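/- Let $R$ be a commutative ring. Let $\mathrm{sMod}_R$ be the category of simplicial $R$-modules, with the degreewise tensor product and internal hom $(B^A)_n=\operatorname{Hom}_{\mathrm{sMod}_R}(A\otimes R\Delta^n,B)$. Let $\mathrm{Ch}_{\ge 0}(R)$ be the category of non-negatively graded chain complexes, with tensor product differential $d(x\otimes y)=dx\otimes y+(-1)^{|x|}x\otimes dy$ and internal hom $D^C$ given by $$(D^C)_n=\prod_{p\ge 0}\operatorname{Hom}_R(C_p,D_{p+n})\ (n\ge 1),\qquad (D^C)_0=\operatorname{Hom}_{\mathrm{Ch}_{\ge0}(R)}(C,D),\qquad df=d\circ f-(-1)^{|f|}f\circ d .$$ Let $N\colon \mathrm{sMod}_R\rightleftarrows \mathrm{Ch}_{\ge 0}(R)\colon\Gamma$ be the Dold–Kan equivalence ($N$ is the normalized chain complex), and let $$\mathrm{AW}\colon N(A\otimes B)\to N(A)\otimes N(B),\qquad \mathrm{EZ}\colon N(A)\otimes N(B)\to N(A\otimes B)$$ be the Alexander–Whitney map (front face tensor back face) and the Eilenberg–Zilber shuffle map. 1. For all $C,D\in \mathrm{Ch}_{\ge 0}(R)$, identify $$\Gamma(D^C)\cong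 \operatorname{Hom}_{\mathrm{Ch}_{\ge 0}(R)}(C\otimes N(R\Delta^\bullet),D),\qquad \Gamma(D)^{\Gamma(C)}\cong \operatorname{Hom}_{\mathrm{Ch}_{\ge 0}(R)}(N(\Gamma C\otimes R\Delta^\bullet),D)$$ by the Yoneda lemma, the Dold–Kan equivalence and the tensor–hom adjunction. Restriction along $N(\Gamma C\otimes R\Delta^n)\xrightarrow{\mathrm{AW}}N(\Gamma C)\otimes N(R\Delta^n)\cong C\otimes N(R\Delta^n)$ defines a map of simplicial $R$-modules $$\mathrm{AW}^*\colon \Gamma(D^C)\to\Gamma(D)^{\Gamma(C)},$$ and restriction along $\mathrm{EZ}$ defines a map $\mathrm{EZ}^*$ in the opposite direction. The map $\mathrm{AW}^*$ is natural in $C$ and $D$, and it is a simplicial homotopy equivalence with homotopy inverse $\mathrm{EZ}^*$: both $\mathrm{EZ}^*\circ\mathrm{AW}^*$ and $\mathrm{AW}^*\circ\mathrm{EZ}^*$ are simplicially homotopic to the identity. 2. For all $A,B\in \mathrm{sMod}_R$, apply $N$ to the restriction maps along $\mathrm{AW}$ and $\mathrm{EZ}$ between $\operatorname{Hom}_{\mathrm{Ch}_{\ge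 0}(R)}(N(A)\otimes N(R\Delta^\bullet),N(B))\cong\Gamma(N(B)^{N(A)})$ and $\operatorname{Hom}_{\mathrm{Ch}_{\ge 0}(R)}(N(A\otimes R\Delta^\bullet),N(B))\cong B^A$, and use $N\Gamma\cong\mathrm{id}$. This gives chain maps $$\mathrm{AW}^*\colon N(B)^{N(A)}\to N(B^A),\qquad \mathrm{EZ}^*\colon N(B^A)\to N(B)^{N(A)}.$$ The map $\mathrm{AW}^*$ is natural in $A$ and $B$, and it is a chain homotopy equivalence with homotopy inverse $\mathrm{EZ}^*$. -/

import Mathlib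

open CategoryTheory MonoidalCategory Opposite Simplicial

universe u

namespace DoldKanHom

noncomputable section

open SimplexCategory AlgebraicTopology

/-- A pair of order-preserving maps `f : [n] → [p]` and `g : [n] → [q]` with `f i + g i = i`, that is, a
lattice path from `(0, 0)`. For `p + q = n` it ends at `(p, q)`, and such pairs are exactly the
`(p, q)`-shuffles: the steps of `f` are the degeneracy indices of `g` and conversely. -/
def IsShuffle {n p q : ℕ} (f : ⦋n⦌ ⟶ ⦋p⦌) (g : ⦋n⦌ ⟶ ⦋q⦌) : Prop :=
  ∀ i, (f.toOrderHom i : ℕ) + (g.toOrderHom i : ℕ) = i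

/-- The number of pairs of a step of `g` that precedes a step of `f`; its parity gives the sign of the
shuffle. -/
def shuffleInversions {n p q : ℕ} (f : ⦋n⦌ ⟶ ⦋p⦌) (g : ⦋n⦌ ⟶ ⦋q⦌) : ℕ :=
  ∑ i : Fin n, ((f.toOrderHom i.succ : ℕ) - f.toOrderHom i.castSucc) * g.toOrderHom i.castSucc

theorem sum_heights {n : ℕ} (a b : Fin (n + 1) → ℕ) (h : ∀ i, a i + b i = i)
    (ha : Monotone a) (hb : Monotone b) :
    ∑ i : Fin n, (a i.succ - a i.castSucc) * b i.castSucc +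
      ∑ k ∈ Finset.range (b (Fin.last n) + 1), k = ∑ j, b j := by
  induction n with
  | zero =>
    have := h 0
    simp at this
    simp [this]
  | succ n ih =>
    have ih' := ih (fun i => a i.castSucc) (fun i => b i.castSucc) (fun i => by simpa using h i.castSucc)
      (fun i j hij => ha (by simpa using hij)) (fun i j hij => hb (by simpa using hij))
    rw [Fin.sum_univ_castSucc, Fin.sum_univ_castSucc b, ← ih']
    have e1 := h (Fin.last n).castSucc
    have e2 := h (Fin.last (n+1))
    have e3 := ha (show (Fin.last n).castSucc ≤ Fin.last (n+1) from Fin.le_last _)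
    have e4 := hb (show (Fin.last n).castSucc ≤ Fin.last (n+1) from Fin.le_last _)
    simp only [Fin.val_castSucc, Fin.val_last] at e1 e2
    simp only [Fin.succ_castSucc, Fin.succ_last]
    have : b (Fin.last (n+1)) = b (Fin.last n).castSucc ∧ a (Fin.last (n+1)) = a (Fin.last n).castSucc + 1 ∨
       b (Fin.last (n+1)) = b (Fin.last n).castSucc + 1 ∧ a (Fin.last (n+1)) = a (Fin.last n).castSucc := by omega
    rcases this with ⟨h1, h2⟩ | ⟨h1, h2⟩
    · rw [h1, h2, Nat.add_sub_cancel_left]; ring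
    · rw [h1, h2, Nat.sub_self, Finset.sum_range_succ _ (_ + 1)]; ring

theorem toOrderHom_δ {n : ℕ} (i : Fin (n + 2)) (j : Fin (n + 1)) :
    (δ i).toOrderHom j = i.succAbove j := rfl

theorem toOrderHom_σ {n : ℕ} (i : Fin (n + 1)) (j : Fin (n + 2)) :
    (σ i).toOrderHom j = i.predAbove j := rfl

theorem toOrderHom_comp {a b c : SimplexCategory} (f : a ⟶ b) (g : b ⟶ c) (j) :
    (f ≫ g).toOrderHom j = g.toOrderHom (f.toOrderHom j) := rfl

theorem IsShuffle.last {n p q : ℕ} {f : ⦋n⦌ ⟶ ⦋p⦌} {g : ⦋n⦌ ⟶ ⦋q⦌} (h : IsShuffle f g)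
    (hn : p + q = n) : (f.toOrderHom (Fin.last n) : ℕ) = p ∧ (g.toOrderHom (Fin.last n) : ℕ) = q := by
  have h1 := h (Fin.last n)
  have h2 := (f.toOrderHom (Fin.last n)).is_lt
  have h3 := (g.toOrderHom (Fin.last n)).is_lt
  simp only [SimplexCategory.len_mk, Fin.val_last] at h1 h2 h3
  have e : ((Fin.last n : Fin (n+1)) : ℕ) = n := rfl
  omega

theorem IsShuffle.inversions {n p q : ℕ} {f : ⦋n⦌ ⟶ ⦋p⦌} {g : ⦋n⦌ ⟶ ⦋q⦌} (h : IsShuffle f g)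
    (hn : p + q = n) :
    shuffleInversions f g + ∑ k ∈ Finset.range (q + 1), k =
      ∑ j : Fin (n + 1), (g.toOrderHom j : ℕ) := by
  have := sum_heights (fun j : Fin (n+1) => (f.toOrderHom j : ℕ)) (fun j => (g.toOrderHom j : ℕ)) h
    (fun i j hij => f.toOrderHom.monotone hij) (fun i j hij => g.toOrderHom.monotone hij)
  rw [(h.last hn).2] at this
  exact this

theorem IsShuffle.symm {n p q : ℕ} {f : ⦋n⦌ ⟶ ⦋p⦌} {g : ⦋n⦌ ⟶ ⦋q⦌} (h : IsShuffle f g) :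
    IsShuffle g f := fun i => by rw [add_comm]; exact h i

theorem IsShuffle.inversions_symm {n p q : ℕ} {f : ⦋n⦌ ⟶ ⦋p⦌} {g : ⦋n⦌ ⟶ ⦋q⦌}
    (h : IsShuffle f g) (hn : p + q = n) :
    shuffleInversions f g + shuffleInversions g f = p * q := by
  have h1 := h.inversions hn
  have h2 := h.symm.inversions (by omega)
  have h3 : ∑ j : Fin (n + 1), (f.toOrderHom j : ℕ) + ∑ j : Fin (n + 1), (g.toOrderHom j : ℕ) =
      ∑ k ∈ Finset.range (n + 1), k := by
    rw [← Finset.sum_add_distrib, Finset.sum_congr rfl (fun j _ => h j), Fin.sum_univ_eq_sum_range (fun j => j)]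
  have t (m : ℕ) := Finset.sum_range_id_mul_two (m + 1)
  have t1 := t p
  have t2 := t q
  have t3 := t n
  simp only [Nat.add_sub_cancel] at t1 t2 t3
  subst hn
  zify at *
  linarith

theorem IsShuffle.corner {n p q : ℕ} {f : ⦋n + 1⦌ ⟶ ⦋p⦌} {g : ⦋n + 1⦌ ⟶ ⦋q⦌} (h : IsShuffle f g)
    {i : Fin (n + 2)} (hf : ∃ j, j ≠ i ∧ f.toOrderHom j = f.toOrderHom i)
    (hg : ∃ j, j ≠ i ∧ g.toOrderHom j = g.toOrderHom i) :
    ∃ m : Fin n, i = m.succ.castSucc ∧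
      ((f.toOrderHom i = f.toOrderHom m.castSucc.castSucc ∧
          g.toOrderHom i = g.toOrderHom m.succ.succ ∧
          (g.toOrderHom i : ℕ) = g.toOrderHom m.castSucc.castSucc + 1 ∧
          (f.toOrderHom m.succ.succ : ℕ) = f.toOrderHom i + 1) ∨
       (f.toOrderHom i = f.toOrderHom m.succ.succ ∧
          g.toOrderHom i = g.toOrderHom m.castSucc.castSucc ∧
          (f.toOrderHom i : ℕ) = f.toOrderHom m.castSucc.castSucc + 1 ∧
          (g.toOrderHom m.succ.succ : ℕ) = g.toOrderHom i + 1)) := by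
  obtain ⟨j, hj, ej⟩ := hf
  obtain ⟨l, hl, el⟩ := hg
  have mf {a b : Fin (n + 2)} (hab : a ≤ b) : (f.toOrderHom a : ℕ) ≤ f.toOrderHom b :=
    f.toOrderHom.monotone hab
  have mg {a b : Fin (n + 2)} (hab : a ≤ b) : (g.toOrderHom a : ℕ) ≤ g.toOrderHom b :=
    g.toOrderHom.monotone hab
  have ej' := congrArg Fin.val ej
  have el' := congrArg Fin.val el
  have hi := h i
  have hj' := h j
  have hl' := h l
  have key : (j < i ∧ i < l) ∨ (l < i ∧ i < j) := by
    rcases lt_or_gt_of_ne hj with h1 | h1 <;> rcases lt_or_gt_of_ne hl with h2 | h2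
    · exfalso
      rcases le_total j l with h3 | h3
      · have := mf h3; have := mf h2.le; simp only [Fin.lt_def] at h1 h2; omega
      · have := mg h3; have := mg h1.le; simp only [Fin.lt_def] at h1 h2; omega
    · exact Or.inl ⟨h1, h2⟩
    · exact Or.inr ⟨h2, h1⟩
    · exfalso
      rcases le_total j l with h3 | h3
      · have := mg h3; have := mg h1.le; simp only [Fin.lt_def] at h1 h2; omega
      · have := mf h3; have := mf h2.le; simp only [Fin.lt_def] at h1 h2; omega
  have hpos : 0 < (i : ℕ) ∧ (i : ℕ) < n + 1 := by
    simp only [Fin.lt_def] at key; have := j.is_lt; have := l.is_lt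
    simp only [SimplexCategory.len_mk] at *
    omega
  obtain ⟨m, rfl⟩ : ∃ m : Fin n, i = m.succ.castSucc :=
    ⟨⟨i - 1, by omega⟩, by ext; simp; omega⟩
  refine ⟨m, rfl, ?_⟩
  have ha := h m.castSucc.castSucc
  have hb := h m.succ.succ
  have l1 : m.castSucc.castSucc ≤ m.succ.castSucc := by simp [Fin.le_def]
  have l2 : m.succ.castSucc ≤ m.succ.succ := by simp [Fin.le_def]
  simp only [Fin.ext_iff]
  simp only [Fin.val_castSucc, Fin.val_succ] at ha hb hi
  rcases key with ⟨h1, h2⟩ | ⟨h1, h2⟩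
  · left
    have k1 := mf (show j ≤ m.castSucc.castSucc by simp [Fin.le_def, Fin.lt_def] at h1 ⊢; omega)
    have k2 := mg (show m.succ.succ ≤ l by simp [Fin.le_def, Fin.lt_def] at h2 ⊢; omega)
    have := mf l1; have := mg l2; have := mg l1; have := mf l2
    omega
  · right
    have k1 := mg (show l ≤ m.castSucc.castSucc by simp [Fin.le_def, Fin.lt_def] at h1 ⊢; omega)
    have k2 := mf (show m.succ.succ ≤ j by simp [Fin.le_def, Fin.lt_def] at h2 ⊢; omega)
    have := mf l1; have := mg l2; have := mg l1; have := mf l2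
    omega

theorem IsShuffle.inversions_succAbove {n p q : ℕ} {f : ⦋n + 1⦌ ⟶ ⦋p⦌} {g : ⦋n + 1⦌ ⟶ ⦋q⦌}
    (h : IsShuffle f g) (hn : p + q = n + 1) (i : Fin (n + 2)) :
    shuffleInversions f g + ∑ k ∈ Finset.range (q + 1), k =
      g.toOrderHom i + ∑ j : Fin (n + 1), ((δ i ≫ g).toOrderHom j : ℕ) := by
  rw [h.inversions hn, Fin.sum_univ_succAbove _ i]
  rfl

theorem hom_ext_succAbove {n p : ℕ} {f f' : ⦋n + 1⦌ ⟶ ⦋p⦌} (i : Fin (n + 2))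
    (h : δ i ≫ f = δ i ≫ f') (h' : f.toOrderHom i = f'.toOrderHom i) : f = f' := by
  ext j : 3
  refine Fin.succAboveCases i h' (fun j => ?_) j
  exact congrArg (fun f => f.toOrderHom j) h

theorem toOrderHom_of_ne {n p : ℕ} {f f' : ⦋n + 1⦌ ⟶ ⦋p⦌} {i j : Fin (n + 2)}
    (h : δ i ≫ f = δ i ≫ f') (hj : j ≠ i) : f.toOrderHom j = f'.toOrderHom j := by
  obtain ⟨l, rfl⟩ := Fin.exists_succAbove_eq hj
  exact congrArg (fun f => f.toOrderHom l) h

theorem shuffle_corner {M : Type*} [AddCommGroup M] {n p q : ℕ} (hn : p + q = n + 1)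
    (Φ : (⦋n⦌ ⟶ ⦋p⦌) → (⦋n⦌ ⟶ ⦋q⦌) → M) (i : Fin (n + 2))
    (S : Finset ((⦋n + 1⦌ ⟶ ⦋p⦌) × (⦋n + 1⦌ ⟶ ⦋q⦌)))
    (hS : ∀ x, x ∈ S ↔ IsShuffle x.1 x.2 ∧ (∃ j, j ≠ i ∧ x.1.toOrderHom j = x.1.toOrderHom i) ∧
      ∃ j, j ≠ i ∧ x.2.toOrderHom j = x.2.toOrderHom i) :
    ∑ x ∈ S, (-1 : ℤ) ^ shuffleInversions x.1 x.2 • Φ (δ i ≫ x.1) (δ i ≫ x.2) = 0 := by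
  classical
  by_cases hm : ∃ m : Fin n, i = m.succ.castSucc
  swap
  · rw [Finset.sum_eq_zero]
    intro x hx
    obtain ⟨h1, h2, h3⟩ := (hS x).1 hx
    obtain ⟨m, hm', -⟩ := h1.corner h2 h3
    exact absurd ⟨m, hm'⟩ hm
  obtain ⟨m, rfl⟩ := hm
  set i : Fin (n + 2) := m.succ.castSucc with hi
  have dlo : δ i ≫ σ m.castSucc = 𝟙 _ := δ_comp_σ_succ' rfl
  have dhi : δ i ≫ σ m.succ = 𝟙 _ := δ_comp_σ_self' rfl
  have ne1 : m.castSucc.castSucc ≠ i := by simp [hi, Fin.ext_iff]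
  have ne2 : m.succ.succ ≠ i := by simp [hi, Fin.ext_iff]
  let lo {r : ℕ} (f : ⦋n + 1⦌ ⟶ ⦋r⦌) : ⦋n + 1⦌ ⟶ ⦋r⦌ := σ m.castSucc ≫ δ i ≫ f
  let hi' {r : ℕ} (f : ⦋n + 1⦌ ⟶ ⦋r⦌) : ⦋n + 1⦌ ⟶ ⦋r⦌ := σ m.succ ≫ δ i ≫ f
  have lod {r : ℕ} (f : ⦋n + 1⦌ ⟶ ⦋r⦌) : δ i ≫ lo f = δ i ≫ f := by
    simp only [lo]; rw [← Category.assoc, dlo, Category.id_comp]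
  have hid {r : ℕ} (f : ⦋n + 1⦌ ⟶ ⦋r⦌) : δ i ≫ hi' f = δ i ≫ f := by
    simp only [hi']; rw [← Category.assoc, dhi, Category.id_comp]
  have loi {r : ℕ} (f : ⦋n + 1⦌ ⟶ ⦋r⦌) : (lo f).toOrderHom i = f.toOrderHom m.castSucc.castSucc := by
    simp only [lo, toOrderHom_comp, toOrderHom_σ, toOrderHom_δ]
    congr 1
    simp [hi, Fin.predAbove, Fin.succAbove, Fin.lt_def]
  have hii {r : ℕ} (f : ⦋n + 1⦌ ⟶ ⦋r⦌) : (hi' f).toOrderHom i = f.toOrderHom m.succ.succ := by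
    simp only [hi', toOrderHom_comp, toOrderHom_σ, toOrderHom_δ]
    congr 1
    simp [hi, Fin.ext_iff, Fin.predAbove, Fin.succAbove]
  let τ (x : (⦋n + 1⦌ ⟶ ⦋p⦌) × (⦋n + 1⦌ ⟶ ⦋q⦌)) : (⦋n + 1⦌ ⟶ ⦋p⦌) × (⦋n + 1⦌ ⟶ ⦋q⦌) :=
    if x.1.toOrderHom i = x.1.toOrderHom m.castSucc.castSucc then (hi' x.1, lo x.2)
      else (lo x.1, hi' x.2)
  have τd1 (x) : δ i ≫ (τ x).1 = δ i ≫ x.1 := by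
    simp only [τ]; split_ifs <;> simp [lod, hid]
  have τd2 (x) : δ i ≫ (τ x).2 = δ i ≫ x.2 := by
    simp only [τ]; split_ifs <;> simp [lod, hid]
  have shape (x) (hx : x ∈ S) :
      (x.1.toOrderHom i = x.1.toOrderHom m.castSucc.castSucc ∧
        x.2.toOrderHom i = x.2.toOrderHom m.succ.succ ∧
        (x.1.toOrderHom m.succ.succ : ℕ) = x.1.toOrderHom i + 1 ∧
        (x.2.toOrderHom i : ℕ) = x.2.toOrderHom m.castSucc.castSucc + 1 ∧
        (τ x).1.toOrderHom i = x.1.toOrderHom m.succ.succ ∧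
        (τ x).2.toOrderHom i = x.2.toOrderHom m.castSucc.castSucc) ∨
      (x.1.toOrderHom i = x.1.toOrderHom m.succ.succ ∧
        x.2.toOrderHom i = x.2.toOrderHom m.castSucc.castSucc ∧
        (x.1.toOrderHom i : ℕ) = x.1.toOrderHom m.castSucc.castSucc + 1 ∧
        (x.2.toOrderHom m.succ.succ : ℕ) = x.2.toOrderHom i + 1 ∧
        (τ x).1.toOrderHom i = x.1.toOrderHom m.castSucc.castSucc ∧
        (τ x).2.toOrderHom i = x.2.toOrderHom m.succ.succ) := by
    have h := (hS x).1 hx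
    obtain ⟨m', hm', h'⟩ := h.1.corner h.2.1 h.2.2
    have : m' = m := by
      simp only [hi, Fin.ext_iff, Fin.val_castSucc, Fin.val_succ] at hm' ⊢; omega
    subst this
    rcases h' with ⟨h1, h2, h3, h4⟩ | ⟨h1, h2, h3, h4⟩
    · exact Or.inl ⟨h1, h2, h4, h3, by simp only [τ, if_pos h1, hii, loi]; simp⟩
    · have hc : x.1.toOrderHom i ≠ x.1.toOrderHom m'.castSucc.castSucc := by
        intro hc; rw [hc] at h3; omega
      exact Or.inr ⟨h1, h2, h3, h4, by simp only [τ, if_neg hc, hii, loi]; simp⟩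
  have sh (x) (hx : x ∈ S) : IsShuffle (τ x).1 (τ x).2 := by
    intro j
    have h0 := ((hS x).1 hx).1
    by_cases hj : j = i
    · subst hj
      have a0 := h0 i
      rcases shape x hx with ⟨c1, c2, c3, c4, c5, c6⟩ | ⟨c1, c2, c3, c4, c5, c6⟩ <;>
        rw [c5, c6] <;> omega
    · rw [toOrderHom_of_ne (τd1 x) hj, toOrderHom_of_ne (τd2 x) hj]; exact h0 j
  have ττ (x) (hx : x ∈ S) : τ (τ x) = x := by
    have lolo {r : ℕ} (f f' : ⦋n + 1⦌ ⟶ ⦋r⦌) (h : δ i ≫ f' = δ i ≫ f) : lo f' = lo f := by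
      simp only [lo, h]
    have hihi {r : ℕ} (f f' : ⦋n + 1⦌ ⟶ ⦋r⦌) (h : δ i ≫ f' = δ i ≫ f) : hi' f' = hi' f := by
      simp only [hi', h]
    rcases shape x hx with ⟨c1, c2, c3, c4, c5, c6⟩ | ⟨c1, c2, c3, c4, c5, c6⟩
    · have e : (τ x).1.toOrderHom i ≠ (τ x).1.toOrderHom m.castSucc.castSucc := by
        rw [c5, toOrderHom_of_ne (τd1 x) ne1, ← c1]; intro hh; rw [hh] at c3; omega
      have : τ (τ x) = (lo x.1, hi' x.2) := by
        simp only [τ] at e ⊢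
        rw [if_neg e]; exact Prod.ext (lolo _ _ (τd1 x)) (hihi _ _ (τd2 x))
      rw [this]
      exact Prod.ext (hom_ext_succAbove i (lod _) (by rw [loi, c1]))
        (hom_ext_succAbove i (hid _) (by rw [hii, c2]))
    · have e : (τ x).1.toOrderHom i = (τ x).1.toOrderHom m.castSucc.castSucc := by
        rw [c5, toOrderHom_of_ne (τd1 x) ne1]
      have : τ (τ x) = (hi' x.1, lo x.2) := by
        simp only [τ] at e ⊢
        rw [if_pos e]; exact Prod.ext (hihi _ _ (τd1 x)) (lolo _ _ (τd2 x))
      rw [this]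
      exact Prod.ext (hom_ext_succAbove i (hid _) (by rw [hii, c1]))
        (hom_ext_succAbove i (lod _) (by rw [loi, c2]))
  refine Finset.sum_involution (fun x _ => τ x) ?_ ?_ ?_ ?_
  · intro x hx
    simp only [τd1, τd2]
    rw [← add_smul]
    convert zero_smul ℤ _
    have h1 := ((hS x).1 hx).1.inversions_succAbove hn i
    have h2 := (sh x hx).inversions_succAbove hn i
    rw [τd2] at h2
    rcases shape x hx with ⟨c1, c2, c3, c4, c5, c6⟩ | ⟨c1, c2, c3, c4, c5, c6⟩ <;> rw [c6] at h2
    · have : shuffleInversions x.1 x.2 = shuffleInversions (τ x).1 (τ x).2 + 1 := by omega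
      rw [this, pow_succ]; ring
    · have : shuffleInversions (τ x).1 (τ x).2 = shuffleInversions x.1 x.2 + 1 := by omega
      rw [this, pow_succ]; ring
  · intro x hx _ he
    have : (τ x).2.toOrderHom i = x.2.toOrderHom i := by rw [he]
    rcases shape x hx with ⟨c1, c2, c3, c4, c5, c6⟩ | ⟨c1, c2, c3, c4, c5, c6⟩ <;> rw [c6] at this
    · rw [this] at c4; omega
    · rw [this] at c4; omega
  · intro x hx
    refine (hS _).2 ⟨sh x hx, ?_⟩
    rcases shape x hx with ⟨c1, c2, c3, c4, c5, c6⟩ | ⟨c1, c2, c3, c4, c5, c6⟩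
    · exact ⟨⟨_, ne2, by rw [c5, toOrderHom_of_ne (τd1 x) ne2]⟩,
        ⟨_, ne1, by rw [c6, toOrderHom_of_ne (τd2 x) ne1]⟩⟩
    · exact ⟨⟨_, ne1, by rw [c5, toOrderHom_of_ne (τd1 x) ne1]⟩,
        ⟨_, ne2, by rw [c6, toOrderHom_of_ne (τd2 x) ne2]⟩⟩
  · exact ττ

theorem val_succAbove {n : ℕ} (i : Fin (n + 1)) (j : Fin n) :
    (i.succAbove j : ℕ) = if (j : ℕ) < i then (j : ℕ) else j + 1 := by
  simp only [Fin.succAbove, Fin.lt_def, Fin.val_castSucc]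
  split_ifs <;> simp

theorem exists_cut {n r : ℕ} (f : ⦋n⦌ ⟶ ⦋r⦌) (k : ℕ) :
    ∃ i : Fin (n + 2), ∀ j : Fin (n + 1), (f.toOrderHom j : ℕ) < k ↔ (j : ℕ) < i := by
  classical
  by_cases h : ∃ j : ℕ, ∃ hj : j < n + 1, k ≤ f.toOrderHom ⟨j, hj⟩
  · obtain ⟨h1, h2⟩ := Nat.find_spec h
    refine ⟨⟨Nat.find h, by omega⟩, fun j => ⟨fun hj => ?_, fun hj => ?_⟩⟩
    · by_contra hc
      have : (f.toOrderHom ⟨Nat.find h, h1⟩ : ℕ) ≤ f.toOrderHom j :=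
        f.toOrderHom.monotone (show (⟨Nat.find h, h1⟩ : Fin (n + 1)) ≤ j by
          simp only [Fin.le_def]; simp at hc; simpa using hc)
      omega
    · by_contra hc
      exact Nat.find_min h hj ⟨j.is_lt, by simpa using hc⟩
  · push Not at h
    exact ⟨Fin.last _, fun j => ⟨fun _ => j.is_lt, fun _ => h j j.is_lt⟩⟩

theorem shuffle_column {M : Type*} [AddCommGroup M] {n p q : ℕ} (hn : p + q = n)
    (Φ : (⦋n⦌ ⟶ ⦋p + 1⦌) → (⦋n⦌ ⟶ ⦋q⦌) → M)
    (S : Finset (Fin (n + 2) × (⦋n + 1⦌ ⟶ ⦋p + 1⦌) × (⦋n + 1⦌ ⟶ ⦋q⦌)))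
    (hS : ∀ x, x ∈ S ↔ IsShuffle x.2.1 x.2.2 ∧
      ∀ j, x.2.1.toOrderHom j = x.2.1.toOrderHom x.1 → j = x.1)
    (S' : Finset (Fin (p + 2) × (⦋n⦌ ⟶ ⦋p⦌) × (⦋n⦌ ⟶ ⦋q⦌)))
    (hS' : ∀ x, x ∈ S' ↔ IsShuffle x.2.1 x.2.2) :
    ∑ x ∈ S, (-1 : ℤ) ^ (x.1 + shuffleInversions x.2.1 x.2.2) • Φ (δ x.1 ≫ x.2.1) (δ x.1 ≫ x.2.2) =
    ∑ x ∈ S', (-1 : ℤ) ^ (x.1 + shuffleInversions x.2.1 x.2.2) • Φ (x.2.1 ≫ δ x.1) x.2.2 := by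
  have fac (x) (hx : x ∈ S) : factor_δ (δ x.1 ≫ x.2.1) (x.2.1.toOrderHom x.1) ≫
      δ (x.2.1.toOrderHom x.1) = δ x.1 ≫ x.2.1 := by
    apply factor_δ_spec
    intro k hk
    exact Fin.succAbove_ne x.1 k (((hS x).1 hx).2 _ hk)
  have fval (x) (hx : x ∈ S) (j) := congrArg (fun f => (f.toOrderHom j : ℕ)) (fac x hx)
  simp only [toOrderHom_comp, toOrderHom_δ] at fval
  -- a vertex lies before the one that is removed exactly if its column does
  have before (x) (hx : x ∈ S) (j : Fin (n + 1)) :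
      ((factor_δ (δ x.1 ≫ x.2.1) (x.2.1.toOrderHom x.1)).toOrderHom j : ℕ) <
        x.2.1.toOrderHom x.1 ↔ (j : ℕ) < x.1 := by
    have h1 := fval x hx j
    have h2 := ((hS x).1 hx).2 (x.1.succAbove j)
    have h3 : (x.1.succAbove j : ℕ) ≤ x.1 →
        (x.2.1.toOrderHom (x.1.succAbove j) : ℕ) ≤ x.2.1.toOrderHom x.1 :=
      fun h => x.2.1.toOrderHom.monotone h
    have h4 : (x.1 : ℕ) ≤ x.1.succAbove j →
        (x.2.1.toOrderHom x.1 : ℕ) ≤ x.2.1.toOrderHom (x.1.succAbove j) :=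
      fun h => x.2.1.toOrderHom.monotone h
    have h5 := mt h2 (Fin.succAbove_ne x.1 j)
    rw [Fin.ext_iff] at h5
    rw [← h1] at h3 h4 h5
    rw [val_succAbove] at h3 h4
    erw [val_succAbove] at h3 h4 h5
    grind
  have sh (x) (hx : x ∈ S) : IsShuffle (factor_δ (δ x.1 ≫ x.2.1) (x.2.1.toOrderHom x.1))
      (δ x.1 ≫ x.2.2) := by
    intro j
    have h1 := fval x hx j
    have h2 := before x hx j
    have h3 := ((hS x).1 hx).1 (x.1.succAbove j)
    rw [toOrderHom_comp, toOrderHom_δ]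
    rw [val_succAbove x.1] at h3
    erw [val_succAbove] at h1
    grind
  refine Finset.sum_bij (fun x _ => (x.2.1.toOrderHom x.1,
    factor_δ (δ x.1 ≫ x.2.1) (x.2.1.toOrderHom x.1), δ x.1 ≫ x.2.2)) ?_ ?_ ?_ ?_
  · exact fun x hx => (hS' _).2 (sh x hx)
  · rintro ⟨i, f, g⟩ hx ⟨i', f', g'⟩ hy h
    simp only [Prod.mk.injEq] at h
    obtain ⟨h1, h2, h3⟩ := h
    have hi : i = i' := by
      have b1 := before _ hx
      have b2 := before _ hy
      have f1 := fac _ hx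
      simp only at b1 b2
      rw [← h2, ← h1] at b2
      have b3 (j : Fin (n + 1)) := (b1 j).symm.trans (b2 j)
      by_contra hne
      rcases lt_or_gt_of_ne hne with hlt | hlt <;> simp only [Fin.lt_def] at hlt
      · have := b3 ⟨i, by omega⟩; simp at this; omega
      · have := b3 ⟨i', by omega⟩; simp at this; omega
    subst hi
    have f1 := fac _ hx
    have f2 := fac _ hy
    simp only at f1 f2
    rw [← h2, ← h1] at f2
    have hf : f = f' := hom_ext_succAbove i (f1.symm.trans f2) h1
    subst hf
    have hg : g = g' := by
      refine hom_ext_succAbove i h3 ?_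
      have e1 := ((hS _).1 hx).1 i
      have e2 := ((hS _).1 hy).1 i
      ext
      simp only at e1 e2
      omega
    rw [hg]
  · rintro ⟨k, f', g'⟩ hx
    have h0 := (hS' _).1 hx
    simp only at h0
    obtain ⟨i, hi⟩ := exists_cut f' k
    have mf : Monotone (i.insertNth k (fun j => k.succAbove (f'.toOrderHom j)) :
        Fin (n + 2) → Fin (p + 2)) := by
      intro a b
      refine Fin.succAboveCases i ?_ (fun a => ?_) a <;>
        refine Fin.succAboveCases i ?_ (fun b => ?_) b
      · intro; rfl
      · intro hab
        rw [Fin.insertNth_apply_same, Fin.insertNth_apply_succAbove]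
        have := hi b
        simp only [Fin.le_def, val_succAbove] at hab ⊢
        grind
      · intro hab
        rw [Fin.insertNth_apply_same, Fin.insertNth_apply_succAbove]
        have := hi a
        simp only [Fin.le_def, val_succAbove] at hab ⊢
        grind
      · intro hab
        rw [Fin.insertNth_apply_succAbove, Fin.insertNth_apply_succAbove]
        exact Fin.succAbove_le_succAbove_iff.2
          (f'.toOrderHom.monotone (Fin.succAbove_le_succAbove_iff.1 hab))
    let f : ⦋n + 1⦌ ⟶ ⦋p + 1⦌ := mkHom ⟨_, mf⟩
    let g : ⦋n + 1⦌ ⟶ ⦋q⦌ := σ (Fin.predAbove 0 i) ≫ g'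
    have fi : f.toOrderHom i = k := by
      change (i.insertNth k (fun j => k.succAbove (f'.toOrderHom j)) : Fin (n + 2) → Fin (p + 2)) i = k
      rw [Fin.insertNth_apply_same]
    have fj (j : Fin (n + 1)) : f.toOrderHom (i.succAbove j) = k.succAbove (f'.toOrderHom j) := by
      change (i.insertNth k (fun j => k.succAbove (f'.toOrderHom j)) : Fin (n + 2) → Fin (p + 2))
        (i.succAbove j) = _
      rw [Fin.insertNth_apply_succAbove]
    have gd : δ i ≫ g = g' := by
      have : δ i ≫ σ (Fin.predAbove 0 i) = 𝟙 _ := by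
        rcases Fin.eq_zero_or_eq_succ i with rfl | ⟨m, rfl⟩
        · exact δ_comp_σ_self' rfl
        · exact δ_comp_σ_succ' (by simp)
      simp only [g]
      rw [← Category.assoc, this, Category.id_comp]
    have gi : (g.toOrderHom i : ℕ) + k = i := by
      simp only [g, toOrderHom_comp, toOrderHom_σ]
      rcases Fin.eq_zero_or_eq_succ i with rfl | ⟨m, rfl⟩
      · have h1 := hi 0
        have h2 := h0 (0 : Fin (n + 1))
        simp at h1 h2
        simp only [h2.1, Fin.val_zero, Nat.le_zero] at h1
        simp [h1, h2.2]
      · have h1 := hi m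
        have h2 := h0 m
        have e : Fin.predAbove (Fin.predAbove 0 m.succ) m.succ = m := by simp
        rw [e]
        simp only [Fin.val_succ] at h1 ⊢
        by_cases hm : (m : ℕ) = n
        · have := h0.last hn
          have e : m = Fin.last n := Fin.ext hm
          rw [← e] at this
          have := k.is_lt
          omega
        · have h3 := hi ⟨m + 1, by omega⟩
          have h4 := h0 (⟨m + 1, by omega⟩ : Fin (n + 1))
          have h5 : (g'.toOrderHom m : ℕ) ≤ g'.toOrderHom (⟨m + 1, by omega⟩ : Fin (n + 1)) :=
            g'.toOrderHom.monotone (by simp [Fin.le_def])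
          simp only [Fin.val_succ] at h3 h4
          omega
    have hs : IsShuffle f g := by
      intro j
      refine Fin.succAboveCases i ?_ (fun j => ?_) j
      · rw [fi, ← gi]; omega
      · have e : g.toOrderHom (i.succAbove j) = g'.toOrderHom j :=
          congrArg (fun g => g.toOrderHom j) gd
        have := h0 j
        have := hi j
        rw [fj, e]
        erw [val_succAbove]
        rw [val_succAbove]
        grind
    have hm : (i, f, g) ∈ S := by
      refine (hS _).2 ⟨hs, fun j hj => ?_⟩
      by_contra hne
      obtain ⟨l, rfl⟩ := Fin.exists_succAbove_eq hne
      simp only [fi, fj] at hj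
      exact Fin.succAbove_ne _ _ hj
    refine ⟨(i, f, g), hm, ?_⟩
    have f1 := fac _ hm
    simp only [fi] at f1 ⊢
    refine Prod.ext rfl (Prod.ext ?_ gd)
    simp only
    have : δ i ≫ f = f' ≫ δ k := by
      ext j : 3
      exact fj j
    rw [← cancel_mono (δ k), f1, this]
  · intro x hx
    simp only [fac x hx]
    congr 1
    have h0 := ((hS x).1 hx).1
    have h1 := h0.inversions_succAbove (by omega) x.1
    have h2 := (sh x hx).inversions hn
    have h3 := h0 x.1
    have : (x.1 : ℕ) + shuffleInversions x.2.1 x.2.2 = x.2.1.toOrderHom x.1 +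
      shuffleInversions (factor_δ (δ x.1 ≫ x.2.1) (x.2.1.toOrderHom x.1)) (δ x.1 ≫ x.2.2) +
        2 * x.2.2.toOrderHom x.1 := by omega
    rw [this, pow_add _ _ (2 * _), pow_mul]; simp

/-- The finite set of `(p, q)`-shuffles. -/
def shuffles (p q n : ℕ) : Finset ((⦋n⦌ ⟶ ⦋p⦌) × (⦋n⦌ ⟶ ⦋q⦌)) :=
  (Set.toFinite {x | IsShuffle x.1 x.2}).toFinset

theorem mem_shuffles {p q n : ℕ} (x : (⦋n⦌ ⟶ ⦋p⦌) × (⦋n⦌ ⟶ ⦋q⦌)) :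
    x ∈ shuffles p q n ↔ IsShuffle x.1 x.2 := by simp [shuffles]

/-- The signed sum over all `(p, q)`-shuffles. -/
def shuffleSum {M : Type*} [AddCommGroup M] (p q n : ℕ)
    (Φ : (⦋n⦌ ⟶ ⦋p⦌) → (⦋n⦌ ⟶ ⦋q⦌) → M) : M :=
  ∑ x ∈ shuffles p q n, (-1 : ℤ) ^ shuffleInversions x.1 x.2 • Φ x.1 x.2

open Classical in
theorem shuffle_boundary {M : Type*} [AddCommGroup M] {n p q : ℕ} (hn : p + q = n + 1)
    (Φ : (⦋n⦌ ⟶ ⦋p⦌) → (⦋n⦌ ⟶ ⦋q⦌) → M) (X Y : M)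
    (hX0 : p = 0 → X = 0) (hY0 : q = 0 → Y = 0)
    (hX : ∀ p' (e : p = p' + 1), X = ∑ k : Fin (p' + 2), (-1 : ℤ) ^ (k : ℕ) •
      shuffleSum p' q n (fun f g => Φ (f ≫ δ k ≫ eqToHom (by rw [e])) g))
    (hY : ∀ q' (e : q = q' + 1), Y = ∑ k : Fin (q' + 2), (-1 : ℤ) ^ (k : ℕ) •
      shuffleSum p q' n (fun f g => Φ f (g ≫ δ k ≫ eqToHom (by rw [e])))) :
    ∑ i : Fin (n + 2), (-1 : ℤ) ^ (i : ℕ) • shuffleSum p q (n + 1)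
      (fun f g => Φ (δ i ≫ f) (δ i ≫ g)) = X + (-1 : ℤ) ^ p • Y := by
  let Sh := (Finset.univ : Finset (Fin (n + 2))) ×ˢ shuffles p q (n + 1)
  let T (x : Fin (n + 2) × (⦋n + 1⦌ ⟶ ⦋p⦌) × (⦋n + 1⦌ ⟶ ⦋q⦌)) : M :=
    (-1 : ℤ) ^ (x.1 + shuffleInversions x.2.1 x.2.2) • Φ (δ x.1 ≫ x.2.1) (δ x.1 ≫ x.2.2)
  let P (x : Fin (n + 2) × (⦋n + 1⦌ ⟶ ⦋p⦌) × (⦋n + 1⦌ ⟶ ⦋q⦌)) : Prop :=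
    ∀ j, x.2.1.toOrderHom j = x.2.1.toOrderHom x.1 → j = x.1
  let Q (x : Fin (n + 2) × (⦋n + 1⦌ ⟶ ⦋p⦌) × (⦋n + 1⦌ ⟶ ⦋q⦌)) : Prop :=
    ∀ j, x.2.2.toOrderHom j = x.2.2.toOrderHom x.1 → j = x.1
  have hT : ∑ i : Fin (n + 2), (-1 : ℤ) ^ (i : ℕ) • shuffleSum p q (n + 1)
      (fun f g => Φ (δ i ≫ f) (δ i ≫ g)) = ∑ x ∈ Sh, T x := by
    simp only [Sh, T, shuffleSum]
    rw [Finset.sum_product]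
    refine Finset.sum_congr rfl (fun i _ => ?_)
    rw [Finset.smul_sum]
    exact Finset.sum_congr rfl (fun x _ => by rw [smul_smul, pow_add])
  have hSh (x) : x ∈ Sh ↔ IsShuffle x.2.1 x.2.2 := by
    simp only [Sh, Finset.mem_product, Finset.mem_univ, true_and, mem_shuffles]
  have hne (i : Fin (n + 2)) : ∃ j : Fin (n + 2), j ≠ i := exists_ne i
  have hPQ (x) (hx : x ∈ Sh) (h1 : P x) (h2 : Q x) : False := by
    have h0 := (hSh x).1 hx
    obtain ⟨i, f, g⟩ := x
    simp only [P, Q] at h0 h1 h2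
    obtain ⟨a, b, hab, hi⟩ : ∃ a b : Fin (n + 2), (b : ℕ) = a + 1 ∧ (i = a ∨ i = b) := by
      rcases Fin.eq_zero_or_eq_succ i with rfl | ⟨m, rfl⟩
      · exact ⟨0, 1, by simp, Or.inl rfl⟩
      · exact ⟨m.castSucc, m.succ, by simp, Or.inr rfl⟩
    have e1 := h0 a
    have e2 := h0 b
    have hab' : a ≤ b := by simp only [Fin.le_def]; omega
    have hne' : a ≠ b := by rintro rfl; omega
    have m1 : (f.toOrderHom a : ℕ) ≤ f.toOrderHom b := f.toOrderHom.monotone hab'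
    have m2 : (g.toOrderHom a : ℕ) ≤ g.toOrderHom b := g.toOrderHom.monotone hab'
    have : f.toOrderHom a = f.toOrderHom b ∨ g.toOrderHom a = g.toOrderHom b := by
      simp only [Fin.ext_iff]; omega
    rcases hi with rfl | rfl <;> rcases this with h | h
    · exact hne' (h1 b h.symm).symm
    · exact hne' (h2 b h.symm).symm
    · exact hne' (h1 a h)
    · exact hne' (h2 a h)
  have h1 : ∑ x ∈ Sh.filter P, T x = X := by
    rcases p with _ | p'
    · rw [hX0 rfl, Finset.filter_eq_empty_iff.2, Finset.sum_empty]
      intro x _ hP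
      obtain ⟨j, hj⟩ := hne x.1
      exact hj (hP j (Subsingleton.elim (α := Fin 1) _ _))
    · rw [hX p' rfl]
      have := shuffle_column (M := M) (n := n) (p := p') (q := q) (by omega) Φ (Sh.filter P)
        (fun x => by rw [Finset.mem_filter, hSh]) (Finset.univ ×ˢ shuffles p' q n)
        (fun x => by simp only [Finset.mem_product, Finset.mem_univ, true_and, mem_shuffles])
      rw [this, Finset.sum_product]
      refine Finset.sum_congr rfl (fun k _ => ?_)
      rw [shuffleSum, Finset.smul_sum]
      exact Finset.sum_congr rfl (fun x _ => by
        simp only [eqToHom_refl, Category.comp_id]; rw [smul_smul, pow_add])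
  have h2 : ∑ x ∈ Sh.filter Q, T x = (-1 : ℤ) ^ p • Y := by
    rcases q with _ | q'
    · rw [hY0 rfl, Finset.filter_eq_empty_iff.2, Finset.sum_empty, smul_zero]
      intro x _ hQ
      obtain ⟨j, hj⟩ := hne x.1
      exact hj (hQ j (Subsingleton.elim (α := Fin 1) _ _))
    · rw [hY q' rfl]
      let e {a b c : Type} : a × b × c ≃ a × c × b := Equiv.prodCongr (Equiv.refl a) (Equiv.prodComm b c)
      have := shuffle_column (M := M) (n := n) (p := q') (q := p) (by omega)
        (fun g f => (-1 : ℤ) ^ (p * (q' + 1)) • Φ f g) ((Sh.filter Q).map e.toEmbedding)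
        (fun x => by
          rw [Finset.mem_map_equiv, Finset.mem_filter, hSh]
          exact and_congr ⟨IsShuffle.symm, IsShuffle.symm⟩ Iff.rfl)
        ((Finset.univ ×ˢ shuffles p q' n).map e.toEmbedding)
        (fun x => by
          rw [Finset.mem_map_equiv]
          simp only [Finset.mem_product, Finset.mem_univ, true_and, mem_shuffles]
          exact ⟨IsShuffle.symm, IsShuffle.symm⟩)
      rw [Finset.sum_map, Finset.sum_map, Finset.sum_product] at this
      refine Eq.trans ?_ (this.trans ?_)
      · refine Finset.sum_congr rfl (fun x hx => ?_)
        have hs := ((hSh x).1 (Finset.mem_filter.1 hx).1).inversions_symm hn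
        change T x = (-1 : ℤ) ^ ((x.1 : ℕ) + shuffleInversions x.2.2 x.2.1) •
          (-1 : ℤ) ^ (p * (q' + 1)) • Φ (δ x.1 ≫ x.2.1) (δ x.1 ≫ x.2.2)
        simp only [T]
        rw [smul_smul, ← pow_add, ← hs]
        congr 1
        rw [show (x.1 : ℕ) + shuffleInversions x.2.2 x.2.1 + (shuffleInversions x.2.1 x.2.2 +
          shuffleInversions x.2.2 x.2.1) = (x.1 + shuffleInversions x.2.1 x.2.2) +
            2 * shuffleInversions x.2.2 x.2.1 by ring, pow_add _ _ (2 * _), pow_mul]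
        simp
      · rw [Finset.smul_sum]
        refine Finset.sum_congr rfl (fun k _ => ?_)
        rw [shuffleSum, smul_smul, Finset.smul_sum]
        refine Finset.sum_congr rfl (fun x hx => ?_)
        have hs := ((mem_shuffles x).1 hx).inversions_symm (by omega)
        change (-1 : ℤ) ^ ((k : ℕ) + shuffleInversions x.2 x.1) •
          (-1 : ℤ) ^ (p * (q' + 1)) • Φ x.1 (x.2 ≫ δ k) = _
        simp only [eqToHom_refl, Category.comp_id]
        rw [smul_smul, smul_smul, ← pow_add, ← pow_add, ← pow_add]
        congr 1
        rw [mul_add, mul_one, ← hs]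
        rw [show (k : ℕ) + shuffleInversions x.2 x.1 + (shuffleInversions x.1 x.2 +
          shuffleInversions x.2 x.1 + p) = (p + k + shuffleInversions x.1 x.2) +
            2 * shuffleInversions x.2 x.1 by ring, pow_add _ _ (2 * _), pow_mul]
        simp
  have h3 : ∑ x ∈ (Sh.filter (fun x => ¬ P x)).filter (fun x => ¬ Q x), T x = 0 := by
    rw [Finset.filter_filter, Finset.sum_filter]
    simp only [Sh]
    rw [Finset.sum_product]
    refine Finset.sum_eq_zero (fun i _ => ?_)
    rw [← Finset.sum_filter]
    have := shuffle_corner hn Φ i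
      ((shuffles p q (n + 1)).filter (fun x => ¬ P (i, x) ∧ ¬ Q (i, x)))
      (fun x => by
        rw [Finset.mem_filter, mem_shuffles]
        simp only [P, Q, not_forall, exists_prop]
        simp only [and_comm])
    simp only [T, pow_add, ← smul_smul]
    rw [← Finset.smul_sum, this, smul_zero]
  rw [hT, ← Finset.sum_filter_add_sum_filter_not Sh P, h1,
    ← Finset.sum_filter_add_sum_filter_not (Sh.filter (fun x => ¬ P x)) Q, h3, add_zero, ← h2]
  congr 2
  ext x
  simp only [Finset.mem_filter]
  exact ⟨fun h => ⟨h.1.1, h.2⟩, fun h => ⟨⟨h.1, fun hP => hPQ x h.1 hP h.2⟩, h.2⟩⟩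

variable {R : Type u} [CommRing R]

/-- The unnormalized chain complex of a simplicial module, with differential the alternating sum of the
faces. -/
abbrev chains : SimplicialObject (ModuleCat.{u} R) ⥤ ChainComplex (ModuleCat.{u} R) ℕ :=
  alternatingFaceMapComplex (ModuleCat.{u} R)

/-- The shuffle map `A_p ⊗ B_q → A_n ⊗ B_n`, the signed sum over shuffles of degeneracies. -/
def ezTerm (A B : SimplicialObject (ModuleCat.{u} R)) (p q n : ℕ) :
    (chains.obj A).X p ⊗ (chains.obj B).X q ⟶ (chains.obj (A ⊗ B)).X n :=
  shuffleSum (M := A _⦋p⦌ ⊗ B _⦋q⦌ ⟶ A _⦋n⦌ ⊗ B _⦋n⦌) p q n (fun f g => A.map f.op ⊗ₘ B.map g.op)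

theorem zsmul_whiskerRight {X Y : ModuleCat.{u} R} (n : ℤ) (f : X ⟶ Y) (Z : ModuleCat.{u} R) :
    (n • f) ▷ Z = n • f ▷ Z := ((tensorRight Z).map_zsmul)

theorem whiskerLeft_zsmul {X Y : ModuleCat.{u} R} (n : ℤ) (f : X ⟶ Y) (Z : ModuleCat.{u} R) :
    Z ◁ (n • f) = n • Z ◁ f := ((tensorLeft Z).map_zsmul)

theorem ezTerm_d (A B : SimplicialObject (ModuleCat.{u} R)) {p q n : ℕ} (hn : p + q = n + 1) :
    ezTerm A B p q (n + 1) ≫ (chains.obj (A ⊗ B)).d (n + 1) n =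
      (chains.obj A).d p (p - 1) ▷ (chains.obj B).X q ≫ ezTerm A B (p - 1) q n +
      (-1 : ℤ) ^ p • (chains.obj A).X p ◁ (chains.obj B).d q (q - 1) ≫ ezTerm A B p (q - 1) n := by
  refine Eq.trans ?_ (shuffle_boundary (M := A _⦋p⦌ ⊗ B _⦋q⦌ ⟶ A _⦋n⦌ ⊗ B _⦋n⦌) hn
    (fun f g => A.map f.op ⊗ₘ B.map g.op)
    ((chains.obj A).d p (p - 1) ▷ (chains.obj B).X q ≫ ezTerm A B (p - 1) q n)
    ((chains.obj A).X p ◁ (chains.obj B).d q (q - 1) ≫ ezTerm A B p (q - 1) n) ?_ ?_ ?_ ?_)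
  · rw [alternatingFaceMapComplex_obj_d, AlternatingFaceMapComplex.objD]
    refine (Preadditive.comp_sum (C := ModuleCat.{u} R) _ _ _).trans
      (Finset.sum_congr rfl (fun i _ => ?_))
    refine (Preadditive.comp_zsmul (C := ModuleCat.{u} R) _ _ _).trans ?_
    congr 1
    refine (Preadditive.sum_comp (C := ModuleCat.{u} R) _ _ _).trans
      (Finset.sum_congr rfl (fun x _ => ?_))
    refine (Preadditive.zsmul_comp (C := ModuleCat.{u} R) _ _ _).trans ?_
    congr 1
    change (A.map x.1.op ⊗ₘ B.map x.2.op) ≫ (A.map (δ i).op ⊗ₘ B.map (δ i).op) = _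
    simp
  · rintro rfl
    rw [HomologicalComplex.shape _ _ _ (by simp), MonoidalPreadditive.zero_whiskerRight]
    exact Limits.zero_comp (C := ModuleCat.{u} R)
  · rintro rfl
    rw [HomologicalComplex.shape _ _ _ (by simp), MonoidalPreadditive.whiskerLeft_zero]
    exact Limits.zero_comp (C := ModuleCat.{u} R)
  · rintro p' rfl
    refine (congrArg (fun d : A _⦋p' + 1⦌ ⟶ A _⦋p'⦌ => d ▷ B _⦋q⦌ ≫
      (ezTerm A B p' q n : A _⦋p'⦌ ⊗ B _⦋q⦌ ⟶ A _⦋n⦌ ⊗ B _⦋n⦌))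
        (alternatingFaceMapComplex_obj_d A p')).trans ?_
    simp only [eqToHom_refl, Category.comp_id]
    change (∑ i : Fin (p' + 2), (-1 : ℤ) ^ (i : ℕ) • A.map (δ i).op) ▷ B _⦋q⦌ ≫ _ = _
    rw [sum_whiskerRight, Preadditive.sum_comp]
    refine Finset.sum_congr rfl (fun k _ => ?_)
    rw [zsmul_whiskerRight, Preadditive.zsmul_comp]
    congr 1
    refine (Preadditive.comp_sum (C := ModuleCat.{u} R) _ _ _).trans
      (Finset.sum_congr rfl (fun x _ => ?_))
    refine (Preadditive.comp_zsmul (C := ModuleCat.{u} R) _ _ _).trans ?_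
    congr 1
    simp [MonoidalCategory.tensorHom_def]
  · rintro q' rfl
    refine (congrArg (fun d : B _⦋q' + 1⦌ ⟶ B _⦋q'⦌ => A _⦋p⦌ ◁ d ≫
      (ezTerm A B p q' n : A _⦋p⦌ ⊗ B _⦋q'⦌ ⟶ A _⦋n⦌ ⊗ B _⦋n⦌))
        (alternatingFaceMapComplex_obj_d B q')).trans ?_
    simp only [eqToHom_refl, Category.comp_id]
    change A _⦋p⦌ ◁ (∑ i : Fin (q' + 2), (-1 : ℤ) ^ (i : ℕ) • B.map (δ i).op) ≫ _ = _
    rw [whiskerLeft_sum, Preadditive.sum_comp]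
    refine Finset.sum_congr rfl (fun k _ => ?_)
    rw [whiskerLeft_zsmul, Preadditive.zsmul_comp]
    congr 1
    refine (Preadditive.comp_sum (C := ModuleCat.{u} R) _ _ _).trans
      (Finset.sum_congr rfl (fun x _ => ?_))
    refine (Preadditive.comp_zsmul (C := ModuleCat.{u} R) _ _ _).trans ?_
    congr 1
    simp [MonoidalCategory.tensorHom_def']

/-- The shuffle map on unnormalized chains. -/
def ezK (A B : SimplicialObject (ModuleCat.{u} R)) :
    chains.obj A ⊗ chains.obj B ⟶ chains.obj (A ⊗ B) where
  f n := HomologicalComplex.mapBifunctorDesc (fun p q _ => ezTerm A B p q n)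
  comm' := by
    rintro _ n rfl
    refine HomologicalComplex.mapBifunctor.hom_ext (fun p q h => ?_)
    rw [HomologicalComplex.ι_mapBifunctorDesc_assoc, ezTerm_d A B h]
    erw [HomologicalComplex.mapBifunctor.d_eq]
    rw [Preadditive.add_comp, Preadditive.comp_add]
    rw [HomologicalComplex.mapBifunctor.ι_D₁_assoc, HomologicalComplex.mapBifunctor.ι_D₂_assoc]
    congr 1
    · rcases p with _ | p
      · rw [HomologicalComplex.mapBifunctor.d₁_eq_zero _ _ _ _ _ _ _ (by simp),
          HomologicalComplex.shape _ _ _ (by simp), MonoidalPreadditive.zero_whiskerRight]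
        exact (Limits.zero_comp (C := ModuleCat.{u} R)).trans Limits.zero_comp.symm
      · rw [HomologicalComplex.mapBifunctor.d₁_eq (i₁' := p) _ _ _ _ (by simp) _ _ (by
          change p + q = n; change p + 1 + q = n + 1 at h; omega)]
        rw [show ComplexShape.ε₁ (ComplexShape.down ℕ) (ComplexShape.down ℕ) (ComplexShape.down ℕ)
          (p + 1, q) = 1 from rfl, one_smul, Category.assoc, HomologicalComplex.ι_mapBifunctorDesc]
        rfl
    · rcases q with _ | q
      · rw [HomologicalComplex.mapBifunctor.d₂_eq_zero _ _ _ _ _ _ _ (by simp),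
          HomologicalComplex.shape _ _ _ (by simp), MonoidalPreadditive.whiskerLeft_zero]
        refine (congrArg ((-1 : ℤ) ^ p • ·) (Limits.zero_comp (C := ModuleCat.{u} R))).trans ?_
        exact (smul_zero _).trans Limits.zero_comp.symm
      · rw [HomologicalComplex.mapBifunctor.d₂_eq (i₂' := q) _ _ _ _ _ (by simp) _ (by
          change p + q = n; change p + (q + 1) = n + 1 at h; omega)]
        rw [show ComplexShape.ε₂ (ComplexShape.down ℕ) (ComplexShape.down ℕ) (ComplexShape.down ℕ)
          (p, q + 1) = (-1) ^ p from rfl, Units.smul_def, Preadditive.zsmul_comp, Category.assoc,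
          HomologicalComplex.ι_mapBifunctorDesc]
        simp only [Units.val_pow_eq_pow_val, Units.val_neg, Units.val_one]
        rfl

/-- The front `p`-face tensored with the back `q`-face. -/
def awTerm (A B : SimplicialObject (ModuleCat.{u} R)) (p q n : ℕ) (h : p + q = n) :
    (chains.obj (A ⊗ B)).X n ⟶ (chains.obj A).X p ⊗ (chains.obj B).X q :=
  (A.map (subinterval (n := n) 0 p (by omega)).op ⊗ₘ B.map (subinterval (n := n) p q (by omega)).op :
    A _⦋n⦌ ⊗ B _⦋n⦌ ⟶ A _⦋p⦌ ⊗ B _⦋q⦌)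

theorem toOrderHom_subinterval {n : ℕ} (j l : ℕ) (h : j + l ≤ n) (i : Fin (l + 1)) :
    ((subinterval (n := n) j l h).toOrderHom i : ℕ) = i + j := rfl

theorem subinterval_boundary {M : Type*} [AddCommGroup M] (p q : ℕ)
    (U : (⦋p⦌ ⟶ ⦋p + q + 1⦌) → (⦋q⦌ ⟶ ⦋p + q + 1⦌) → M) :
    ∑ i : Fin (p + q + 2), (-1 : ℤ) ^ (i : ℕ) • U (subinterval (n := p + q) 0 p (by omega) ≫ δ i)
        (subinterval (n := p + q) p q (by omega) ≫ δ i) =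
      ∑ i : Fin (p + 2), (-1 : ℤ) ^ (i : ℕ) •
        U (δ i ≫ subinterval (n := p + q + 1) 0 (p + 1) (by omega))
          (subinterval (n := p + q + 1) (p + 1) q (by omega)) +
      (-1 : ℤ) ^ p • ∑ i : Fin (q + 2), (-1 : ℤ) ^ (i : ℕ) •
        U (subinterval (n := p + q + 1) 0 p (by omega))
          (δ i ≫ subinterval (n := p + q + 1) p (q + 1) (by omega)) := by
  rw [Fin.sum_univ_castSucc (n := p + 1), Fin.sum_univ_succ (n := q + 1)]
  have e : p + q + 2 = (p + 1) + (q + 1) := by omega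
  rw [← (finCongr e.symm).sum_comp, Fin.sum_univ_add]
  have t1 : ∀ i : Fin (p + 1), (-1 : ℤ) ^ ((finCongr e.symm (Fin.castAdd (q + 1) i) : Fin _) : ℕ) •
      U (subinterval (n := p + q) 0 p (by omega) ≫ δ (finCongr e.symm (Fin.castAdd (q + 1) i)))
        (subinterval (n := p + q) p q (by omega) ≫ δ (finCongr e.symm (Fin.castAdd (q + 1) i))) =
      (-1 : ℤ) ^ (i.castSucc : ℕ) •
        U (δ i.castSucc ≫ subinterval (n := p + q + 1) 0 (p + 1) (by omega))
          (subinterval (n := p + q + 1) (p + 1) q (by omega)) := by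
    intro i
    congr 2
    · ext j : 4
      simp only [toOrderHom_comp, toOrderHom_δ, toOrderHom_subinterval, val_succAbove]
      simp
    · ext j : 4
      simp only [toOrderHom_comp, toOrderHom_δ, toOrderHom_subinterval, val_succAbove]
      simp
      have := i.is_lt
      grind
  have t2 : ∀ i : Fin (q + 1), (-1 : ℤ) ^ ((finCongr e.symm (Fin.natAdd (p + 1) i) : Fin _) : ℕ) •
      U (subinterval (n := p + q) 0 p (by omega) ≫ δ (finCongr e.symm (Fin.natAdd (p + 1) i)))
        (subinterval (n := p + q) p q (by omega) ≫ δ (finCongr e.symm (Fin.natAdd (p + 1) i))) =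
      (-1 : ℤ) ^ p • (-1 : ℤ) ^ (i.succ : ℕ) •
        U (subinterval (n := p + q + 1) 0 p (by omega))
          (δ i.succ ≫ subinterval (n := p + q + 1) p (q + 1) (by omega)) := by
    intro i
    rw [smul_smul, ← pow_add]
    congr 1
    · congr 1; simp; omega
    congr 1
    · ext j : 4
      simp only [toOrderHom_comp, toOrderHom_δ, toOrderHom_subinterval, val_succAbove]
      simp
      omega
    · ext j : 4
      simp only [toOrderHom_comp, toOrderHom_δ, toOrderHom_subinterval, val_succAbove]
      simp
      grind
  have t3 : U (δ (Fin.last (p + 1)) ≫ subinterval (n := p + q + 1) 0 (p + 1) (by omega))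
        (subinterval (n := p + q + 1) (p + 1) q (by omega)) =
      U (subinterval (n := p + q + 1) 0 p (by omega))
        (δ 0 ≫ subinterval (n := p + q + 1) p (q + 1) (by omega)) := by
    congr 1
    · ext j : 4
      simp only [toOrderHom_comp, toOrderHom_δ, toOrderHom_subinterval, val_succAbove]
      simp
      omega
    · ext j : 4
      simp only [toOrderHom_comp, toOrderHom_δ, toOrderHom_subinterval, val_succAbove]
      simp
      omega
  rw [Finset.sum_congr rfl (fun i _ => t1 i), Finset.sum_congr rfl (fun i _ => t2 i), t3, smul_add,
    Finset.smul_sum]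
  simp only [Fin.val_last, Fin.val_zero, pow_zero, one_smul, pow_succ, mul_neg, mul_one, neg_smul]
  abel

theorem awTerm_d (A B : SimplicialObject (ModuleCat.{u} R)) {p q n : ℕ} (hn : p + q = n) :
    (chains.obj (A ⊗ B)).d (n + 1) n ≫ awTerm A B p q n hn =
      awTerm A B (p + 1) q (n + 1) (by omega) ≫ (chains.obj A).d (p + 1) p ▷ (chains.obj B).X q +
      (-1 : ℤ) ^ p • awTerm A B p (q + 1) (n + 1) (by omega) ≫
        (chains.obj A).X p ◁ (chains.obj B).d (q + 1) q := by
  subst hn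
  let U (f : ⦋p⦌ ⟶ ⦋p + q + 1⦌) (g : ⦋q⦌ ⟶ ⦋p + q + 1⦌) :
      A _⦋p + q + 1⦌ ⊗ B _⦋p + q + 1⦌ ⟶ A _⦋p⦌ ⊗ B _⦋q⦌ := A.map f.op ⊗ₘ B.map g.op
  have h1 : (chains.obj (A ⊗ B)).d (p + q + 1) (p + q) ≫ awTerm A B p q (p + q) rfl =
      ∑ i : Fin (p + q + 2), (-1 : ℤ) ^ (i : ℕ) • U (subinterval (n := p + q) 0 p (by omega) ≫ δ i)
        (subinterval (n := p + q) p q (by omega) ≫ δ i) := by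
    rw [alternatingFaceMapComplex_obj_d, AlternatingFaceMapComplex.objD]
    refine (Preadditive.sum_comp (C := ModuleCat.{u} R) _ _ _).trans
      (Finset.sum_congr rfl (fun i _ => ?_))
    refine (Preadditive.zsmul_comp (C := ModuleCat.{u} R) _ _ _).trans ?_
    congr 1
    simp only [U, awTerm]
    change (A.map (δ i).op ⊗ₘ B.map (δ i).op) ≫ (A.map _ ⊗ₘ B.map _) = _
    simp
  have h2 : awTerm A B (p + 1) q (p + q + 1) (by omega) ≫ (chains.obj A).d (p + 1) p ▷ (chains.obj B).X q =
      ∑ i : Fin (p + 2), (-1 : ℤ) ^ (i : ℕ) •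
        U (δ i ≫ subinterval (n := p + q + 1) 0 (p + 1) (by omega))
          (subinterval (n := p + q + 1) (p + 1) q (by omega)) := by
    rw [alternatingFaceMapComplex_obj_d, AlternatingFaceMapComplex.objD]
    change _ ≫ (∑ i : Fin (p + 2), (-1 : ℤ) ^ (i : ℕ) • A.map (δ i).op) ▷ B _⦋q⦌ = _
    rw [sum_whiskerRight, Preadditive.comp_sum]
    refine Finset.sum_congr rfl (fun k _ => ?_)
    rw [zsmul_whiskerRight, Preadditive.comp_zsmul]
    congr 1
    simp [awTerm, U, MonoidalCategory.tensorHom_def']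
  have h3 : awTerm A B p (q + 1) (p + q + 1) (by omega) ≫ (chains.obj A).X p ◁ (chains.obj B).d (q + 1) q =
      ∑ i : Fin (q + 2), (-1 : ℤ) ^ (i : ℕ) •
        U (subinterval (n := p + q + 1) 0 p (by omega))
          (δ i ≫ subinterval (n := p + q + 1) p (q + 1) (by omega)) := by
    rw [alternatingFaceMapComplex_obj_d, AlternatingFaceMapComplex.objD]
    change _ ≫ A _⦋p⦌ ◁ (∑ i : Fin (q + 2), (-1 : ℤ) ^ (i : ℕ) • B.map (δ i).op) = _
    rw [whiskerLeft_sum, Preadditive.comp_sum]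
    refine Finset.sum_congr rfl (fun k _ => ?_)
    rw [whiskerLeft_zsmul, Preadditive.comp_zsmul]
    congr 1
    simp [awTerm, U, MonoidalCategory.tensorHom_def]
  refine h1.trans ((subinterval_boundary p q U).trans ?_)
  rw [h2, h3]
  rfl

theorem sum_antidiagonal_coe {M : Type*} [AddCommMonoid M] (n : ℕ)
    (F : ∀ p q : ℕ, p + q = n → M) :
    ∑ x : Finset.HasAntidiagonal.antidiagonal n,
        F x.1.1 x.1.2 (Finset.HasAntidiagonal.mem_antidiagonal.1 x.2) =
      ∑ x ∈ Finset.HasAntidiagonal.antidiagonal n,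
        if h : x.1 + x.2 = n then F x.1 x.2 h else 0 := by
  rw [← Finset.sum_coe_sort (Finset.HasAntidiagonal.antidiagonal n)]
  exact Finset.sum_congr rfl (fun x _ => by
    rw [dif_pos (Finset.HasAntidiagonal.mem_antidiagonal.1 x.2)])

theorem sum_antidiagonal_coe_succ {M : Type*} [AddCommMonoid M] (n : ℕ)
    (F : ∀ p q : ℕ, p + q = n + 1 → M) (h0 : ∀ q h, F 0 q h = 0) :
    ∑ x : Finset.HasAntidiagonal.antidiagonal (n + 1),
        F x.1.1 x.1.2 (Finset.HasAntidiagonal.mem_antidiagonal.1 x.2) =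
      ∑ x : Finset.HasAntidiagonal.antidiagonal n,
        F (x.1.1 + 1) x.1.2 (by
          have := Finset.HasAntidiagonal.mem_antidiagonal.1 x.2; omega) := by
  rw [sum_antidiagonal_coe, sum_antidiagonal_coe n (fun p q h => F (p + 1) q (by omega)),
    Finset.Nat.sum_antidiagonal_succ, dif_pos (by simp), h0, zero_add]
  exact Finset.sum_congr rfl (fun x hx => by
    have := Finset.HasAntidiagonal.mem_antidiagonal.1 hx
    rw [dif_pos this, dif_pos (by simp only; omega)])

theorem sum_antidiagonal_coe_succ' {M : Type*} [AddCommMonoid M] (n : ℕ)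
    (F : ∀ p q : ℕ, p + q = n + 1 → M) (h0 : ∀ p h, F p 0 h = 0) :
    ∑ x : Finset.HasAntidiagonal.antidiagonal (n + 1),
        F x.1.1 x.1.2 (Finset.HasAntidiagonal.mem_antidiagonal.1 x.2) =
      ∑ x : Finset.HasAntidiagonal.antidiagonal n,
        F x.1.1 (x.1.2 + 1) (by
          have := Finset.HasAntidiagonal.mem_antidiagonal.1 x.2; omega) := by
  rw [sum_antidiagonal_coe, sum_antidiagonal_coe n (fun p q h => F p (q + 1) (by omega)),
    Finset.Nat.sum_antidiagonal_succ', dif_pos (by simp), h0, zero_add]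
  exact Finset.sum_congr rfl (fun x hx => by
    have := Finset.HasAntidiagonal.mem_antidiagonal.1 hx
    rw [dif_pos this, dif_pos (by simp only; omega)])

/-- The Alexander–Whitney map on unnormalized chains. -/
def awK (A B : SimplicialObject (ModuleCat.{u} R)) :
    chains.obj (A ⊗ B) ⟶ chains.obj A ⊗ chains.obj B where
  f n := ∑ x : Finset.HasAntidiagonal.antidiagonal n, awTerm A B x.1.1 x.1.2 n (Finset.HasAntidiagonal.mem_antidiagonal.1 x.2) ≫
    HomologicalComplex.ιTensorObj _ _ x.1.1 x.1.2 n (Finset.HasAntidiagonal.mem_antidiagonal.1 x.2)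
  comm' := by
    rintro _ n rfl
    rw [Preadditive.sum_comp, Preadditive.comp_sum]
    refine Eq.trans (b := (∑ x : Finset.HasAntidiagonal.antidiagonal (n + 1),
        awTerm A B x.1.1 x.1.2 (n + 1) (Finset.HasAntidiagonal.mem_antidiagonal.1 x.2) ≫
          HomologicalComplex.mapBifunctor.d₁ (chains.obj A) (chains.obj B) (curriedTensor _)
            (ComplexShape.down ℕ) x.1.1 x.1.2 n) +
      ∑ x : Finset.HasAntidiagonal.antidiagonal (n + 1),
        awTerm A B x.1.1 x.1.2 (n + 1) (Finset.HasAntidiagonal.mem_antidiagonal.1 x.2) ≫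
          HomologicalComplex.mapBifunctor.d₂ (chains.obj A) (chains.obj B) (curriedTensor _)
            (ComplexShape.down ℕ) x.1.1 x.1.2 n) ?_ ?_
    · rw [← Finset.sum_add_distrib]
      refine Finset.sum_congr rfl (fun x _ => ?_)
      erw [HomologicalComplex.mapBifunctor.d_eq]
      rw [Category.assoc, Preadditive.comp_add, HomologicalComplex.mapBifunctor.ι_D₁,
        HomologicalComplex.mapBifunctor.ι_D₂, Preadditive.comp_add]
    · rw [sum_antidiagonal_coe_succ n (fun p q h => awTerm A B p q (n + 1) h ≫
          HomologicalComplex.mapBifunctor.d₁ (chains.obj A) (chains.obj B) (curriedTensor _)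
            (ComplexShape.down ℕ) p q n) (fun q h => by
        rw [HomologicalComplex.mapBifunctor.d₁_eq_zero _ _ _ _ _ _ _ (by simp)]
        exact Limits.comp_zero),
        sum_antidiagonal_coe_succ' n (fun p q h => awTerm A B p q (n + 1) h ≫
          HomologicalComplex.mapBifunctor.d₂ (chains.obj A) (chains.obj B) (curriedTensor _)
            (ComplexShape.down ℕ) p q n) (fun q h => by
        rw [HomologicalComplex.mapBifunctor.d₂_eq_zero _ _ _ _ _ _ _ (by simp)]
        exact Limits.comp_zero), ← Finset.sum_add_distrib]
      refine Finset.sum_congr rfl (fun x _ => ?_)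
      have hx := Finset.HasAntidiagonal.mem_antidiagonal.1 x.2
      rw [← Category.assoc, awTerm_d A B hx, Preadditive.add_comp]
      rw [HomologicalComplex.mapBifunctor.d₁_eq (i₁' := x.1.1) _ _ _ _ (by simp) _ _ hx,
        HomologicalComplex.mapBifunctor.d₂_eq (i₂' := x.1.2) _ _ _ _ _ (by simp) _ hx]
      rw [show ComplexShape.ε₂ (ComplexShape.down ℕ) (ComplexShape.down ℕ) (ComplexShape.down ℕ)
          (x.1.1, x.1.2 + 1) = (-1) ^ x.1.1 from rfl,
        show ComplexShape.ε₁ (ComplexShape.down ℕ) (ComplexShape.down ℕ) (ComplexShape.down ℕ)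
          (x.1.1 + 1, x.1.2) = 1 from rfl, one_smul, Units.smul_def, Preadditive.comp_zsmul,
        Preadditive.zsmul_comp, Category.assoc, Category.assoc]
      simp only [Units.val_pow_eq_pow_val, Units.val_neg, Units.val_one]
      rfl

/-- The normalized (Moore) chain complex functor. -/
abbrev N : SimplicialObject (ModuleCat.{u} R) ⥤ ChainComplex (ModuleCat.{u} R) ℕ :=
  Abelian.DoldKan.N

/-- The denormalization functor, inverse to normalization up to isomorphism. -/
abbrev Γ : ChainComplex (ModuleCat.{u} R) ℕ ⥤ SimplicialObject (ModuleCat.{u} R) :=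
  Abelian.DoldKan.Γ

/-- The inclusion of the normalized chains into the chains. -/
def incl (A : SimplicialObject (ModuleCat.{u} R)) : N.obj A ⟶ chains.obj A :=
  inclusionOfMooreComplexMap A

/-- The projection of the chains onto the normalized chains, with kernel the degenerate chains. -/
def proj (A : SimplicialObject (ModuleCat.{u} R)) : chains.obj A ⟶ N.obj A :=
  DoldKan.PInftyToNormalizedMooreComplex A

theorem incl_naturality {A B : SimplicialObject (ModuleCat.{u} R)} (f : A ⟶ B) :
    N.map f ≫ incl B = incl A ≫ chains.map f :=
  (inclusionOfMooreComplex (ModuleCat.{u} R)).naturality f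

theorem proj_naturality {A B : SimplicialObject (ModuleCat.{u} R)} (f : A ⟶ B) :
    chains.map f ≫ proj B = proj A ≫ N.map f :=
  DoldKan.PInftyToNormalizedMooreComplex_naturality f

instance : (N (R := R)).Additive where
  map_add {A B f g} := by
    have : Mono (incl B) := inferInstanceAs (Mono (inclusionOfMooreComplexMap B))
    rw [← cancel_mono (incl B), Preadditive.add_comp, incl_naturality, incl_naturality,
      incl_naturality, ← Preadditive.comp_add]
    rfl

instance : Functor.Linear R (N (R := R)) where
  map_smul {A B} f r := by
    have : Mono (incl B) := inferInstanceAs (Mono (inclusionOfMooreComplexMap B))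
    rw [← cancel_mono (incl B), Linear.smul_comp, incl_naturality, incl_naturality,
      ← Linear.comp_smul]
    rfl

theorem awTerm_naturality {A A' B B' : SimplicialObject (ModuleCat.{u} R)} (f : A ⟶ A') (g : B ⟶ B')
    (p q n : ℕ) (h : p + q = n) :
    (chains.map (f ⊗ₘ g)).f n ≫ awTerm A' B' p q n h =
      awTerm A B p q n h ≫ ((chains.map f).f p ⊗ₘ (chains.map g).f q) := by
  change (f.app (op ⦋n⦌) ⊗ₘ g.app (op ⦋n⦌)) ≫ (A'.map _ ⊗ₘ B'.map _) =
    (A.map _ ⊗ₘ B.map _) ≫ (f.app (op ⦋p⦌) ⊗ₘ g.app (op ⦋q⦌))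
  simp

theorem awK_naturality {A A' B B' : SimplicialObject (ModuleCat.{u} R)} (f : A ⟶ A') (g : B ⟶ B') :
    chains.map (f ⊗ₘ g) ≫ awK A' B' = awK A B ≫ (chains.map f ⊗ₘ chains.map g) := by
  ext n : 1
  change (chains.map (f ⊗ₘ g)).f n ≫ ∑ _, _ = (∑ _, _) ≫ _
  rw [Preadditive.comp_sum, Preadditive.sum_comp]
  refine Finset.sum_congr rfl (fun x _ => ?_)
  have hx := Finset.HasAntidiagonal.mem_antidiagonal.1 x.2
  rw [Category.assoc]
  refine (Category.assoc _ _ _).symm.trans ?_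
  rw [awTerm_naturality f g _ _ _ hx, MonoidalCategory.tensorHom_def, Category.assoc, Category.assoc]
  congr 1
  exact (HomologicalComplex.ι_mapBifunctorMap (chains.map f) (chains.map g) (curriedTensor _)
    (ComplexShape.down ℕ) x.1.1 x.1.2 n hx).symm

theorem ezTerm_naturality {A A' B B' : SimplicialObject (ModuleCat.{u} R)} (f : A ⟶ A') (g : B ⟶ B')
    (p q n : ℕ) :
    ((chains.map f).f p ⊗ₘ (chains.map g).f q) ≫ ezTerm A' B' p q n =
      ezTerm A B p q n ≫ (chains.map (f ⊗ₘ g)).f n := by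
  refine (Preadditive.comp_sum (C := ModuleCat.{u} R) _ _ _).trans (Eq.trans ?_
    (Preadditive.sum_comp (C := ModuleCat.{u} R) _ _ _).symm)
  refine Finset.sum_congr rfl (fun x _ => ?_)
  refine (Preadditive.comp_zsmul (C := ModuleCat.{u} R) _ _ _).trans (Eq.trans ?_
    (Preadditive.zsmul_comp (C := ModuleCat.{u} R) _ _ _).symm)
  congr 1
  change (f.app (op ⦋p⦌) ⊗ₘ g.app (op ⦋q⦌)) ≫ (A'.map _ ⊗ₘ B'.map _) =
    (A.map _ ⊗ₘ B.map _) ≫ (f.app (op ⦋n⦌) ⊗ₘ g.app (op ⦋n⦌))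
  simp

theorem ezK_naturality {A A' B B' : SimplicialObject (ModuleCat.{u} R)} (f : A ⟶ A') (g : B ⟶ B') :
    (chains.map f ⊗ₘ chains.map g) ≫ ezK A' B' = ezK A B ≫ chains.map (f ⊗ₘ g) := by
  ext n : 1
  refine HomologicalComplex.mapBifunctor.hom_ext (fun p q h => ?_)
  change _ ≫ (HomologicalComplex.mapBifunctorMap _ _ _ _).f n ≫
    HomologicalComplex.mapBifunctorDesc _ = _ ≫ HomologicalComplex.mapBifunctorDesc _ ≫ _
  rw [HomologicalComplex.ι_mapBifunctorMap_assoc, HomologicalComplex.ι_mapBifunctorDesc_assoc]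
  refine Eq.trans ?_ (ezTerm_naturality f g p q n)
  rw [MonoidalCategory.tensorHom_def, Category.assoc]
  refine congrArg (_ ≫ ·) (congrArg (_ ≫ ·) ?_)
  exact HomologicalComplex.ι_mapBifunctorDesc _ _ _ _

/-- The Alexander–Whitney map on normalized chains. -/
def aw (A B : SimplicialObject (ModuleCat.{u} R)) : N.obj (A ⊗ B) ⟶ N.obj A ⊗ N.obj B :=
  incl (A ⊗ B) ≫ awK A B ≫ (proj A ⊗ₘ proj B)

/-- The Eilenberg–Zilber (shuffle) map on normalized chains. -/
def ez (A B : SimplicialObject (ModuleCat.{u} R)) : N.obj A ⊗ N.obj B ⟶ N.obj (A ⊗ B) :=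
  (incl A ⊗ₘ incl B) ≫ ezK A B ≫ proj (A ⊗ B)

theorem aw_naturality {A A' B B' : SimplicialObject (ModuleCat.{u} R)} (f : A ⟶ A') (g : B ⟶ B') :
    N.map (f ⊗ₘ g) ≫ aw A' B' = aw A B ≫ (N.map f ⊗ₘ N.map g) := by
  simp only [aw, Category.assoc]
  rw [← Category.assoc, incl_naturality, Category.assoc, ← Category.assoc (chains.map _), awK_naturality,
    Category.assoc, tensorHom_comp_tensorHom, tensorHom_comp_tensorHom, proj_naturality, proj_naturality]

theorem ez_naturality {A A' B B' : SimplicialObject (ModuleCat.{u} R)} (f : A ⟶ A') (g : B ⟶ B') :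
    (N.map f ⊗ₘ N.map g) ≫ ez A' B' = ez A B ≫ N.map (f ⊗ₘ g) := by
  simp only [ez, Category.assoc]
  rw [← Category.assoc, tensorHom_comp_tensorHom, incl_naturality, incl_naturality,
    ← tensorHom_comp_tensorHom, Category.assoc, ← Category.assoc (chains.map f ⊗ₘ _), ezK_naturality,
    Category.assoc, proj_naturality]

variable (R) in
/-- The cosimplicial simplicial module `[n] ↦ R Δ^n`. -/
def stdSimplexModule : SimplexCategory ⥤ SimplicialObject (ModuleCat.{u} R) :=
  SSet.stdSimplex ⋙ (SimplicialObject.whiskering _ _).obj (ModuleCat.free R)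

/-- The internal hom `B^A` of simplicial modules: `Hom(A ⊗ R Δ^n, B)` in degree `n`. -/
def sHom (A B : SimplicialObject (ModuleCat.{u} R)) : SimplicialObject (ModuleCat.{u} R) :=
  (stdSimplexModule R ⋙ tensorLeft A).op ⋙ (linearYoneda R _).obj B

/-- The simplicial module `Hom(X ⊗ N (R Δ^n), D)`. -/
def homTensor (X D : ChainComplex (ModuleCat.{u} R) ℕ) : SimplicialObject (ModuleCat.{u} R) :=
  (stdSimplexModule R ⋙ N ⋙ tensorLeft X).op ⋙ (linearYoneda R _).obj D

/-- The simplicial module `Hom(N (A ⊗ R Δ^n), D)`. -/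
def homNormalized (A : SimplicialObject (ModuleCat.{u} R)) (D : ChainComplex (ModuleCat.{u} R) ℕ) :
    SimplicialObject (ModuleCat.{u} R) :=
  (stdSimplexModule R ⋙ tensorLeft A ⋙ N).op ⋙ (linearYoneda R _).obj D

/-- The Alexander–Whitney map `N (A ⊗ R Δ^n) → N A ⊗ N (R Δ^n)`, natural in `n`. -/
def awNat (A : SimplicialObject (ModuleCat.{u} R)) :
    stdSimplexModule R ⋙ tensorLeft A ⋙ N ⟶ stdSimplexModule R ⋙ N ⋙ tensorLeft (N.obj A) where
  app n := aw A ((stdSimplexModule R).obj n)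
  naturality m n f := by
    have := aw_naturality (𝟙 A) ((stdSimplexModule R).map f)
    simpa using this

/-- The Eilenberg–Zilber map `N A ⊗ N (R Δ^n) → N (A ⊗ R Δ^n)`, natural in `n`. -/
def ezNat (A : SimplicialObject (ModuleCat.{u} R)) :
    stdSimplexModule R ⋙ N ⋙ tensorLeft (N.obj A) ⟶ stdSimplexModule R ⋙ tensorLeft A ⋙ N where
  app n := ez A ((stdSimplexModule R).obj n)
  naturality m n f := by
    have := ez_naturality (𝟙 A) ((stdSimplexModule R).map f)
    simpa using this

/-- Restriction along the Alexander–Whitney map. -/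
def awStar (A : SimplicialObject (ModuleCat.{u} R)) (D : ChainComplex (ModuleCat.{u} R) ℕ) :
    homTensor (N.obj A) D ⟶ homNormalized A D :=
  Functor.whiskerRight (NatTrans.op (awNat A)) _

/-- Restriction along the Eilenberg–Zilber map. -/
def ezStar (A : SimplicialObject (ModuleCat.{u} R)) (D : ChainComplex (ModuleCat.{u} R) ℕ) :
    homNormalized A D ⟶ homTensor (N.obj A) D :=
  Functor.whiskerRight (NatTrans.op (ezNat A)) _

/-- The counit `N Γ C ≅ C`. -/
def dkCounit (C : ChainComplex (ModuleCat.{u} R) ℕ) : N.obj (Γ.obj C) ≅ C :=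
  Abelian.DoldKan.equivalence.counitIso.app C

theorem dkCounit_naturality {C C' : ChainComplex (ModuleCat.{u} R) ℕ} (f : C ⟶ C') :
    N.map (Γ.map f) ≫ (dkCounit C').hom = (dkCounit C).hom ≫ f :=
  Abelian.DoldKan.equivalence.counitIso.hom.naturality f

instance : (N (R := R)).Full := inferInstanceAs (Abelian.DoldKan.equivalence (A := ModuleCat.{u} R)).functor.Full
instance : (N (R := R)).Faithful := inferInstanceAs (Abelian.DoldKan.equivalence (A := ModuleCat.{u} R)).functor.Faithful

/-- `Hom(A, B) ≅ Hom(N A, N B)`, as `N` is fully faithful. -/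
def ffIso (B : SimplicialObject (ModuleCat.{u} R)) :
    (linearYoneda R _).obj B ≅ N.op ⋙ (linearYoneda R _).obj (N.obj B) :=
  NatIso.ofComponents (fun A => (LinearEquiv.ofBijective (N.mapLinearMap R (X := A.unop) (Y := B))
      ⟨N.map_injective, N.map_surjective⟩).toModuleIso) (fun f => by
    ext g
    exact N.map_comp _ _)

/-- The adjunction isomorphism `Hom(A, Γ D) ≅ Hom(N A, D)`. -/
def dkIso (D : ChainComplex (ModuleCat.{u} R) ℕ) :
    (linearYoneda R _).obj (Γ.obj D) ≅ (N (R := R)).op ⋙ (linearYoneda R _).obj D :=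
  ffIso (Γ.obj D) ≪≫ Functor.isoWhiskerLeft _ ((linearYoneda R _).mapIso (dkCounit D))

/-- The nondegenerate `n`-simplex of `R Δ^n`. -/
def fundSimplex (n : SimplexCategory) : ((stdSimplexModule R).obj n).obj (op n) :=
  ModuleCat.freeMk (X := (SSet.stdSimplex.{u}.obj n).obj (op n)) (SSet.stdSimplex.objEquiv.symm (𝟙 n))

theorem stdSimplexModule_map_fundSimplex {m n : SimplexCategory} (f : m ⟶ n) :
    (((stdSimplexModule R).map f).app (op m)).hom (fundSimplex m) =
      (((stdSimplexModule R).obj n).map f.op).hom (fundSimplex n) := by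
  refine (ModuleCat.free_map_apply _ _).trans (Eq.trans ?_ (ModuleCat.free_map_apply _ _).symm)
  refine congrArg ModuleCat.freeMk ?_
  refine congrArg SSet.stdSimplex.objEquiv.symm ?_
  exact (Category.id_comp f).trans (Category.comp_id f).symm

/-- Evaluation of a map `R Δ^n → X` at the nondegenerate `n`-simplex. -/
def yonedaEval (X : SimplicialObject (ModuleCat.{u} R)) (n : SimplexCategory) :
    ((stdSimplexModule R).obj n ⟶ X) →ₗ[R] X.obj (op n) where
  toFun g := (g.app (op n)).hom (fundSimplex n)
  map_add' _ _ := rfl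
  map_smul' _ _ := rfl

/-- The components of `yonedaDesc`. -/
def yonedaDescApp (X : SimplicialObject (ModuleCat.{u} R)) (n : SimplexCategory) (x : X.obj (op n))
    (m : SimplexCategoryᵒᵖ) : ((stdSimplexModule R).obj n).obj m ⟶ X.obj m :=
  ModuleCat.freeDesc (TypeCat.ofHom (fun s : (SSet.stdSimplex.{u}.obj n).obj m =>
    (X.map (SSet.stdSimplex.objEquiv s).op).hom x))

theorem yonedaDescApp_freeMk (X : SimplicialObject (ModuleCat.{u} R)) (n : SimplexCategory)
    (x : X.obj (op n)) (m : SimplexCategoryᵒᵖ) (s : (SSet.stdSimplex.{u}.obj n).obj m) :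
    (yonedaDescApp X n x m).hom (ModuleCat.freeMk s) =
      (X.map (SSet.stdSimplex.objEquiv s).op).hom x :=
  ModuleCat.freeDesc_apply _ _

theorem stdSimplexModule_obj_map (n : SimplexCategory) {m m' : SimplexCategoryᵒᵖ} (f : m ⟶ m')
    (s : (SSet.stdSimplex.{u}.obj n).obj m) :
    (((stdSimplexModule R).obj n).map f).hom (ModuleCat.freeMk s) =
      ModuleCat.freeMk ((SSet.stdSimplex.obj n).map f s) :=
  ModuleCat.free_map_apply _ _

/-- The map `R Δ^n → X` given by an `n`-simplex of `X`. -/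
def yonedaDesc (X : SimplicialObject (ModuleCat.{u} R)) (n : SimplexCategory) (x : X.obj (op n)) :
    (stdSimplexModule R).obj n ⟶ X where
  app m := yonedaDescApp X n x m
  naturality m m' f := by
    refine ModuleCat.free_hom_ext (fun s => ?_)
    change (yonedaDescApp X n x m').hom ((((stdSimplexModule R).obj n).map f).hom _) =
      (X.map f).hom ((yonedaDescApp X n x m).hom _)
    rw [stdSimplexModule_obj_map, yonedaDescApp_freeMk, yonedaDescApp_freeMk]
    exact congrArg (fun φ : X.obj (op n) ⟶ X.obj m' => φ.hom x)
      (X.map_comp (SSet.stdSimplex.objEquiv s).op f)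

theorem yonedaEval_bijective (X : SimplicialObject (ModuleCat.{u} R)) (n : SimplexCategory) :
    Function.Bijective (yonedaEval X n) := by
  constructor
  · intro g h e
    refine NatTrans.ext (funext fun m => ModuleCat.free_hom_ext (fun s => ?_))
    have key (g : (stdSimplexModule R).obj n ⟶ X) :
        (g.app m).hom (ModuleCat.freeMk s) =
          (X.map (SSet.stdSimplex.objEquiv s).op).hom (yonedaEval X n g) := by
      have h1 := congrArg (fun φ => φ.hom (fundSimplex n))
        (g.naturality (SSet.stdSimplex.objEquiv s).op)
      refine Eq.trans (congrArg (g.app m).hom ?_) h1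
      refine Eq.trans ?_ (ModuleCat.free_map_apply _ _).symm
      refine congrArg ModuleCat.freeMk ?_
      refine (SSet.stdSimplex.objEquiv.symm_apply_apply s).symm.trans ?_
      exact congrArg SSet.stdSimplex.objEquiv.symm (Category.comp_id _).symm
    exact (key g).trans ((congrArg _ e).trans (key h).symm)
  · intro x
    refine ⟨yonedaDesc X n x, ?_⟩
    refine (ModuleCat.freeDesc_apply _ _).trans ?_
    exact congrArg (fun φ : X.obj (op n) ⟶ X.obj (op n) => φ.hom x) (X.map_id (op n))

/-- The isomorphism `Hom(R Δ^n, X) ≅ X_n` of simplicial modules. -/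
def yonedaIso (X : SimplicialObject (ModuleCat.{u} R)) :
    (stdSimplexModule R).op ⋙ (linearYoneda R _).obj X ≅ X :=
  NatIso.ofComponents (fun n =>
    (LinearEquiv.ofBijective (yonedaEval X n.unop) (yonedaEval_bijective X n.unop)).toModuleIso)
    (fun {m n} f => by
      ext g
      have h1 := congrArg (fun φ => φ.hom (fundSimplex m.unop)) (g.naturality f)
      change ((((stdSimplexModule R).map f.unop ≫ g).app n).hom (fundSimplex n.unop)) = _
      refine Eq.trans ?_ h1
      exact congrArg (g.app n).hom (stdSimplexModule_map_fundSimplex f.unop))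

/-- Families of maps `C_p → D_(p+n)`: the degree `n` part of the untruncated hom complex. -/
abbrev HomFam (C D : ChainComplex (ModuleCat.{u} R) ℕ) (n : ℕ) : Type u :=
  ∀ p : ℕ, C.X p ⟶ D.X (p + n)

variable {C D : ChainComplex (ModuleCat.{u} R) ℕ}

/-- The component `C_p → D_m` for `m = p + n`. -/
def HomFam.comp {n : ℕ} (f : HomFam C D n) (p m : ℕ) (h : p + n = m) : C.X p ⟶ D.X m :=
  f p ≫ (D.XIsoOfEq h).hom

theorem HomFam.comp_rfl {n : ℕ} (f : HomFam C D n) (p : ℕ) : f.comp p (p + n) rfl = f p := by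
  simp [HomFam.comp]

theorem HomFam.comp_add {n : ℕ} (f g : HomFam C D n) (p m : ℕ) (h : p + n = m) :
    (f + g).comp p m h = f.comp p m h + g.comp p m h := by
  simp [HomFam.comp]

theorem HomFam.comp_smul {n : ℕ} (r : R) (f : HomFam C D n) (p m : ℕ) (h : p + n = m) :
    (r • f).comp p m h = r • f.comp p m h := by
  simp [HomFam.comp]

theorem HomFam.comp_d {n : ℕ} (f : HomFam C D n) (p m l : ℕ) (h : p + n = m) :
    f.comp p m h ≫ D.d m l = f p ≫ D.d (p + n) l := by
  subst h; rw [HomFam.comp_rfl]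

/-- Precomposition with the differential of `C`. -/
def HomFam.precomp {n : ℕ} (f : HomFam C D (n + 1)) : HomFam C D n :=
  fun p => match p with
    | 0 => 0
    | p + 1 => C.d (p + 1) p ≫ f.comp p (p + 1 + n) (by omega)

theorem HomFam.precomp_add {n : ℕ} (f g : HomFam C D (n + 1)) :
    (f + g).precomp = f.precomp + g.precomp := by
  funext p
  rcases p with _ | p
  · simp [HomFam.precomp]
  · simp [HomFam.precomp, HomFam.comp_add]

theorem HomFam.precomp_smul {n : ℕ} (r : R) (f : HomFam C D (n + 1)) :
    (r • f).precomp = r • f.precomp := by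
  funext p
  rcases p with _ | p
  · simp [HomFam.precomp]
  · simp [HomFam.precomp, HomFam.comp_smul]

variable (C D) in
/-- The differential `d ∘ f - (-1)^|f| f ∘ d` of the hom complex. -/
def homD (n : ℕ) : HomFam C D (n + 1) →ₗ[R] HomFam C D n where
  toFun f p := f p ≫ D.d (p + (n + 1)) (p + n) - (-1 : ℤ) ^ (n + 1) • f.precomp p
  map_add' f g := by
    funext p
    simp only [HomFam.precomp_add, Pi.add_apply, Preadditive.add_comp, smul_add]
    abel
  map_smul' r f := by
    funext p
    simp only [HomFam.precomp_smul, Pi.smul_apply, Linear.smul_comp, smul_sub,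
      RingHom.id_apply, smul_comm r]

theorem homD_zero (n : ℕ) (f : HomFam C D (n + 1)) :
    homD C D n f 0 = f 0 ≫ D.d (0 + (n + 1)) (0 + n) := by
  simp [homD, HomFam.precomp]

theorem homD_succ (n : ℕ) (f : HomFam C D (n + 1)) (p : ℕ) :
    homD C D n f (p + 1) = f (p + 1) ≫ D.d (p + 1 + (n + 1)) (p + 1 + n) -
      (-1 : ℤ) ^ (n + 1) • C.d (p + 1) p ≫ f.comp p (p + 1 + n) (by omega) := rfl

theorem homD_d (n : ℕ) (f : HomFam C D (n + 1)) (p : ℕ) :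
    homD C D n f (p + 1) ≫ D.d (p + 1 + n) (p + n) =
      (-1 : ℤ) ^ n • C.d (p + 1) p ≫ f p ≫ D.d (p + (n + 1)) (p + n) := by
  rw [homD_succ, Preadditive.sub_comp, Category.assoc, D.d_comp_d, Limits.comp_zero, zero_sub,
    Preadditive.zsmul_comp, Category.assoc, HomFam.comp_d, pow_succ]
  simp

theorem d_homD (n : ℕ) (f : HomFam C D (n + 1)) (p : ℕ) :
    C.d (p + 1) p ≫ homD C D n f p = C.d (p + 1) p ≫ f p ≫ D.d (p + (n + 1)) (p + n) := by
  rcases p with _ | p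
  · rw [homD_zero]
  · rw [homD_succ, Preadditive.comp_sub, Preadditive.comp_zsmul, ← Category.assoc (C.d _ _) (C.d _ _),
      C.d_comp_d, Limits.zero_comp, smul_zero, sub_zero]

theorem d_homD_comp (n : ℕ) (f : HomFam C D (n + 1)) (p m : ℕ) (h : p + n = m) :
    C.d (p + 1) p ≫ (homD C D n f).comp p m h =
      C.d (p + 1) p ≫ f.comp p (m + 1) (by omega) ≫ D.d (m + 1) m := by
  subst h
  rw [HomFam.comp_rfl, d_homD]
  exact congrArg (fun x => _ ≫ x ≫ _) (f.comp_rfl p).symm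

theorem homD_homD (n : ℕ) (f : HomFam C D (n + 2)) : homD C D n (homD C D (n + 1) f) = 0 := by
  funext p
  rcases p with _ | p
  · rw [homD_zero, homD_zero, Category.assoc]
    exact (congrArg (f 0 ≫ ·) (D.d_comp_d _ _ _)).trans Limits.comp_zero
  · rw [homD_succ, homD_succ, d_homD_comp, Preadditive.sub_comp, Category.assoc,
      Preadditive.zsmul_comp, Category.assoc]
    refine Eq.trans (congrArg (fun x => x - _ - _)
      ((congrArg (f (p + 1) ≫ ·) (D.d_comp_d _ _ _)).trans Limits.comp_zero)) ?_
    rw [pow_succ _ (n + 1), zero_sub, mul_neg, mul_one, neg_smul, neg_neg]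
    exact sub_self _

variable (C D) in
/-- The degree `n` part of the truncated hom complex: all families if `n > 0`, the chain maps if
`n = 0`. -/
def homCycles (n : ℕ) : Submodule R (HomFam C D n) where
  carrier := {f | n = 0 → ∀ p, f (p + 1) ≫ D.d (p + 1 + n) (p + n) = C.d (p + 1) p ≫ f p}
  add_mem' {f g} hf hg h p := by simp [hf h p, hg h p]
  zero_mem' h p := by simp
  smul_mem' r f hf h p := by simp [hf h p]

variable (C D) in
/-- The differential of the truncated hom complex. -/
def homCyclesD (n : ℕ) : homCycles C D (n + 1) →ₗ[R] homCycles C D n :=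
  (homD C D n).restrict (by
    rintro f - rfl p
    rw [homD_d, d_homD, pow_zero, one_smul])

theorem homCyclesD_homCyclesD (n : ℕ) (f : homCycles C D (n + 2)) :
    homCyclesD C D n (homCyclesD C D (n + 1) f) = 0 :=
  Subtype.ext (homD_homD n f.1)

variable (C D) in
/-- The internal hom `D^C` of nonnegatively graded chain complexes: the good truncation of the hom
complex. -/
def homComplex : ChainComplex (ModuleCat.{u} R) ℕ :=
  ChainComplex.of (fun n => ModuleCat.of R (homCycles C D n))
    (fun n => ModuleCat.ofHom (homCyclesD C D n))
    (fun n => ModuleCat.hom_ext (LinearMap.ext (homCyclesD_homCyclesD n)))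

theorem homComplex_d (n : ℕ) : (homComplex C D).d (n + 1) n = ModuleCat.ofHom (homCyclesD C D n) :=
  ChainComplex.of_d (fun n => ModuleCat.of R (homCycles C D n))
    (fun n => ModuleCat.ofHom (homCyclesD C D n)) n

/-- The family of maps underlying an element of degree `q` of the hom complex. -/
def ev {X : ChainComplex (ModuleCat.{u} R) ℕ} (φ : X ⟶ homComplex C D) (q : ℕ) (x : X.X q) :
    HomFam C D q := ((φ.f q).hom x : homCycles C D q).1

theorem ev_d {X : ChainComplex (ModuleCat.{u} R) ℕ} (φ : X ⟶ homComplex C D) (q : ℕ) (x : X.X (q + 1)) :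
    ev φ q ((X.d (q + 1) q).hom x) = homD C D q (ev φ (q + 1) x) := by
  have h := congrArg (fun ψ => ψ.hom x) (φ.comm (q + 1) q)
  rw [homComplex_d] at h
  exact (congrArg Subtype.val h).symm

theorem ev_zero {X : ChainComplex (ModuleCat.{u} R) ℕ} (φ : X ⟶ homComplex C D) (x : X.X 0) (p : ℕ) :
    ev φ 0 x (p + 1) ≫ D.d (p + 1) p = C.d (p + 1) p ≫ ev φ 0 x p :=
  ((φ.f 0).hom x : homCycles C D 0).2 rfl p

theorem ev_ext {X : ChainComplex (ModuleCat.{u} R) ℕ} {φ ψ : X ⟶ homComplex C D}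
    (h : ∀ p q x, ev φ q x p = ev ψ q x p) : φ = ψ := by
  ext q : 1
  refine ModuleCat.hom_ext (LinearMap.ext (fun x => Subtype.ext (funext (fun p => h p q x))))

/-- A chain map into the hom complex from its underlying families. -/
def ofEv (X : ChainComplex (ModuleCat.{u} R) ℕ) (e : ∀ q, X.X q →ₗ[R] HomFam C D q)
    (h : ∀ q x, e q ((X.d (q + 1) q).hom x) = homD C D q (e (q + 1) x))
    (h0 : ∀ x p, e 0 x (p + 1) ≫ D.d (p + 1) p = C.d (p + 1) p ≫ e 0 x p) : X ⟶ homComplex C D where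
  f q := ModuleCat.ofHom (Y := homCycles C D q)
    ((e q).codRestrict (homCycles C D q) (by rintro x rfl p; exact h0 x p))
  comm' := by
    rintro _ n rfl
    rw [homComplex_d]
    refine ModuleCat.hom_ext (LinearMap.ext (fun x => Subtype.ext ?_))
    exact (h n x).symm

theorem HomFam.comp_d_succ {q : ℕ} (f : HomFam C D (q + 1)) (p n : ℕ) (h : p + 1 + q = n) :
    f.comp (p + 1) (n + 1) (by omega) ≫ D.d (n + 1) n =
      (homD C D q f).comp (p + 1) n h +
        (-1 : ℤ) ^ (q + 1) • C.d (p + 1) p ≫ f.comp p n (by omega) := by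
  subst h
  rw [HomFam.comp_rfl (homD C D q f), homD_succ]
  refine (congrArg (· ≫ _) (f.comp_rfl (p + 1))).trans ?_
  exact (sub_add_cancel _ _).symm

theorem HomFam.comp_d_zero {q : ℕ} (f : HomFam C D (q + 1)) (n : ℕ) (h : 0 + q = n) :
    f.comp 0 (n + 1) (by omega) ≫ D.d (n + 1) n = (homD C D q f).comp 0 n h := by
  subst h
  rw [HomFam.comp_rfl (homD C D q f), homD_zero]
  exact congrArg (· ≫ _) (f.comp_rfl 0)

theorem ev_add_left {X : ChainComplex (ModuleCat.{u} R) ℕ} (φ ψ : X ⟶ homComplex C D) (q : ℕ) (x : X.X q) :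
    ev (φ + ψ) q x = ev φ q x + ev ψ q x := rfl

theorem ev_smul_left {X : ChainComplex (ModuleCat.{u} R) ℕ} (r : R) (φ : X ⟶ homComplex C D) (q : ℕ)
    (x : X.X q) : ev (r • φ) q x = r • ev φ q x := rfl

theorem ev_add {X : ChainComplex (ModuleCat.{u} R) ℕ} (φ : X ⟶ homComplex C D) (q : ℕ) (x y : X.X q) :
    ev φ q (x + y) = ev φ q x + ev φ q y :=
  congrArg Subtype.val ((φ.f q).hom.map_add x y)

theorem ev_smul {X : ChainComplex (ModuleCat.{u} R) ℕ} (φ : X ⟶ homComplex C D) (q : ℕ) (r : R) (x : X.X q) :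
    ev φ q (r • x) = r • ev φ q x :=
  congrArg Subtype.val ((φ.f q).hom.map_smul r x)

variable (C) in
/-- The map `c ⊗ x ↦ (-1)^(p q) φ(x)(c)` on `C_p ⊗ X_q`. -/
def tensorHomTerm {X : ChainComplex (ModuleCat.{u} R) ℕ} (φ : X ⟶ homComplex C D) (p q n : ℕ) (h : p + q = n) :
    C.X p ⊗ X.X q ⟶ D.X n :=
  ModuleCat.MonoidalCategory.tensorLift
    (fun c x => (-1 : ℤ) ^ (p * q) • ((ev φ q x).comp p n h).hom c)
    (fun c c' x => by rw [map_add, smul_add])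
    (fun r c x => by rw [map_smul, smul_comm])
    (fun c x y => by rw [ev_add, HomFam.comp_add, ModuleCat.hom_add, LinearMap.add_apply, smul_add])
    (fun r c x => by
      rw [ev_smul, HomFam.comp_smul, ModuleCat.hom_smul, LinearMap.smul_apply, smul_comm])

theorem tensorHomTerm_tmul {X : ChainComplex (ModuleCat.{u} R) ℕ} (φ : X ⟶ homComplex C D) (p q n : ℕ)
    (h : p + q = n) (c : C.X p) (x : X.X q) :
    (tensorHomTerm C φ p q n h).hom (c ⊗ₜ x) =
      (-1 : ℤ) ^ (p * q) • ((ev φ q x).comp p n h).hom c := rfl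

theorem tensorHomTerm_d {X : ChainComplex (ModuleCat.{u} R) ℕ} (φ : X ⟶ homComplex C D) (p q n : ℕ)
    (h : p + 1 + q = n) :
    tensorHomTerm C φ (p + 1) (q + 1) (n + 1) (by omega) ≫ D.d (n + 1) n =
      C.d (p + 1) p ▷ X.X (q + 1) ≫ tensorHomTerm C φ p (q + 1) n (by omega) +
      (-1 : ℤ) ^ (p + 1) • C.X (p + 1) ◁ X.d (q + 1) q ≫ tensorHomTerm C φ (p + 1) q n h := by
  refine ModuleCat.MonoidalCategory.tensor_ext (fun c x => ?_)
  change (D.d (n + 1) n).hom ((-1 : ℤ) ^ ((p + 1) * (q + 1)) •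
    ((ev φ (q + 1) x).comp (p + 1) (n + 1) _).hom c) =
    (-1 : ℤ) ^ (p * (q + 1)) • ((ev φ (q + 1) x).comp p n _).hom ((C.d (p + 1) p).hom c) +
    (-1 : ℤ) ^ (p + 1) • (-1 : ℤ) ^ ((p + 1) * q) •
      ((ev φ q ((X.d (q + 1) q).hom x)).comp (p + 1) n h).hom c
  have key := congrArg (fun a => a.hom c) ((ev φ (q + 1) x).comp_d_succ p n h)
  change (D.d (n + 1) n).hom (((ev φ (q + 1) x).comp (p + 1) (n + 1) _).hom c) =
    ((homD C D q (ev φ (q + 1) x)).comp (p + 1) n h).hom c +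
      (-1 : ℤ) ^ (q + 1) • ((ev φ (q + 1) x).comp p n _).hom ((C.d (p + 1) p).hom c) at key
  rw [map_zsmul, key, ev_d, smul_add, smul_smul, smul_smul, add_comm]
  congr 2
  · rw [← pow_add, show (p + 1) * (q + 1) + (q + 1) = p * (q + 1) + 2 * (q + 1) by ring, pow_add _ _ (2 * _), pow_mul]
    simp
  · rw [← pow_add]
    congr 1; ring

theorem tensorHomTerm_d_zero_left {X : ChainComplex (ModuleCat.{u} R) ℕ} (φ : X ⟶ homComplex C D) (q n : ℕ)
    (h : 0 + q = n) :
    tensorHomTerm C φ 0 (q + 1) (n + 1) (by omega) ≫ D.d (n + 1) n =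
      C.X 0 ◁ X.d (q + 1) q ≫ tensorHomTerm C φ 0 q n h := by
  refine ModuleCat.MonoidalCategory.tensor_ext (fun c x => ?_)
  change (D.d (n + 1) n).hom ((-1 : ℤ) ^ (0 * (q + 1)) •
    ((ev φ (q + 1) x).comp 0 (n + 1) _).hom c) =
    (-1 : ℤ) ^ (0 * q) • ((ev φ q ((X.d (q + 1) q).hom x)).comp 0 n h).hom c
  rw [zero_mul, zero_mul, pow_zero, one_smul, one_smul, ev_d]
  exact congrArg (fun a => a.hom c) ((ev φ (q + 1) x).comp_d_zero n h)

theorem tensorHomTerm_d_zero_right {X : ChainComplex (ModuleCat.{u} R) ℕ} (φ : X ⟶ homComplex C D) (p n : ℕ)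
    (h : p + 0 = n) :
    tensorHomTerm C φ (p + 1) 0 (n + 1) (by omega) ≫ D.d (n + 1) n =
      C.d (p + 1) p ▷ X.X 0 ≫ tensorHomTerm C φ p 0 n h := by
  subst h
  refine ModuleCat.MonoidalCategory.tensor_ext (fun c x => ?_)
  change (D.d (p + 1) p).hom ((-1 : ℤ) ^ ((p + 1) * 0) •
    ((ev φ 0 x).comp (p + 1) (p + 1) _).hom c) =
    (-1 : ℤ) ^ (p * 0) • ((ev φ 0 x).comp p p _).hom ((C.d (p + 1) p).hom c)
  rw [mul_zero, mul_zero, pow_zero, one_smul, one_smul]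
  have h1 := congrArg (fun a => a.hom c) (ev_zero φ x p)
  have h2 := (ev φ 0 x).comp_rfl (p + 1)
  have h3 := (ev φ 0 x).comp_rfl p
  refine (congrArg (fun a : C.X (p + 1) ⟶ D.X (p + 1) => (D.d (p + 1) p).hom (a.hom c)) h2).trans (h1.trans ?_)
  exact (congrArg (fun a : C.X p ⟶ D.X p => a.hom ((C.d (p + 1) p).hom c)) h3).symm

/-- The chain map `C ⊗ X → D`, `c ⊗ x ↦ (-1)^(|c| |x|) φ(x)(c)`, that corresponds to
`φ : X → D^C`. -/
def tensorHomMap {X : ChainComplex (ModuleCat.{u} R) ℕ} (φ : X ⟶ homComplex C D) : C ⊗ X ⟶ D where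
  f n := HomologicalComplex.mapBifunctorDesc (fun p q h => tensorHomTerm C φ p q n h)
  comm' := by
    rintro _ n rfl
    refine HomologicalComplex.mapBifunctor.hom_ext (fun p q h => ?_)
    rw [HomologicalComplex.ι_mapBifunctorDesc_assoc]
    erw [HomologicalComplex.mapBifunctor.d_eq]
    rw [Preadditive.add_comp, Preadditive.comp_add]
    rw [HomologicalComplex.mapBifunctor.ι_D₁_assoc, HomologicalComplex.mapBifunctor.ι_D₂_assoc]
    change p + q = n + 1 at h
    have h1 (p) (h : p + 1 + q = n + 1) : HomologicalComplex.mapBifunctor.d₁ C X (curriedTensor (ModuleCat R)) (ComplexShape.down ℕ) (p + 1) q n ≫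
        HomologicalComplex.mapBifunctorDesc (fun p q h => tensorHomTerm C φ p q n h) =
          C.d (p + 1) p ▷ X.X q ≫ tensorHomTerm C φ p q n (by omega) := by
      rw [HomologicalComplex.mapBifunctor.d₁_eq (i₁' := p) _ _ _ _ (by simp) _ _ (by
          change p + q = n; omega)]
      rw [show ComplexShape.ε₁ (ComplexShape.down ℕ) (ComplexShape.down ℕ) (ComplexShape.down ℕ)
          (p + 1, q) = 1 from rfl, one_smul, Category.assoc, HomologicalComplex.ι_mapBifunctorDesc]
      rfl
    have h2 (q) (h : p + (q + 1) = n + 1) : HomologicalComplex.mapBifunctor.d₂ C X (curriedTensor (ModuleCat R)) (ComplexShape.down ℕ) p (q + 1) n ≫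
        HomologicalComplex.mapBifunctorDesc (fun p q h => tensorHomTerm C φ p q n h) =
          (-1 : ℤ) ^ p • C.X p ◁ X.d (q + 1) q ≫ tensorHomTerm C φ p q n (by omega) := by
      rw [HomologicalComplex.mapBifunctor.d₂_eq (i₂' := q) _ _ _ _ _ (by simp) _ (by
          change p + q = n; omega)]
      rw [show ComplexShape.ε₂ (ComplexShape.down ℕ) (ComplexShape.down ℕ) (ComplexShape.down ℕ)
          (p, q + 1) = (-1) ^ p from rfl, Units.smul_def, Preadditive.zsmul_comp, Category.assoc,
          HomologicalComplex.ι_mapBifunctorDesc]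
      simp only [Units.val_pow_eq_pow_val, Units.val_neg, Units.val_one]
      rfl
    rcases p with _ | p
    · rw [HomologicalComplex.mapBifunctor.d₁_eq_zero _ _ _ _ _ _ _ (by simp), Limits.zero_comp, zero_add]
      rcases q with _ | q
      · omega
      · rw [h2 q h, pow_zero, one_smul]
        exact tensorHomTerm_d_zero_left φ q n (by omega)
    · rw [h1 p h]
      rcases q with _ | q
      · rw [HomologicalComplex.mapBifunctor.d₂_eq_zero _ _ _ _ _ _ _ (by simp), Limits.zero_comp, add_zero]
        exact tensorHomTerm_d_zero_right φ p n (by omega)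
      · rw [h2 q h]
        exact tensorHomTerm_d φ p q n (by omega)

theorem ι_tensorHomMap {X : ChainComplex (ModuleCat.{u} R) ℕ} (φ : X ⟶ homComplex C D) (p q n : ℕ)
    (h : p + q = n) :
    HomologicalComplex.ιTensorObj C X p q n h ≫ (tensorHomMap φ).f n = tensorHomTerm C φ p q n h :=
  HomologicalComplex.ι_mapBifunctorDesc (K₁ := C) (K₂ := X) (F := curriedTensor (ModuleCat.{u} R))
    (c := ComplexShape.down ℕ) (A := D.X n) (j := n) (fun p q h => tensorHomTerm C φ p q n h) p q h

theorem ι_d₁ (X : ChainComplex (ModuleCat.{u} R) ℕ) (p q n : ℕ) (h : p + q = n) :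
    HomologicalComplex.mapBifunctor.d₁ C X (curriedTensor (ModuleCat R)) (ComplexShape.down ℕ)
      (p + 1) q n = C.d (p + 1) p ▷ X.X q ≫ HomologicalComplex.ιTensorObj C X p q n h := by
  rw [HomologicalComplex.mapBifunctor.d₁_eq (i₁' := p) _ _ _ _ (by simp) _ _ h]
  rw [show ComplexShape.ε₁ (ComplexShape.down ℕ) (ComplexShape.down ℕ) (ComplexShape.down ℕ)
      (p + 1, q) = 1 from rfl, one_smul]
  rfl

theorem ι_d₂ (X : ChainComplex (ModuleCat.{u} R) ℕ) (p q n : ℕ) (h : p + q = n) :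
    HomologicalComplex.mapBifunctor.d₂ C X (curriedTensor (ModuleCat R)) (ComplexShape.down ℕ)
      p (q + 1) n = (-1 : ℤ) ^ p • C.X p ◁ X.d (q + 1) q ≫ HomologicalComplex.ιTensorObj C X p q n h := by
  rw [HomologicalComplex.mapBifunctor.d₂_eq (i₂' := q) _ _ _ _ _ (by simp) _ h]
  rw [show ComplexShape.ε₂ (ComplexShape.down ℕ) (ComplexShape.down ℕ) (ComplexShape.down ℕ)
      (p, q + 1) = (-1) ^ p from rfl, Units.smul_def]
  simp only [Units.val_pow_eq_pow_val, Units.val_neg, Units.val_one]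
  rfl

theorem ι_d (X : ChainComplex (ModuleCat.{u} R) ℕ) (p q n : ℕ) (h : p + q = n + 1) :
    HomologicalComplex.ιTensorObj C X p q (n + 1) h ≫ (C ⊗ X).d (n + 1) n =
      HomologicalComplex.mapBifunctor.d₁ C X (curriedTensor (ModuleCat R)) (ComplexShape.down ℕ)
        p q n +
      HomologicalComplex.mapBifunctor.d₂ C X (curriedTensor (ModuleCat R)) (ComplexShape.down ℕ)
        p q n := by
  erw [HomologicalComplex.mapBifunctor.d_eq]
  rw [Preadditive.comp_add, HomologicalComplex.mapBifunctor.ι_D₁,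
    HomologicalComplex.mapBifunctor.ι_D₂]

/-- The map `c ↦ (-1)^(p q) ψ(c ⊗ x)`. -/
def curryTerm {X : ChainComplex (ModuleCat.{u} R) ℕ} (ψ : C ⊗ X ⟶ D) (p q n : ℕ) (h : p + q = n)
    (x : X.X q) : C.X p ⟶ D.X n :=
  ModuleCat.ofHom ((-1 : ℤ) ^ (p * q) •
    (HomologicalComplex.ιTensorObj C X p q n h ≫ ψ.f n).hom ∘ₗ (TensorProduct.mk R (C.X p) (X.X q)).flip x)

theorem curryTerm_apply {X : ChainComplex (ModuleCat.{u} R) ℕ} (ψ : C ⊗ X ⟶ D) (p q n : ℕ) (h : p + q = n)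
    (x : X.X q) (c : C.X p) : (curryTerm ψ p q n h x).hom c = (-1 : ℤ) ^ (p * q) •
      (HomologicalComplex.ιTensorObj C X p q n h ≫ ψ.f n).hom (c ⊗ₜ x) := rfl

/-- The family of maps `c ↦ (-1)^(|c| |x|) ψ(c ⊗ x)`. -/
def curryFam {X : ChainComplex (ModuleCat.{u} R) ℕ} (ψ : C ⊗ X ⟶ D) (q : ℕ) :
    X.X q →ₗ[R] HomFam C D q where
  toFun x p := curryTerm ψ p q (p + q) rfl x
  map_add' x y := by
    funext p
    refine ModuleCat.hom_ext (LinearMap.ext (fun c => ?_))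
    change (curryTerm ψ p q _ rfl _).hom c = (curryTerm ψ p q _ rfl _).hom c + (curryTerm ψ p q _ rfl _).hom c
    simp only [curryTerm_apply, TensorProduct.tmul_add, map_add, smul_add]
  map_smul' r x := by
    funext p
    refine ModuleCat.hom_ext (LinearMap.ext (fun c => ?_))
    change (curryTerm ψ p q _ rfl _).hom c = r • (curryTerm ψ p q _ rfl _).hom c
    simp only [curryTerm_apply, TensorProduct.tmul_smul, map_smul]
    rw [smul_comm]

theorem curryFam_comp {X : ChainComplex (ModuleCat.{u} R) ℕ} (ψ : C ⊗ X ⟶ D) (p q n : ℕ) (h : p + q = n)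
    (x : X.X q) : (curryFam ψ q x).comp p n h = curryTerm ψ p q n h x := by
  subst h
  rw [HomFam.comp_rfl]; rfl

theorem curry_d {X : ChainComplex (ModuleCat.{u} R) ℕ} (ψ : C ⊗ X ⟶ D) (p q n : ℕ) (h : p + q = n + 1) :
    (HomologicalComplex.ιTensorObj C X p q (n + 1) h ≫ ψ.f (n + 1)) ≫ D.d (n + 1) n =
      HomologicalComplex.mapBifunctor.d₁ C X (curriedTensor (ModuleCat R)) (ComplexShape.down ℕ)
        p q n ≫ ψ.f n +
      HomologicalComplex.mapBifunctor.d₂ C X (curriedTensor (ModuleCat R)) (ComplexShape.down ℕ)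
        p q n ≫ ψ.f n := by
  rw [Category.assoc, ψ.comm, ← Category.assoc, ι_d, Preadditive.add_comp]

theorem curry_d_succ {X : ChainComplex (ModuleCat.{u} R) ℕ} (ψ : C ⊗ X ⟶ D) (q : ℕ) (x : X.X (q + 1)) :
    curryFam ψ q ((X.d (q + 1) q).hom x) = homD C D q (curryFam ψ (q + 1) x) := by
  funext p
  rcases p with _ | p
  · rw [homD_zero]
    refine ModuleCat.hom_ext (LinearMap.ext (fun c => ?_))
    have h := curry_d ψ 0 (q + 1) (0 + q) rfl
    rw [HomologicalComplex.mapBifunctor.d₁_eq_zero _ _ _ _ _ _ _ (by simp), Limits.zero_comp,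
      ι_d₂ _ _ _ _ rfl, Preadditive.zsmul_comp] at h
    have h := congrArg (fun a => a.hom (c ⊗ₜ x)) (h.trans (zero_add _))
    change (D.d _ _).hom ((HomologicalComplex.ιTensorObj C X 0 (q + 1) _ _ ≫ ψ.f _).hom (c ⊗ₜ x)) =
      ((-1 : ℤ) ^ 0) • (HomologicalComplex.ιTensorObj C X 0 q _ _ ≫ ψ.f _).hom (c ⊗ₜ (X.d (q + 1) q).hom x) at h
    change (-1 : ℤ) ^ (0 * q) • (HomologicalComplex.ιTensorObj C X 0 q _ _ ≫ ψ.f _).hom (c ⊗ₜ (X.d (q + 1) q).hom x)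
     = (D.d _ _).hom ((-1 : ℤ) ^ (0 * (q + 1)) • (HomologicalComplex.ιTensorObj C X 0 (q + 1) _ _ ≫ ψ.f _).hom (c ⊗ₜ x))
    rw [zero_mul, zero_mul, pow_zero, one_smul, one_smul]
    rw [pow_zero, one_smul] at h
    exact h.symm
  · rw [homD_succ, curryFam_comp]
    refine ModuleCat.hom_ext (LinearMap.ext (fun c => ?_))
    have h := curry_d ψ (p + 1) (q + 1) (p + 1 + q) rfl
    rw [ι_d₁ _ _ _ _ (by omega), ι_d₂ _ _ _ _ rfl, Preadditive.zsmul_comp] at h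
    have h := congrArg (fun a => a.hom (c ⊗ₜ x)) h
    change (D.d _ _).hom ((HomologicalComplex.ιTensorObj C X (p + 1) (q + 1) _ _ ≫ ψ.f _).hom (c ⊗ₜ x)) =
      (HomologicalComplex.ιTensorObj C X p (q + 1) _ _ ≫ ψ.f _).hom ((C.d (p + 1) p).hom c ⊗ₜ x) +
      ((-1 : ℤ) ^ (p + 1)) • (HomologicalComplex.ιTensorObj C X (p + 1) q _ _ ≫ ψ.f _).hom (c ⊗ₜ (X.d (q + 1) q).hom x) at h
    change (-1 : ℤ) ^ ((p + 1) * q) • (HomologicalComplex.ιTensorObj C X (p + 1) q _ _ ≫ ψ.f _).hom (c ⊗ₜ (X.d (q + 1) q).hom x)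
     = (D.d _ _).hom ((-1 : ℤ) ^ ((p + 1) * (q + 1)) • (HomologicalComplex.ιTensorObj C X (p + 1) (q + 1) _ _ ≫ ψ.f _).hom (c ⊗ₜ x)) -
      (-1 : ℤ) ^ (q + 1) • (-1 : ℤ) ^ (p * (q + 1)) • (HomologicalComplex.ιTensorObj C X p (q + 1) _ _ ≫ ψ.f _).hom ((C.d (p + 1) p).hom c ⊗ₜ x)
    rw [map_zsmul]
    erw [h]
    rw [smul_add, smul_smul, smul_smul, ← pow_add, ← pow_add,
      show (p + 1) * (q + 1) = q + 1 + p * (q + 1) by ring, add_sub_cancel_left]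
    congr 1
    rw [show q + 1 + p * (q + 1) + (p + 1) = (p + 1) * q + 2 * (p + 1) by ring, pow_add _ _ (2 * _), pow_mul]
    simp

theorem curry_d_zero {X : ChainComplex (ModuleCat.{u} R) ℕ} (ψ : C ⊗ X ⟶ D) (x : X.X 0) (p : ℕ) :
    curryFam ψ 0 x (p + 1) ≫ D.d (p + 1) p = C.d (p + 1) p ≫ curryFam ψ 0 x p := by
  refine ModuleCat.hom_ext (LinearMap.ext (fun c => ?_))
  have h := curry_d ψ (p + 1) 0 p rfl
  rw [HomologicalComplex.mapBifunctor.d₂_eq_zero _ _ _ _ _ _ _ (by simp), Limits.zero_comp,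
    ι_d₁ X p 0 p rfl] at h
  have h := congrArg (fun a => a.hom (c ⊗ₜ x)) (h.trans (add_zero _))
  change (D.d _ _).hom ((HomologicalComplex.ιTensorObj C X (p + 1) 0 _ _ ≫ ψ.f _).hom (c ⊗ₜ x)) =
    (HomologicalComplex.ιTensorObj C X p 0 _ _ ≫ ψ.f _).hom ((C.d (p + 1) p).hom c ⊗ₜ x) at h
  change (D.d _ _).hom ((-1 : ℤ) ^ ((p + 1) * 0) • (HomologicalComplex.ιTensorObj C X (p + 1) 0 _ _ ≫ ψ.f _).hom (c ⊗ₜ x)) =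
    (-1 : ℤ) ^ (p * 0) • (HomologicalComplex.ιTensorObj C X p 0 _ _ ≫ ψ.f _).hom ((C.d (p + 1) p).hom c ⊗ₜ x)
  rw [mul_zero, mul_zero, pow_zero, one_smul, one_smul]
  exact h

theorem ev_ofEv (X : ChainComplex (ModuleCat.{u} R) ℕ) (e : ∀ q, X.X q →ₗ[R] HomFam C D q) (h h0)
    (q : ℕ) (x : X.X q) : ev (ofEv X e h h0) q x = e q x := rfl

/-- `tensorHomMap` as a linear map. -/
def tensorHomLinear (C D X : ChainComplex (ModuleCat.{u} R) ℕ) : (X ⟶ homComplex C D) →ₗ[R] (C ⊗ X ⟶ D) where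
  toFun φ := tensorHomMap φ
  map_add' φ ψ := by
    ext n : 1
    refine HomologicalComplex.mapBifunctor.hom_ext (fun p q h => ?_)
    refine (ι_tensorHomMap _ p q n h).trans (Eq.trans ?_ (Preadditive.comp_add _ _ _ _ _ _).symm)
    refine Eq.trans ?_ (congrArg₂ (· + ·) (ι_tensorHomMap φ p q n h) (ι_tensorHomMap ψ p q n h)).symm
    refine ModuleCat.MonoidalCategory.tensor_ext (fun c x => ?_)
    rw [ModuleCat.hom_add, LinearMap.add_apply]
    simp only [tensorHomTerm_tmul, ev_add_left, HomFam.comp_add, ModuleCat.hom_add, LinearMap.add_apply, smul_add]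
  map_smul' r φ := by
    ext n : 1
    refine HomologicalComplex.mapBifunctor.hom_ext (fun p q h => ?_)
    refine (ι_tensorHomMap _ p q n h).trans (Eq.trans ?_ (Linear.comp_smul _ _ _ _ _ _).symm)
    refine Eq.trans ?_ (congrArg (r • ·) (ι_tensorHomMap φ p q n h)).symm
    refine ModuleCat.MonoidalCategory.tensor_ext (fun c x => ?_)
    rw [ModuleCat.hom_smul, LinearMap.smul_apply]
    simp only [tensorHomTerm_tmul, ev_smul_left, HomFam.comp_smul, ModuleCat.hom_smul, LinearMap.smul_apply]
    rw [smul_comm]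

theorem neg_one_smul_smul {M : Type*} [AddCommGroup M] (k : ℕ) (m : M) :
    (-1 : ℤ) ^ k • (-1 : ℤ) ^ k • m = m := by
  rw [smul_smul, ← mul_pow]; simp

theorem tensorHomLinear_bijective (C D X : ChainComplex (ModuleCat.{u} R) ℕ) :
    Function.Bijective (tensorHomLinear C D X) := by
  constructor
  · intro φ ψ e
    refine ev_ext (fun p q x => ModuleCat.hom_ext (LinearMap.ext (fun c => ?_)))
    have h : tensorHomTerm C φ p q (p + q) rfl = tensorHomTerm C ψ p q (p + q) rfl := by
      rw [← ι_tensorHomMap, ← ι_tensorHomMap]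
      exact congrArg (fun χ : C ⊗ X ⟶ D => _ ≫ χ.f (p + q)) e
    have h := congrArg (fun a => (-1 : ℤ) ^ (p * q) • a.hom (c ⊗ₜ x)) h
    simp only [tensorHomTerm_tmul, neg_one_smul_smul, HomFam.comp_rfl] at h
    exact h
  · intro ψ
    refine ⟨ofEv X (curryFam ψ) (curry_d_succ ψ) (curry_d_zero ψ), ?_⟩
    ext n : 1
    refine HomologicalComplex.mapBifunctor.hom_ext (fun p q h => ?_)
    refine (ι_tensorHomMap _ p q n h).trans ?_
    refine ModuleCat.MonoidalCategory.tensor_ext (fun c x => ?_)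
    rw [tensorHomTerm_tmul, ev_ofEv, curryFam_comp, curryTerm_apply, neg_one_smul_smul]

theorem tensorHomMap_naturality {X Y : ChainComplex (ModuleCat.{u} R) ℕ} (f : Y ⟶ X) (φ : X ⟶ homComplex C D) :
    tensorHomMap (f ≫ φ) = C ◁ f ≫ tensorHomMap φ := by
  ext n : 1
  refine HomologicalComplex.mapBifunctor.hom_ext (fun p q h => ?_)
  refine (ι_tensorHomMap _ p q n h).trans ?_
  change _ = _ ≫ (HomologicalComplex.mapBifunctorMap _ _ _ _).f n ≫ _
  rw [HomologicalComplex.ι_mapBifunctorMap_assoc]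
  refine Eq.trans ?_ (congrArg (fun a => _ ≫ _ ≫ a) (ι_tensorHomMap φ p q n h)).symm
  refine ModuleCat.MonoidalCategory.tensor_ext (fun c x => ?_)
  rfl

/-- The tensor-hom isomorphism `Hom(X, D^C) ≅ Hom(C ⊗ X, D)`. -/
def tensorHomIso (C D : ChainComplex (ModuleCat.{u} R) ℕ) :
    (linearYoneda R _).obj (homComplex C D) ≅ (tensorLeft C).op ⋙ (linearYoneda R _).obj D :=
  NatIso.ofComponents (fun X => (LinearEquiv.ofBijective (tensorHomLinear C D X.unop)
    (tensorHomLinear_bijective C D X.unop)).toModuleIso) (fun f => by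
      refine ModuleCat.hom_ext (LinearMap.ext (fun φ => ?_))
      exact tensorHomMap_naturality f.unop φ)

/-- Functoriality of the internal hom of simplicial modules. -/
def sHomMap {A A' B B' : SimplicialObject (ModuleCat.{u} R)} (f : A' ⟶ A) (g : B ⟶ B') :
    sHom A B ⟶ sHom A' B' :=
  Functor.whiskerRight (NatTrans.op (Functor.whiskerLeft (stdSimplexModule R)
      ((tensoringLeft _).map f))) ((linearYoneda R _).obj B) ≫
    Functor.whiskerLeft (stdSimplexModule R ⋙ tensorLeft A').op ((linearYoneda R _).map g)

/-- Functoriality of `Hom(X ⊗ N (R Δ^n), D)` in `X`. -/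
def homTensorMap {X X' : ChainComplex (ModuleCat.{u} R) ℕ} (f : X' ⟶ X) (D : ChainComplex (ModuleCat.{u} R) ℕ) :
    homTensor X D ⟶ homTensor X' D :=
  Functor.whiskerRight (NatTrans.op (Functor.whiskerLeft (stdSimplexModule R ⋙ N)
    ((tensoringLeft _).map f))) ((linearYoneda R _).obj D)

/-- Pre- and postcomposition of a family with chain maps. -/
def homComplexMapFam {C C' D D' : ChainComplex (ModuleCat.{u} R) ℕ} (f : C' ⟶ C) (g : D ⟶ D') (n : ℕ) :
    HomFam C D n →ₗ[R] HomFam C' D' n where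
  toFun φ p := f.f p ≫ φ p ≫ g.f (p + n)
  map_add' φ ψ := by funext p; simp
  map_smul' r φ := by funext p; simp

theorem homComplexMapFam_d {C C' D D' : ChainComplex (ModuleCat.{u} R) ℕ} (f : C' ⟶ C) (g : D ⟶ D') (n : ℕ)
    (φ : HomFam C D (n + 1)) :
    homD C' D' n (homComplexMapFam f g (n + 1) φ) = homComplexMapFam f g n (homD C D n φ) := by
  have h (p m h) : (homComplexMapFam f g (n + 1) φ).comp p m h = f.f p ≫ φ.comp p m h ≫ g.f m := by
    subst h
    rw [HomFam.comp_rfl, HomFam.comp_rfl]; rfl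
  funext p
  change _ = f.f p ≫ homD C D n φ p ≫ g.f (p + n)
  rcases p with _ | p
  · rw [homD_zero, homD_zero]
    simp [homComplexMapFam]
  · rw [homD_succ, homD_succ, h]
    simp [homComplexMapFam]

/-- Functoriality of the internal hom of chain complexes. -/
def homComplexMap {C C' D D' : ChainComplex (ModuleCat.{u} R) ℕ} (f : C' ⟶ C) (g : D ⟶ D') :
    homComplex C D ⟶ homComplex C' D' where
  f n := ModuleCat.ofHom (X := homCycles C D n) (Y := homCycles C' D' n)
    ((homComplexMapFam f g n).restrict (by
      rintro φ h rfl p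
      have := h rfl p
      change (f.f _ ≫ φ _ ≫ g.f _) ≫ D'.d (p + 1) p = C'.d _ _ ≫ f.f _ ≫ φ p ≫ g.f p
      rw [Category.assoc, Category.assoc]
      refine (congrArg (fun a => _ ≫ _ ≫ a) (g.comm (p + 1) p)).trans ?_
      rw [← f.comm_assoc]
      refine congrArg (_ ≫ ·) ?_
      rw [← Category.assoc, ← Category.assoc]
      exact congrArg (· ≫ _) this))
  comm' := by
    rintro _ n rfl
    rw [homComplex_d, homComplex_d]
    refine ModuleCat.hom_ext (LinearMap.ext (fun x => Subtype.ext ?_))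
    exact homComplexMapFam_d f g n x.1

/-- The identification `Γ (D^C) ≅ Hom(C ⊗ N (R Δ^n), D)`: an `n`-simplex is a map `R Δ^n → Γ (D^C)`,
which is a map `N (R Δ^n) → D^C`, which is a map `C ⊗ N (R Δ^n) → D`. -/
def gammaHomIso (C D : ChainComplex (ModuleCat.{u} R) ℕ) : Γ.obj (homComplex C D) ≅ homTensor C D :=
  (yonedaIso (Γ.obj (homComplex C D))).symm ≪≫
    Functor.isoWhiskerLeft (stdSimplexModule R).op (dkIso (homComplex C D)) ≪≫
    Functor.isoWhiskerLeft (stdSimplexModule R ⋙ N).op (tensorHomIso C D)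

/-- The identification `(Γ D)^A ≅ Hom(N (A ⊗ R Δ^n), D)`. -/
def sHomGammaIso (A : SimplicialObject (ModuleCat.{u} R)) (D : ChainComplex (ModuleCat.{u} R) ℕ) :
    sHom A (Γ.obj D) ≅ homNormalized A D :=
  Functor.isoWhiskerLeft (stdSimplexModule R ⋙ tensorLeft A).op (dkIso D)

/-- The identification `B^A ≅ Hom(N (A ⊗ R Δ^n), N B)`. -/
def sHomIso (A B : SimplicialObject (ModuleCat.{u} R)) : sHom A B ≅ homNormalized A (N.obj B) :=
  Functor.isoWhiskerLeft (stdSimplexModule R ⋙ tensorLeft A).op (ffIso B)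

/-- The map `AW^* : Γ (D^C) → (Γ D)^(Γ C)`: restriction along
`N (Γ C ⊗ R Δ^n) → N (Γ C) ⊗ N (R Δ^n) ≅ C ⊗ N (R Δ^n)`. -/
def awGamma (C D : ChainComplex (ModuleCat.{u} R) ℕ) :
    Γ.obj (homComplex C D) ⟶ sHom (Γ.obj C) (Γ.obj D) :=
  (gammaHomIso C D).hom ≫ homTensorMap (dkCounit C).hom D ≫ awStar (Γ.obj C) D ≫
    (sHomGammaIso (Γ.obj C) D).inv

/-- The map `EZ^* : (Γ D)^(Γ C) → Γ (D^C)`: restriction along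
`C ⊗ N (R Δ^n) ≅ N (Γ C) ⊗ N (R Δ^n) → N (Γ C ⊗ R Δ^n)`. -/
def ezGamma (C D : ChainComplex (ModuleCat.{u} R) ℕ) :
    sHom (Γ.obj C) (Γ.obj D) ⟶ Γ.obj (homComplex C D) :=
  (sHomGammaIso (Γ.obj C) D).hom ≫ ezStar (Γ.obj C) D ≫ homTensorMap (dkCounit C).inv D ≫
    (gammaHomIso C D).inv

/-- The map `AW^* : (N B)^(N A) → N (B^A)`: under `(N B)^(N A) ≅ N Γ ((N B)^(N A))` it is the
normalization of the restriction `Hom(N A ⊗ N (R Δ^n), N B) → Hom(N (A ⊗ R Δ^n), N B)` along the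
Alexander–Whitney map. -/
def awN (A B : SimplicialObject (ModuleCat.{u} R)) :
    homComplex (N.obj A) (N.obj B) ⟶ N.obj (sHom A B) :=
  (dkCounit (homComplex (N.obj A) (N.obj B))).inv ≫
    N.map ((gammaHomIso (N.obj A) (N.obj B)).hom ≫ awStar A (N.obj B) ≫ (sHomIso A B).inv)

/-- The map `EZ^* : N (B^A) → (N B)^(N A)`: the normalization of the restriction
`Hom(N (A ⊗ R Δ^n), N B) → Hom(N A ⊗ N (R Δ^n), N B)` along the Eilenberg–Zilber map. -/
def ezN (A B : SimplicialObject (ModuleCat.{u} R)) :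
    N.obj (sHom A B) ⟶ homComplex (N.obj A) (N.obj B) :=
  N.map ((sHomIso A B).hom ≫ ezStar A (N.obj B) ≫ (gammaHomIso (N.obj A) (N.obj B)).inv) ≫
    (dkCounit (homComplex (N.obj A) (N.obj B))).hom

end

end DoldKanHom

open DoldKanHom

namespace DoldKanHom

noncomputable section

open SimplexCategory AlgebraicTopology

variable {R : Type u} [CommRing R]

/-! On normalized chains the shuffle map followed by the Alexander–Whitney map is the identity on
the nose (`ez_aw`): when the front and back faces of a sum of shuffles are taken, every term has a
degenerate factor except the one in which both factors are identities. Restriction reverses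
composition, so `EZ^* ∘ AW^*` is the identity and needs no homotopy.

The other composite is restriction along `aw ≫ ez` on `N (A ⊗ R Δ^n)`. This map is induced by a
natural endomorphism `awEz` of the unnormalized chains of `A ⊗ B` that is the identity in degree
`0`. The method of acyclic models gives a natural homotopy `h` with `awEz = 1 + d h + h d`
(`awEz_eq`): a natural map out of `A_n ⊗ B_n` is determined freely by its value on the universal
simplex of `R Δ^n ⊗ R Δ^n`, and this model is contractible by an extra degeneracy.

A natural chain homotopy is not yet a simplicial homotopy between self-maps of `[n] ↦ Hom(N (A ⊗ R
Δ^n), D)`. For that one wants an endomorphism of `N (A ⊗ R Δ^n)` for every `t : [n] → [1]`,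
compatible with all `[m] → [n]`, equal to `aw ≫ ez` at the constant `0` and to the identity at the
constant `1`. The point is that `d h' + h' d` is a chain map for every family `h'` of linear maps
that raise the degree by one. Hence `h` may be precomposed with a degreewise projection that need
not commute with `d`. The projection of `R Δ^n` onto the simplices whose last vertex is sent to `0`
by `t` is compatible with all `[m] → [n]`, is the identity at one end and zero at the other. The
resulting maps `1 + d h_t + h_t d`, normalized, are `interpolation`, and `homotopyOfFamily` turns
them into a simplicial homotopy.

Both parts of the theorem follow by transport along the identifications of the mapping objects. For
the second, the simplicial homotopy is converted into a chain homotopy of normalized chains.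
Naturality of `AW^*` reduces to that of `aw`, of the counit `N Γ C ≅ C` and of the tensor-hom
bijection. -/

/-! ### Simplices as maps out of `R Δ^n` -/

/-- The map `R Δ^n → X` classifying an `n`-simplex, as a linear equivalence. -/
def classify (X : SimplicialObject (ModuleCat.{u} R)) (n : SimplexCategory) :
    X.obj (op n) ≃ₗ[R] ((stdSimplexModule R).obj n ⟶ X) :=
  (LinearEquiv.ofBijective (yonedaEval X n) (yonedaEval_bijective X n)).symm

theorem classify_app_fundSimplex (X : SimplicialObject (ModuleCat.{u} R)) (n : SimplexCategory)
    (x : X.obj (op n)) : ((classify X n x).app (op n)).hom (fundSimplex n) = x :=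
  (LinearEquiv.ofBijective (yonedaEval X n) (yonedaEval_bijective X n)).apply_symm_apply x

theorem hom_ext_fundSimplex {X : SimplicialObject (ModuleCat.{u} R)} {n : SimplexCategory}
    {g h : (stdSimplexModule R).obj n ⟶ X}
    (e : (g.app (op n)).hom (fundSimplex n) = (h.app (op n)).hom (fundSimplex n)) : g = h :=
  (yonedaEval_bijective X n).1 e

theorem classify_comp {X Y : SimplicialObject (ModuleCat.{u} R)} (f : X ⟶ Y) (n : SimplexCategory)
    (x : X.obj (op n)) : classify X n x ≫ f = classify Y n ((f.app (op n)).hom x) := by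
  apply hom_ext_fundSimplex
  rw [classify_app_fundSimplex]
  exact congrArg (f.app (op n)).hom (classify_app_fundSimplex X n x)

theorem classify_fundSimplex (n : SimplexCategory) :
    classify ((stdSimplexModule R).obj n) n (fundSimplex n) = 𝟙 _ := by
  apply hom_ext_fundSimplex
  rw [classify_app_fundSimplex]
  rfl

/-! ### Natural maps out of `A_n ⊗ B_n` and their models -/

/-- Naturality of a family of maps `A_n ⊗ B_n → A_m ⊗ B_m`. -/
def IsNatural {n m : ℕ} (α : ∀ A B : SimplicialObject (ModuleCat.{u} R), (chains.obj (A ⊗ B)).X n ⟶ (chains.obj (A ⊗ B)).X m) : Prop :=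
  ∀ ⦃A A' B B' : SimplicialObject (ModuleCat.{u} R)⦄ (f : A ⟶ A') (g : B ⟶ B'),
    (chains.map (f ⊗ₘ g)).f n ≫ α A' B' = α A B ≫ (chains.map (f ⊗ₘ g)).f m

variable (R) in
/-- The model `R Δ^n ⊗ R Δ^n`. -/
abbrev model (n : ℕ) : SimplicialObject (ModuleCat.{u} R) :=
  (stdSimplexModule R).obj ⦋n⦌ ⊗ (stdSimplexModule R).obj ⦋n⦌

variable (R) in
/-- The universal `n`-simplex of the model `R Δ^n ⊗ R Δ^n`. -/
def modelSimplex (n : ℕ) : (chains.obj (model R n)).X n :=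
  (fundSimplex ⦋n⦌ : ((stdSimplexModule R).obj ⦋n⦌) _⦋n⦌) ⊗ₜ[R]
    (fundSimplex ⦋n⦌ : ((stdSimplexModule R).obj ⦋n⦌) _⦋n⦌)

/-- The natural map `A_n ⊗ B_n → A_m ⊗ B_m` that sends the universal simplex of the model to `w`. -/
def ofModel {n m : ℕ} (w : (chains.obj (model R n)).X m) (A B : SimplicialObject (ModuleCat.{u} R)) :
    (chains.obj (A ⊗ B)).X n ⟶ (chains.obj (A ⊗ B)).X m :=
  ModuleCat.ofHom (X := TensorProduct R (A _⦋n⦌) (B _⦋n⦌)) (Y := TensorProduct R (A _⦋m⦌) (B _⦋m⦌))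
    (TensorProduct.lift (LinearMap.mk₂ R
      (fun a b => (TensorProduct.map ((classify A ⦋n⦌ a).app (op ⦋m⦌)).hom
        ((classify B ⦋n⦌ b).app (op ⦋m⦌)).hom :
        TensorProduct R (((stdSimplexModule R).obj ⦋n⦌) _⦋m⦌) (((stdSimplexModule R).obj ⦋n⦌) _⦋m⦌)
          →ₗ[R] TensorProduct R (A _⦋m⦌) (B _⦋m⦌)) w)
      (fun a a' b => by
        rw [map_add, NatTrans.app_add, ModuleCat.hom_add, TensorProduct.map_add_left]; rfl)
      (fun r a b => by
        rw [map_smul]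
        exact LinearMap.congr_fun (TensorProduct.map_smul_left r
          ((classify A ⦋n⦌ a).app (op ⦋m⦌)).hom ((classify B ⦋n⦌ b).app (op ⦋m⦌)).hom) w)
      (fun a b b' => by
        rw [map_add, NatTrans.app_add, ModuleCat.hom_add, TensorProduct.map_add_right]; rfl)
      (fun r a b => by
        rw [map_smul]
        exact LinearMap.congr_fun (TensorProduct.map_smul_right r
          ((classify A ⦋n⦌ a).app (op ⦋m⦌)).hom ((classify B ⦋n⦌ b).app (op ⦋m⦌)).hom) w)))

/-- The simplex `a ⊗ b` is the image of the universal one under the tensor product of the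
classifying maps, so naturality leaves no other possible value. -/
theorem ofModel_tmul {n m : ℕ} (w : (chains.obj (model R n)).X m) (A B : SimplicialObject (ModuleCat.{u} R))
    (a : A _⦋n⦌) (b : B _⦋n⦌) :
    (ofModel w A B).hom (a ⊗ₜ[R] b) =
      ((classify A ⦋n⦌ a ⊗ₘ classify B ⦋n⦌ b).app (op ⦋m⦌)).hom w := rfl

theorem ofModel_isNatural {n m : ℕ} (w : (chains.obj (model R n)).X m) : IsNatural (ofModel w) := by
  intro A A' B B' f g
  refine ModuleCat.MonoidalCategory.tensor_ext (fun a b => ?_)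
  have h := congrArg (fun φ => (φ.app (op ⦋m⦌)).hom w)
    (tensorHom_comp_tensorHom (classify A ⦋n⦌ a) (classify B ⦋n⦌ b) f g)
  rw [classify_comp, classify_comp] at h
  exact h.symm

theorem ofModel_modelSimplex {n m : ℕ} (w : (chains.obj (model R n)).X m) :
    (ofModel w ((stdSimplexModule R).obj ⦋n⦌) ((stdSimplexModule R).obj ⦋n⦌)).hom (modelSimplex R n) = w := by
  refine (ofModel_tmul w _ _ _ _).trans ?_
  rw [classify_fundSimplex, id_tensorHom_id]
  rfl

/-- A natural transformation out of `A_n ⊗ B_n` is determined by the universal simplex of the model. -/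
theorem IsNatural.ext {n m : ℕ}
    {α β : ∀ A B : SimplicialObject (ModuleCat.{u} R), (chains.obj (A ⊗ B)).X n ⟶ (chains.obj (A ⊗ B)).X m}
    (hα : IsNatural α) (hβ : IsNatural β)
    (h : (α _ _).hom (modelSimplex R n) = (β _ _).hom (modelSimplex R n))
    (A B : SimplicialObject (ModuleCat.{u} R)) : α A B = β A B := by
  refine ModuleCat.MonoidalCategory.tensor_ext (fun a b => ?_)
  -- Every pure tensor is the image of the universal simplex under a map `f ⊗ g`, which is the kind
  -- of map for which naturality is assumed.
  have key : ((classify A ⦋n⦌ a ⊗ₘ classify B ⦋n⦌ b).app (op ⦋n⦌)).hom (modelSimplex R n) = a ⊗ₜ[R] b :=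
    congrArg₂ (fun a b => a ⊗ₜ[R] b) (classify_app_fundSimplex A ⦋n⦌ a) (classify_app_fundSimplex B ⦋n⦌ b)
  have h1 := congrArg (fun φ => φ.hom (modelSimplex R n)) (hα (classify A ⦋n⦌ a) (classify B ⦋n⦌ b))
  have h2 := congrArg (fun φ => φ.hom (modelSimplex R n)) (hβ (classify A ⦋n⦌ a) (classify B ⦋n⦌ b))
  refine (congrArg (α A B).hom key).symm.trans (h1.trans (Eq.trans ?_ (h2.symm.trans (congrArg (β A B).hom key))))
  exact congrArg ((classify A ⦋n⦌ a ⊗ₘ classify B ⦋n⦌ b).app (op ⦋m⦌)).hom h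

/-! ### Contractibility of the models -/

variable (R) in
/-- The extra degeneracy of `R Δ^n`. -/
def extraDegeneracy (n : ℕ) : SimplicialObject.Augmented.ExtraDegeneracy
    (((SimplicialObject.Augmented.whiskering _ _).obj (ModuleCat.free R)).obj
      (SSet.Augmented.stdSimplex.{u}.obj ⦋n⦌)) :=
  (SSet.Augmented.StandardSimplex.extraDegeneracy ⦋n⦌).map (ModuleCat.free R)

variable (R) in
/-- The extra degeneracy of the model `R Δ^n ⊗ R Δ^n`. -/
def cone (n m : ℕ) : (chains.obj (model R n)).X m ⟶ (chains.obj (model R n)).X (m + 1) :=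
  ((extraDegeneracy R n).s m ⊗ₘ (extraDegeneracy R n).s m :
    ((stdSimplexModule R).obj ⦋n⦌) _⦋m⦌ ⊗ ((stdSimplexModule R).obj ⦋n⦌) _⦋m⦌ ⟶
    ((stdSimplexModule R).obj ⦋n⦌) _⦋m + 1⦌ ⊗ ((stdSimplexModule R).obj ⦋n⦌) _⦋m + 1⦌)

/-- Faces of a tensor product act diagonally, so the identities of an extra degeneracy hold factor
by factor. -/
theorem cone_δ_zero (n m : ℕ) : cone R n m ≫ (model R n).δ 0 = 𝟙 _ := by
  refine (tensorHom_comp_tensorHom _ _ _ _).trans ?_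
  refine Eq.trans (congrArg₂ (fun a b => a ⊗ₘ b) ((extraDegeneracy R n).s_comp_δ₀ m)
    ((extraDegeneracy R n).s_comp_δ₀ m)) (id_tensorHom_id _ _)

theorem cone_δ_succ (n m : ℕ) (i : Fin (m + 2)) :
    cone R n (m + 1) ≫ (model R n).δ i.succ = (model R n).δ i ≫ cone R n m := by
  refine (tensorHom_comp_tensorHom _ _ _ _).trans (Eq.trans ?_ (tensorHom_comp_tensorHom _ _ _ _).symm)
  exact congrArg₂ (fun a b => a ⊗ₘ b) ((extraDegeneracy R n).s_comp_δ m i)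
    ((extraDegeneracy R n).s_comp_δ m i)

/-- Face `0` undoes the cone and contributes the identity. The remaining faces pass through the cone
with their index lowered by one, which reverses their signs. The degrees are positive, so no
augmentation term occurs. -/
theorem cone_d (n m : ℕ) :
    cone R n (m + 1) ≫ (chains.obj (model R n)).d (m + 2) (m + 1) =
      𝟙 _ - (chains.obj (model R n)).d (m + 1) m ≫ cone R n m := by
  rw [alternatingFaceMapComplex_obj_d, AlternatingFaceMapComplex.objD, alternatingFaceMapComplex_obj_d,
    AlternatingFaceMapComplex.objD]
  refine (Preadditive.comp_sum _ _ _).trans ?_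
  rw [Fin.sum_univ_succ]
  rw [Preadditive.comp_zsmul, cone_δ_zero, Preadditive.sum_comp, sub_eq_add_neg, ← Finset.sum_neg_distrib]
  refine congrArg₂ (· + ·) (one_smul ℤ (𝟙 _)) (Finset.sum_congr rfl (fun i _ => ?_))
  rw [Preadditive.comp_zsmul, cone_δ_succ, Preadditive.zsmul_comp]
  rw [Fin.val_succ, pow_succ, mul_neg, mul_one]
  exact neg_smul _ _

/-! ### Acyclic models: a natural homotopy to the identity -/

theorem IsNatural.comp {n m l : ℕ}
    {α : ∀ A B : SimplicialObject (ModuleCat.{u} R), (chains.obj (A ⊗ B)).X n ⟶ (chains.obj (A ⊗ B)).X m}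
    {β : ∀ A B : SimplicialObject (ModuleCat.{u} R), (chains.obj (A ⊗ B)).X m ⟶ (chains.obj (A ⊗ B)).X l}
    (hα : IsNatural α) (hβ : IsNatural β) : IsNatural (fun A B => α A B ≫ β A B) := by
  intro A A' B B' f g
  rw [← Category.assoc, hα, Category.assoc, hβ, Category.assoc]

theorem IsNatural.sub {n m : ℕ}
    {α β : ∀ A B : SimplicialObject (ModuleCat.{u} R), (chains.obj (A ⊗ B)).X n ⟶ (chains.obj (A ⊗ B)).X m}
    (hα : IsNatural α) (hβ : IsNatural β) : IsNatural (fun A B => α A B - β A B) := by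
  intro A A' B B' f g
  rw [Preadditive.comp_sub, Preadditive.sub_comp, hα, hβ]

theorem isNatural_id (n : ℕ) : IsNatural (R := R) (n := n) (fun A B => 𝟙 ((chains.obj (A ⊗ B)).X n)) := by
  intro A A' B B' f g
  rw [Category.comp_id, Category.id_comp]

theorem isNatural_zero (n m : ℕ) : IsNatural (R := R) (n := n) (m := m) (fun _ _ => 0) := by
  intro A A' B B' f g
  rw [Limits.comp_zero, Limits.zero_comp]

theorem isNatural_d (n m : ℕ) :
    IsNatural (R := R) (n := n) (m := m) (fun A B => (chains.obj (A ⊗ B)).d n m) :=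
  fun _ _ _ _ f g => (chains.map (f ⊗ₘ g)).comm n m

variable (e : ∀ A B : SimplicialObject (ModuleCat.{u} R), chains.obj (A ⊗ B) ⟶ chains.obj (A ⊗ B))

/-- The components of the homotopy constructed by acyclic models. -/
def acyclicHomotopy (n : ℕ) :
    ∀ A B : SimplicialObject (ModuleCat.{u} R), (chains.obj (A ⊗ B)).X n ⟶ (chains.obj (A ⊗ B)).X (n + 1) :=
  match n with
  -- Zero is enough, because the method is applied to maps `e` that are the identity in degree `0`.
  | 0 => fun _ _ => 0
  -- The equation to solve is `h_(n+1) ≫ d = e - 1 - d ≫ h_n`. At the universal simplex the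
  -- right-hand side will be a cycle, and the cone over a cycle has that cycle as its boundary.
  | n + 1 => ofModel ((cone R (n + 1) (n + 1)).hom
      (((e ((stdSimplexModule R).obj ⦋n + 1⦌) ((stdSimplexModule R).obj ⦋n + 1⦌)).f (n + 1) - 𝟙 _ -
        (chains.obj (model R (n + 1))).d (n + 1) n ≫ acyclicHomotopy n _ _ :
        (chains.obj (model R (n + 1))).X (n + 1) ⟶ (chains.obj (model R (n + 1))).X (n + 1)).hom (modelSimplex R (n + 1))))

/-- Naturality is independent of any property of `e`: in positive degrees the map is spread from a
single element of the model. -/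
theorem isNatural_acyclicHomotopy (n : ℕ) : IsNatural (acyclicHomotopy e n) := by
  rcases n with _ | n
  · exact isNatural_zero (R := R) 0 1
  · exact ofModel_isNatural (R := R) _

variable {e}

/-- The hypothesis `hw` is what makes the right-hand side a cycle. Both sides are natural, so it
suffices to compare them at the universal simplex, where the cone bounds that cycle. -/
theorem acyclicHomotopy_d_of_cycle (he : ∀ n, IsNatural (fun A B => (e A B).f n)) (n : ℕ)
    (hw : ∀ A B, (chains.obj (A ⊗ B)).d (n + 1) n ≫ ((e A B).f n - 𝟙 _ -
      acyclicHomotopy e n A B ≫ (chains.obj (A ⊗ B)).d (n + 1) n) = 0)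
    (A B : SimplicialObject (ModuleCat.{u} R)) :
    acyclicHomotopy e (n + 1) A B ≫ (chains.obj (A ⊗ B)).d (n + 2) (n + 1) =
      (e A B).f (n + 1) - 𝟙 _ - (chains.obj (A ⊗ B)).d (n + 1) n ≫ acyclicHomotopy e n A B := by
  refine IsNatural.ext ((isNatural_acyclicHomotopy e (n + 1)).comp (isNatural_d _ _))
    (((he _).sub (isNatural_id _)).sub ((isNatural_d _ _).comp (isNatural_acyclicHomotopy e n))) ?_ A B
  let X := (stdSimplexModule R).obj ⦋n + 1⦌
  let φ : (chains.obj (model R (n + 1))).X (n + 1) ⟶ (chains.obj (model R (n + 1))).X (n + 1) :=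
    (e X X).f (n + 1) - 𝟙 _ - (chains.obj (model R (n + 1))).d (n + 1) n ≫ acyclicHomotopy e n X X
  -- As `e` commutes with the differential, `φ ≫ d` is the expression in `hw`.
  have hφ : φ ≫ (chains.obj (model R (n + 1))).d (n + 1) n = 0 := by
    refine Eq.trans ?_ (hw X X)
    simp only [φ, Preadditive.sub_comp, Preadditive.comp_sub, Category.comp_id, Category.assoc]
    rw [← (e X X).comm]
    rfl
  have h1 := congrArg (((chains.obj (model R (n + 1))).d (n + 2) (n + 1)).hom)
    (ofModel_modelSimplex ((cone R (n + 1) (n + 1)).hom (φ.hom (modelSimplex R (n + 1)))))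
  have h2 := congrArg (fun a => a.hom (modelSimplex R (n + 1))) (congrArg (φ ≫ ·) (cone_d (R := R) (n + 1) n))
  refine h1.trans (h2.trans ?_)
  simp only [Preadditive.comp_sub, Category.comp_id]
  rw [← Category.assoc, hφ, Limits.zero_comp, sub_zero]

theorem acyclicHomotopy_d (he : ∀ n, IsNatural (fun A B => (e A B).f n)) (h0 : ∀ A B, (e A B).f 0 = 𝟙 _) (n : ℕ)
    (A B : SimplicialObject (ModuleCat.{u} R)) :
    acyclicHomotopy e (n + 1) A B ≫ (chains.obj (A ⊗ B)).d (n + 2) (n + 1) =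
      (e A B).f (n + 1) - 𝟙 _ - (chains.obj (A ⊗ B)).d (n + 1) n ≫ acyclicHomotopy e n A B := by
  -- Only the cycle condition is carried through the induction. In the inductive step the error `e -
  -- 1 - h_(n+1) ≫ d` equals `d ≫ h_n`, and this is annihilated by a further `d`.
  suffices hw : ∀ A B, (chains.obj (A ⊗ B)).d (n + 1) n ≫ ((e A B).f n - 𝟙 _ -
      acyclicHomotopy e n A B ≫ (chains.obj (A ⊗ B)).d (n + 1) n) = 0 from
    acyclicHomotopy_d_of_cycle he n hw A B
  induction n with
  | zero =>
    intro A B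
    rw [h0, sub_self]
    exact (congrArg (_ ≫ ·) ((congrArg (0 - ·) Limits.zero_comp).trans (sub_zero _))).trans Limits.comp_zero
  | succ n ih =>
    intro A B
    rw [acyclicHomotopy_d_of_cycle he n ih A B, sub_sub_cancel, ← Category.assoc,
      HomologicalComplex.d_comp_d, Limits.zero_comp]

/-! ### Simplicial homotopies from maps indexed by the simplices of `Δ^1` -/

/-- The map `[n] → [1]` that takes the value `0` exactly below `k`. -/
def stepMap (n k : ℕ) : ⦋n⦌ ⟶ ⦋1⦌ :=
  mkHom ⟨fun j : Fin (n + 1) => if (j : ℕ) < k then (0 : Fin 2) else 1, by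
    intro i j hij
    have : (i : ℕ) ≤ j := hij
    dsimp only
    split_ifs <;> first | omega | simp⟩

theorem toOrderHom_stepMap (n k : ℕ) (j : Fin (n + 1)) :
    (stepMap n k).toOrderHom j = if (j : ℕ) < k then (0 : Fin 2) else 1 := rfl

/-- For `k ≤ n + 1`, `stepMap n k` is the simplex of `Δ^1` with `k` zeros followed by ones. Deleting
or doubling a vertex changes the number of zeros only if that vertex is one of them; this accounts
for the two cases, here for faces and below for degeneracies. -/
theorem δ_stepMap_of_le {n k : ℕ} (i : Fin (n + 2)) (h : (i : ℕ) ≤ k) :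
    δ i ≫ stepMap (n + 1) (k + 1) = stepMap n k := by
  ext j : 3
  rw [toOrderHom_comp, toOrderHom_δ, toOrderHom_stepMap, toOrderHom_stepMap]
  refine if_congr ?_ rfl rfl
  rw [val_succAbove]
  split_ifs <;> omega

theorem δ_stepMap_of_ge {n k : ℕ} (i : Fin (n + 2)) (h : k ≤ (i : ℕ)) :
    δ i ≫ stepMap (n + 1) k = stepMap n k := by
  ext j : 3
  rw [toOrderHom_comp, toOrderHom_δ, toOrderHom_stepMap, toOrderHom_stepMap]
  refine if_congr ?_ rfl rfl
  rw [val_succAbove]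
  split_ifs <;> omega

theorem val_predAbove {n : ℕ} (i : Fin n) (j : Fin (n + 1)) :
    (i.predAbove j : ℕ) = if (j : ℕ) ≤ i then (j : ℕ) else j - 1 := by
  simp only [Fin.predAbove, Fin.lt_def, Fin.val_castSucc]
  split_ifs <;> first | omega | simp

theorem σ_stepMap_of_lt {n k : ℕ} (i : Fin (n + 1)) (h : (i : ℕ) < k) :
    σ i ≫ stepMap n k = stepMap (n + 1) (k + 1) := by
  ext j : 3
  rw [toOrderHom_comp, toOrderHom_σ, toOrderHom_stepMap, toOrderHom_stepMap]
  refine if_congr ?_ rfl rfl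
  rw [val_predAbove]
  split_ifs <;> omega

theorem σ_stepMap_of_ge {n k : ℕ} (i : Fin (n + 1)) (h : k ≤ (i : ℕ)) :
    σ i ≫ stepMap n k = stepMap (n + 1) k := by
  ext j : 3
  rw [toOrderHom_comp, toOrderHom_σ, toOrderHom_stepMap, toOrderHom_stepMap]
  refine if_congr ?_ rfl rfl
  rw [val_predAbove]
  split_ifs <;> omega

/-- A combinatorial homotopy from a family of maps `X_n → Y_n` indexed by the simplices of `Δ^1`. -/
def homotopyOfFamily {C : Type*} [Category* C] {X Y : SimplicialObject C} (f g : X ⟶ Y)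
    (ω : ∀ {n : ℕ}, (⦋n⦌ ⟶ ⦋1⦌) → (X _⦋n⦌ ⟶ Y _⦋n⦌))
    (hω : ∀ {m n : ℕ} (θ : ⦋m⦌ ⟶ ⦋n⦌) (t : ⦋n⦌ ⟶ ⦋1⦌), ω t ≫ Y.map θ.op = X.map θ.op ≫ ω (θ ≫ t))
    (hf : ∀ n, ω (stepMap n (n + 1)) = f.app (op ⦋n⦌)) (hg : ∀ n, ω (stepMap n 0) = g.app (op ⦋n⦌)) :
    SimplicialObject.Homotopy f g := by
  have hδ {n : ℕ} (i : Fin (n + 2)) (t : ⦋n + 1⦌ ⟶ ⦋1⦌) : ω t ≫ Y.δ i = X.δ i ≫ ω (δ i ≫ t) := hω _ _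
  have hσ {n : ℕ} (i : Fin (n + 1)) (t : ⦋n⦌ ⟶ ⦋1⦌) : ω t ≫ Y.σ i = X.σ i ≫ ω (σ i ≫ t) := hω _ _
  exact
  -- This is the usual triangulation of the prism `Δ^n × Δ^1`: the degeneracy doubles vertex `i`,
  -- and `stepMap` jumps from `0` to `1` between the two copies.
  { h := fun {n} i => X.σ i ≫ ω (stepMap (n + 1) (i + 1))
    h_zero_comp_δ_zero := fun n => by
      rw [Category.assoc, hδ, δ_stepMap_of_le 0 (by simp), ← Category.assoc]
      exact (congrArg (· ≫ _) (X.δ_comp_σ_self (i := (0 : Fin (n + 1))))).trans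
        ((Category.id_comp _).trans (hg n))
    h_last_comp_δ_last := fun n => by
      rw [Category.assoc, hδ, Fin.val_last, δ_stepMap_of_ge (Fin.last (n + 1)) (by simp), ← Category.assoc]
      exact (congrArg (· ≫ _) (X.δ_comp_σ_succ (i := Fin.last n))).trans
        ((Category.id_comp _).trans (hf n))
    h_succ_comp_δ_castSucc_of_lt := fun {n} i j hij => by
      have : (i : ℕ) ≤ j := hij
      rw [Category.assoc, hδ, δ_stepMap_of_le _ (by simp; omega), ← Category.assoc, ← Category.assoc]
      exact congrArg (· ≫ _) (X.δ_comp_σ_of_le hij)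
    -- The common wall of two neighbouring prisms: the deleted vertex `j + 1` is the last zero of
    -- one simplex and the first one of the other, so both are left with `j + 1` zeros.
    h_succ_comp_δ_castSucc_succ := fun {n} j => by
      rw [Category.assoc, Category.assoc, hδ, hδ, δ_stepMap_of_le _ (by simp), δ_stepMap_of_ge _ (by simp),
        ← Category.assoc, ← Category.assoc]
      exact congrArg (· ≫ _) ((X.δ_comp_σ_self (i := j.succ)).trans
        (X.δ_comp_σ_succ (i := j.castSucc)).symm)
    h_castSucc_comp_δ_succ_of_lt := fun {n} i j hij => by
      have : (j : ℕ) < i := hij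
      rw [Category.assoc, hδ, δ_stepMap_of_ge _ (by simp; omega), ← Category.assoc, ← Category.assoc]
      exact congrArg (· ≫ _) (X.δ_comp_σ_of_gt hij)
    h_comp_σ_castSucc_of_le := fun {n} i j hij => by
      have : (i : ℕ) ≤ j := hij
      rw [Category.assoc, hσ, σ_stepMap_of_lt _ (by simp; omega), ← Category.assoc, ← Category.assoc]
      exact congrArg (· ≫ _) (X.σ_comp_σ hij)
    h_comp_σ_succ_of_lt := fun {n} i j hij => by
      have : (j : ℕ) ≤ i := hij
      rw [Category.assoc, hσ, σ_stepMap_of_ge _ (by simp; omega), ← Category.assoc, ← Category.assoc]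
      exact congrArg (· ≫ _) (X.σ_comp_σ hij).symm }

/-! ### Chain maps of the form `d h + h d` -/

/-- The null-homotopic map `d h + h d`. -/
def nullMap {K L : ChainComplex (ModuleCat.{u} R) ℕ} (h : ∀ n, K.X n ⟶ L.X (n + 1)) : K ⟶ L :=
  Homotopy.nullHomotopicMap' (fun i _ hij => h i ≫ (L.XIsoOfEq hij).hom)

theorem nullMap_f_zero {K L : ChainComplex (ModuleCat.{u} R) ℕ} (h : ∀ n, K.X n ⟶ L.X (n + 1)) :
    (nullMap h).f 0 = h 0 ≫ L.d 1 0 := by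
  refine (Homotopy.nullHomotopicMap'_f_of_not_rel_left (k₁ := 1) rfl (by simp) _).trans ?_
  simp

theorem nullMap_f_succ {K L : ChainComplex (ModuleCat.{u} R) ℕ} (h : ∀ n, K.X n ⟶ L.X (n + 1)) (n : ℕ) :
    (nullMap h).f (n + 1) = K.d (n + 1) n ≫ h n + h (n + 1) ≫ L.d (n + 2) (n + 1) := by
  refine (Homotopy.nullHomotopicMap'_f (k₂ := n + 2) (k₀ := n) rfl rfl _).trans ?_
  simp

theorem nullMap_naturality {K L K' L' : ChainComplex (ModuleCat.{u} R) ℕ} (f : K ⟶ K') (g : L ⟶ L')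
    (h : ∀ n, K.X n ⟶ L.X (n + 1)) (h' : ∀ n, K'.X n ⟶ L'.X (n + 1))
    (w : ∀ n, f.f n ≫ h' n = h n ≫ g.f (n + 1)) : f ≫ nullMap h' = nullMap h ≫ g := by
  ext n : 1
  rcases n with _ | n
  · rw [HomologicalComplex.comp_f, HomologicalComplex.comp_f, nullMap_f_zero, nullMap_f_zero,
      ← Category.assoc, w, Category.assoc, Category.assoc, g.comm]
  · rw [HomologicalComplex.comp_f, HomologicalComplex.comp_f, nullMap_f_succ, nullMap_f_succ,
      Preadditive.comp_add, Preadditive.add_comp, ← Category.assoc, f.comm, Category.assoc, w,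
      ← Category.assoc (f.f _), w, Category.assoc, Category.assoc, Category.assoc, g.comm]

/-! ### Cutting `R Δ^n` by a map to `[1]` -/

/-- The projection of `R Δ^n` in degree `k` onto the simplices whose last vertex is sent to `0` by `t`. -/
def lastVertexProj {n : SimplexCategory} (t : n ⟶ ⦋1⦌) (k : ℕ) :
    ((stdSimplexModule R).obj n) _⦋k⦌ ⟶ ((stdSimplexModule R).obj n) _⦋k⦌ :=
  ModuleCat.freeDesc (TypeCat.ofHom (fun s : (SSet.stdSimplex.{u}.obj n).obj (op ⦋k⦌) =>
    -- Any condition on `s ≫ t` would serve that holds when `t` is constant at `0` and fails when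
    -- `t` is constant at `1`. Compatibility with the faces of `s` is not needed.
    if (SSet.stdSimplex.objEquiv s ≫ t).toOrderHom (Fin.last k) = 0 then ModuleCat.freeMk s else 0))

theorem lastVertexProj_freeMk {n : SimplexCategory} (t : n ⟶ ⦋1⦌) (k : ℕ)
    (s : (SSet.stdSimplex.{u}.obj n).obj (op ⦋k⦌)) :
    (lastVertexProj (R := R) t k).hom (ModuleCat.freeMk s) =
      if (SSet.stdSimplex.objEquiv s ≫ t).toOrderHom (Fin.last k) = 0 then ModuleCat.freeMk s else 0 :=
  ModuleCat.freeDesc_apply _ _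

/-- The map induced by `θ` sends `s` to `s ≫ θ`, and `(s ≫ θ) ≫ t = s ≫ (θ ≫ t)`, so the same
simplices are kept whether the cut is made before or after. -/
theorem lastVertexProj_naturality {m n : SimplexCategory} (θ : m ⟶ n) (t : n ⟶ ⦋1⦌) (k : ℕ) :
    ((stdSimplexModule R).map θ).app (op ⦋k⦌) ≫ lastVertexProj t k =
      lastVertexProj (θ ≫ t) k ≫ ((stdSimplexModule R).map θ).app (op ⦋k⦌) := by
  refine ModuleCat.free_hom_ext (fun s => ?_)
  have h (s : (SSet.stdSimplex.{u}.obj m).obj (op ⦋k⦌)) :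
      (((stdSimplexModule R).map θ).app (op ⦋k⦌)).hom (ModuleCat.freeMk s) =
      ModuleCat.freeMk ((SSet.stdSimplex.map θ).app (op ⦋k⦌) s) := ModuleCat.free_map_apply _ _
  change (lastVertexProj t k).hom ((((stdSimplexModule R).map θ).app (op ⦋k⦌)).hom (ModuleCat.freeMk s)) =
    (((stdSimplexModule R).map θ).app (op ⦋k⦌)).hom ((lastVertexProj (θ ≫ t) k).hom (ModuleCat.freeMk s))
  rw [h, lastVertexProj_freeMk, lastVertexProj_freeMk]
  by_cases hc : (SSet.stdSimplex.objEquiv s ≫ θ ≫ t).toOrderHom (Fin.last k) = 0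
  · rw [if_pos hc]
    exact (if_pos hc).trans (h s).symm
  · rw [if_neg hc]
    exact (if_neg hc).trans (map_zero (((stdSimplexModule R).map θ).app (op ⦋k⦌)).hom).symm

/-- `stepMap n (n + 1)` is constant at `0`, so all simplices are kept. In the next lemma `stepMap n
0` is constant at `1`, so none is. -/
theorem lastVertexProj_stepMap_last (n k : ℕ) : lastVertexProj (R := R) (stepMap n (n + 1)) k = 𝟙 _ := by
  refine ModuleCat.free_hom_ext (fun s => ?_)
  refine (lastVertexProj_freeMk _ _ _).trans (if_pos ?_)
  exact if_pos (Fin.is_lt _)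

theorem lastVertexProj_stepMap_zero (n k : ℕ) : lastVertexProj (R := R) (stepMap n 0) k = 0 := by
  refine ModuleCat.free_hom_ext (fun s => ?_)
  refine (lastVertexProj_freeMk _ _ _).trans (if_neg ?_)
  exact one_ne_zero (α := Fin 2)

/-! ### The natural endomorphism of chains that induces `aw ≫ ez` -/

theorem incl_proj (A : SimplicialObject (ModuleCat.{u} R)) : incl A ≫ proj A = 𝟙 _ :=
  (DoldKan.splitMonoInclusionOfMooreComplexMap A).id

theorem proj_incl (A : SimplicialObject (ModuleCat.{u} R)) : proj A ≫ incl A = DoldKan.PInfty :=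
  DoldKan.PInftyToNormalizedMooreComplex_comp_inclusionOfMooreComplexMap A

/-- The endomorphism of the unnormalized chains of `A ⊗ B` that induces `aw ≫ ez` on normalized chains. -/
def awEz (A B : SimplicialObject (ModuleCat.{u} R)) : chains.obj (A ⊗ B) ⟶ chains.obj (A ⊗ B) :=
  awK A B ≫ ((proj A ≫ incl A) ⊗ₘ (proj B ≫ incl B)) ≫ ezK A B

/-- The idempotents in the middle of `awEz` are inserted for this purpose: `proj` belongs to the end
of `aw` and `incl` to the start of `ez`. -/
theorem incl_awEz_proj (A B : SimplicialObject (ModuleCat.{u} R)) :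
    incl (A ⊗ B) ≫ awEz A B ≫ proj (A ⊗ B) = aw A B ≫ ez A B := by
  simp only [aw, ez, awEz, Category.assoc, ← tensorHom_comp_tensorHom]

theorem awEz_naturality {A A' B B' : SimplicialObject (ModuleCat.{u} R)} (f : A ⟶ A') (g : B ⟶ B') :
    chains.map (f ⊗ₘ g) ≫ awEz A' B' = awEz A B ≫ chains.map (f ⊗ₘ g) := by
  have h {A A' : SimplicialObject (ModuleCat.{u} R)} (f : A ⟶ A') :
      chains.map f ≫ proj A' ≫ incl A' = (proj A ≫ incl A) ≫ chains.map f := by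
    rw [← Category.assoc, proj_naturality, Category.assoc, incl_naturality, Category.assoc]
  simp only [awEz, Category.assoc]
  rw [← Category.assoc, awK_naturality, Category.assoc, ← Category.assoc (chains.map f ⊗ₘ chains.map g),
    tensorHom_comp_tensorHom, h, h, ← tensorHom_comp_tensorHom, Category.assoc, ezK_naturality]

theorem ezTerm_zero (A B : SimplicialObject (ModuleCat.{u} R)) : ezTerm A B 0 0 0 = 𝟙 (A _⦋0⦌ ⊗ B _⦋0⦌) := by
  have : shuffles 0 0 0 = {(𝟙 ⦋0⦌, 𝟙 ⦋0⦌)} := by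
    ext x
    rw [mem_shuffles, Finset.mem_singleton]
    refine ⟨fun _ => Prod.ext (Subsingleton.elim _ _) (Subsingleton.elim _ _), ?_⟩
    rintro rfl i
    simp
  rw [ezTerm, shuffleSum, this, Finset.sum_singleton]
  simp [shuffleInversions]

theorem awK_f (A B : SimplicialObject (ModuleCat.{u} R)) (n : ℕ) : (awK A B).f n =
    ∑ x : Finset.HasAntidiagonal.antidiagonal n,
      awTerm A B x.1.1 x.1.2 n (Finset.HasAntidiagonal.mem_antidiagonal.1 x.2) ≫
        HomologicalComplex.ιTensorObj _ _ x.1.1 x.1.2 n (Finset.HasAntidiagonal.mem_antidiagonal.1 x.2) := rfl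

theorem awK_f_zero (A B : SimplicialObject (ModuleCat.{u} R)) : (awK A B).f 0 =
    awTerm A B 0 0 0 rfl ≫ HomologicalComplex.ιTensorObj _ _ 0 0 0 rfl := by
  rw [awK_f, sum_antidiagonal_coe 0 (fun p q h => awTerm A B p q 0 h ≫ HomologicalComplex.ιTensorObj _ _ p q 0 h),
    Finset.Nat.antidiagonal_zero, Finset.sum_singleton, dif_pos (by rfl)]

/-- In degree `0` there is one way to split a simplex, one shuffle, and nothing degenerate to
project away, so every factor is an identity. This is the starting condition for acyclic models. -/
theorem awEz_f_zero (A B : SimplicialObject (ModuleCat.{u} R)) : (awEz A B).f 0 = 𝟙 _ := by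
  have h : (proj A ≫ incl A).f 0 ⊗ₘ (proj B ≫ incl B).f 0 = 𝟙 (A _⦋0⦌ ⊗ B _⦋0⦌) := by
    rw [proj_incl, proj_incl]
    exact id_tensorHom_id _ _
  have h' : awTerm A B 0 0 0 rfl = 𝟙 (A _⦋0⦌ ⊗ B _⦋0⦌) := by
    rw [awTerm, Subsingleton.elim (subinterval (n := 0) 0 0 (by omega)) (𝟙 ⦋0⦌)]
    simp
  change (awK A B).f 0 ≫ (HomologicalComplex.mapBifunctorMap _ _ _ _).f 0 ≫
    HomologicalComplex.mapBifunctorDesc _ = _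
  rw [awK_f_zero, Category.assoc]
  rw [HomologicalComplex.ι_mapBifunctorMap_assoc, HomologicalComplex.ι_mapBifunctorDesc]
  erw [ezTerm_zero, h', Category.id_comp, Category.comp_id]
  exact (MonoidalCategory.tensorHom_def _ _).symm.trans h

/-! ### Interpolation between `aw ≫ ez` and the identity -/

/-- The projection of the chains of `A ⊗ R Δ^n` given by `lastVertexProj`. -/
def cut (A : SimplicialObject (ModuleCat.{u} R)) {n : SimplexCategory} (t : n ⟶ ⦋1⦌) (k : ℕ) :
    (chains.obj (A ⊗ (stdSimplexModule R).obj n)).X k ⟶ (chains.obj (A ⊗ (stdSimplexModule R).obj n)).X k :=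
  (A _⦋k⦌ ◁ lastVertexProj t k : A _⦋k⦌ ⊗ ((stdSimplexModule R).obj n) _⦋k⦌ ⟶ _)

/-- The chain homotopy from `awEz A B` to the identity, cut off by `lastVertexProj`. -/
def cutHomotopy (A : SimplicialObject (ModuleCat.{u} R)) {n : SimplexCategory} (t : n ⟶ ⦋1⦌) (k : ℕ) :
    (chains.obj (A ⊗ (stdSimplexModule R).obj n)).X k ⟶ (chains.obj (A ⊗ (stdSimplexModule R).obj n)).X (k + 1) :=
  cut A t k ≫ acyclicHomotopy awEz k A ((stdSimplexModule R).obj n)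

theorem awEz_isNatural (n : ℕ) : IsNatural (R := R) (fun A B => (awEz A B).f n) :=
  fun _ _ _ _ f g => congrArg (fun φ => φ.f n) (awEz_naturality f g)

/-- In positive degrees this is `acyclicHomotopy_d` rearranged; in degree `0` both `awEz - 1` and
the homotopy vanish. -/
theorem awEz_eq (A B : SimplicialObject (ModuleCat.{u} R)) :
    awEz A B = 𝟙 _ + nullMap (fun k => acyclicHomotopy awEz k A B) := by
  ext n : 1
  rw [HomologicalComplex.add_f_apply]
  rcases n with _ | n
  · rw [nullMap_f_zero, awEz_f_zero]
    exact (add_zero _).symm.trans (congrArg (_ + ·) Limits.zero_comp.symm)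
  · rw [nullMap_f_succ, acyclicHomotopy_d awEz_isNatural awEz_f_zero, HomologicalComplex.id_f]
    abel

/-- The acyclic-models homotopy commutes strictly with `θ`, whereas the cut does so at the price of
replacing `t` by `θ ≫ t`. -/
theorem cutHomotopy_naturality (A : SimplicialObject (ModuleCat.{u} R)) {m n : SimplexCategory} (θ : m ⟶ n)
    (t : n ⟶ ⦋1⦌) (k : ℕ) :
    (chains.map (A ◁ (stdSimplexModule R).map θ)).f k ≫ cutHomotopy A t k =
      cutHomotopy A (θ ≫ t) k ≫ (chains.map (A ◁ (stdSimplexModule R).map θ)).f (k + 1) := by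
  have h := isNatural_acyclicHomotopy awEz k (𝟙 A) ((stdSimplexModule R).map θ)
  rw [id_tensorHom] at h
  rw [cutHomotopy, cutHomotopy, Category.assoc, ← h, ← Category.assoc, ← Category.assoc]
  refine congrArg (· ≫ _) ?_
  refine (MonoidalCategory.whiskerLeft_comp (A _⦋k⦌) _ _).symm.trans (Eq.trans ?_
    (MonoidalCategory.whiskerLeft_comp (A _⦋k⦌) _ _))
  exact congrArg (A _⦋k⦌ ◁ ·) (lastVertexProj_naturality θ t k)

/-- The endomorphisms of `N (A ⊗ R Δ^n)`, indexed by the simplices `t` of `Δ^1`, that interpolate between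
`aw ≫ ez` and the identity. -/
def interpolation (A : SimplicialObject (ModuleCat.{u} R)) {n : SimplexCategory} (t : n ⟶ ⦋1⦌) :
    N.obj (A ⊗ (stdSimplexModule R).obj n) ⟶ N.obj (A ⊗ (stdSimplexModule R).obj n) :=
  -- `nullMap` produces a chain map from any family that raises the degree by one, so the cut need
  -- not respect the differential. Nor need the homotopy respect degenerate chains, since `incl` and
  -- `proj` restrict the result to normalized ones.
  incl _ ≫ (𝟙 _ + nullMap (cutHomotopy A t)) ≫ proj _

theorem interpolation_naturality (A : SimplicialObject (ModuleCat.{u} R)) {m n : SimplexCategory} (θ : m ⟶ n)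
    (t : n ⟶ ⦋1⦌) :
    N.map (A ◁ (stdSimplexModule R).map θ) ≫ interpolation A t =
      interpolation A (θ ≫ t) ≫ N.map (A ◁ (stdSimplexModule R).map θ) := by
  have h : chains.map (A ◁ (stdSimplexModule R).map θ) ≫ (𝟙 _ + nullMap (cutHomotopy A t)) =
      (𝟙 _ + nullMap (cutHomotopy A (θ ≫ t))) ≫ chains.map (A ◁ (stdSimplexModule R).map θ) := by
    rw [Preadditive.comp_add, Preadditive.add_comp, Category.comp_id, Category.id_comp,
      nullMap_naturality _ _ _ _ (cutHomotopy_naturality A θ t)]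
  rw [interpolation, interpolation, Category.assoc, Category.assoc, ← proj_naturality, ← Category.assoc,
    incl_naturality, Category.assoc, ← Category.assoc (chains.map _), h, Category.assoc]

/-- The whole homotopy is cut away, which leaves `incl ≫ proj`. -/
theorem interpolation_stepMap_zero (A : SimplicialObject (ModuleCat.{u} R)) (n : ℕ) :
    interpolation A (stepMap n 0) = 𝟙 _ := by
  have h : nullMap (cutHomotopy A (stepMap n 0)) = 0 := by
    have h (k) : cutHomotopy A (stepMap n 0) k = 0 := by
      rw [cutHomotopy, cut, lastVertexProj_stepMap_zero, MonoidalPreadditive.whiskerLeft_zero]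
      exact Limits.zero_comp
    ext k : 1
    rcases k with _ | k
    · rw [nullMap_f_zero, h, Limits.zero_comp]; rfl
    · rw [nullMap_f_succ, h, h, Limits.zero_comp, Limits.comp_zero, add_zero]; rfl
  rw [interpolation, h, add_zero, Category.id_comp, incl_proj]

/-- Nothing is cut away, so the full homotopy turns the identity into `awEz`. -/
theorem interpolation_stepMap_last (A : SimplicialObject (ModuleCat.{u} R)) (n : ℕ) :
    interpolation A (stepMap n (n + 1)) = aw A ((stdSimplexModule R).obj ⦋n⦌) ≫ ez A _ := by
  have h : cutHomotopy A (stepMap n (n + 1)) =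
      fun k => acyclicHomotopy awEz k A ((stdSimplexModule R).obj ⦋n⦌) := by
    funext k
    rw [cutHomotopy, cut, lastVertexProj_stepMap_last, MonoidalCategory.whiskerLeft_id]
    exact Category.id_comp _
  rw [interpolation, h, ← awEz_eq, incl_awEz_proj]

/-- The simplicial homotopy from restriction along `aw ≫ ez` to the identity. -/
def ezStarAwStarHomotopy (A : SimplicialObject (ModuleCat.{u} R)) (D : ChainComplex (ModuleCat.{u} R) ℕ) :
    SimplicialObject.Homotopy (ezStar A D ≫ awStar A D) (𝟙 (homNormalized A D)) :=
  -- An `n`-simplex is a map `N (A ⊗ R Δ^n) → D`, on which `interpolation A t` acts by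
  -- precomposition.
  homotopyOfFamily _ _ (fun {n} t => ((linearYoneda R _).obj D).map (interpolation A t).op)
    (fun {m n} θ t => by
      refine (Functor.map_comp _ _ _).symm.trans (Eq.trans ?_ (Functor.map_comp _ _ _))
      exact congrArg (fun φ => ((linearYoneda R _).obj D).map φ.op) (interpolation_naturality A θ t))
    (fun n => by
      rw [interpolation_stepMap_last]
      -- Precomposition with `aw ≫ ez` applies `ezStar` first and `awStar` second.
      exact Functor.map_comp _ _ _)
    (fun n => by
      rw [interpolation_stepMap_zero]
      exact CategoryTheory.Functor.map_id _ _)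

/-! ### Shuffle followed by Alexander–Whitney is the identity -/

/-- A non-injective operator factors through a degeneracy, and `PInfty`, through which `proj`
factors, annihilates degenerate simplices. -/
theorem map_comp_proj (A : SimplicialObject (ModuleCat.{u} R)) {n m : ℕ} (θ : ⦋n⦌ ⟶ ⦋m⦌) (hθ : ¬Mono θ) :
    A.map θ.op ≫ (proj A).f n = 0 := by
  have h : (proj A).f n = (DoldKan.PInfty (X := A)).f n ≫ (proj A).f n :=
    (congrArg (fun φ => φ.f n) (DoldKan.PInfty_comp_PInftyToNormalizedMooreComplex A)).symm
  rw [h, ← Category.assoc]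
  exact (congrArg (· ≫ _) (DoldKan.degeneracy_comp_PInfty A n θ hθ)).trans Limits.zero_comp

theorem map_tensor_comp_proj (A B : SimplicialObject (ModuleCat.{u} R)) {n m p q : ℕ} (f : ⦋p⦌ ⟶ ⦋n⦌)
    (g : ⦋q⦌ ⟶ ⦋m⦌) (h : ¬ (Mono f ∧ Mono g)) :
    (A.map f.op ⊗ₘ B.map g.op) ≫ ((proj A).f p ⊗ₘ (proj B).f q) = 0 := by
  refine (tensorHom_comp_tensorHom (A.map f.op) (B.map g.op) ((proj A).f p) ((proj B).f q)).trans ?_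
  rcases not_and_or.1 h with h | h
  · rw [map_comp_proj A f h, MonoidalPreadditive.zero_tensor]
  · rw [map_comp_proj B g h, MonoidalPreadditive.tensor_zero]

theorem awK_proj_f (A B : SimplicialObject (ModuleCat.{u} R)) (n : ℕ) : (awK A B ≫ (proj A ⊗ₘ proj B)).f n =
    ∑ x : Finset.HasAntidiagonal.antidiagonal n,
      (awTerm A B x.1.1 x.1.2 n (Finset.HasAntidiagonal.mem_antidiagonal.1 x.2) ≫
        ((proj A).f x.1.1 ⊗ₘ (proj B).f x.1.2)) ≫
        HomologicalComplex.ιTensorObj _ _ x.1.1 x.1.2 n (Finset.HasAntidiagonal.mem_antidiagonal.1 x.2) := by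
  rw [HomologicalComplex.comp_f, awK_f, Preadditive.sum_comp]
  refine Finset.sum_congr rfl (fun x _ => ?_)
  have hx := Finset.HasAntidiagonal.mem_antidiagonal.1 x.2
  rw [Category.assoc, MonoidalCategory.tensorHom_def ((proj A).f _), Category.assoc, Category.assoc]
  exact congrArg (_ ≫ ·) (HomologicalComplex.ι_mapBifunctorMap (proj A) (proj B) (curriedTensor _)
    (ComplexShape.down ℕ) x.1.1 x.1.2 n hx)

/-- For every `p`, the `i`-th degeneracy of a simplex has a degenerate front `p`-face if `i < p`,
and a degenerate back face if `p ≤ i`. Hence the normalized Alexander–Whitney map kills the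
complement `QInfty` of `PInfty`. -/
theorem PInfty_awK_proj (A B : SimplicialObject (ModuleCat.{u} R)) :
    DoldKan.PInfty ≫ awK A B ≫ (proj A ⊗ₘ proj B) = awK A B ≫ (proj A ⊗ₘ proj B) := by
  suffices DoldKan.QInfty ≫ awK A B ≫ (proj A ⊗ₘ proj B) = 0 by
    have h := congrArg (· ≫ (awK A B ≫ (proj A ⊗ₘ proj B))) (DoldKan.PInfty_add_QInfty (X := A ⊗ B))
    rw [Preadditive.add_comp, this, add_zero] at h
    exact h.trans (Category.id_comp _)
  ext n : 1
  refine (DoldKan.degeneraciesVanish_iff_QInfty_f_comp (X := A ⊗ B)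
    (((awK A B ≫ (proj A ⊗ₘ proj B)).f n))).1 ?_
  rcases n with _ | n
  · trivial
  · intro i
    rw [awK_proj_f, Preadditive.comp_sum]
    refine Finset.sum_eq_zero (fun x _ => ?_)
    have hx := Finset.HasAntidiagonal.mem_antidiagonal.1 x.2
    rw [← Category.assoc]
    refine (congrArg (· ≫ _) ?_).trans Limits.zero_comp
    rw [← Category.assoc]
    have h := map_tensor_comp_proj A B (subinterval (n := n + 1) 0 x.1.1 (by omega) ≫ σ i)
      (subinterval (n := n + 1) x.1.1 x.1.2 (by omega) ≫ σ i) (by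
        rintro ⟨h1, h2⟩
        rw [SimplexCategory.mono_iff_injective] at h1 h2
        -- `σ i` identifies the vertices `i` and `i + 1`. Both lie in the front interval if `i < p`,
        -- and both in the back interval otherwise, where positions are shifted by `p`.
        rcases Nat.lt_or_ge i x.1.1 with h | h
        · have := @h1 (⟨i, by omega⟩ : Fin (x.1.1 + 1)) (⟨i + 1, by omega⟩ : Fin (x.1.1 + 1)) (by
            ext
            simp only [toOrderHom_comp, toOrderHom_σ, val_predAbove, toOrderHom_subinterval]
            simp)
          simp at this
        · have := @h2 (⟨i - x.1.1, by omega⟩ : Fin (x.1.2 + 1)) (⟨i - x.1.1 + 1, by omega⟩ : Fin (x.1.2 + 1)) (by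
            ext
            rw [toOrderHom_comp, toOrderHom_comp, toOrderHom_σ, toOrderHom_σ, val_predAbove, val_predAbove,
              toOrderHom_subinterval, toOrderHom_subinterval]
            split_ifs <;> simp only at * <;> omega)
          simp at this)
    rw [op_comp, op_comp, A.map_comp, B.map_comp, ← tensorHom_comp_tensorHom] at h
    exact h

/-- The shuffle `(i ↦ min i p, i ↦ i - p)` that takes all steps of the first map first. -/
def trivialShuffle (p q n : ℕ) (h : p + q = n) : (⦋n⦌ ⟶ ⦋p⦌) × (⦋n⦌ ⟶ ⦋q⦌) :=
  (mkHom ⟨fun i : Fin (n + 1) => (⟨min (i : ℕ) p, by omega⟩ : Fin (p + 1)), fun i j hij => by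
      have : (i : ℕ) ≤ j := hij
      simp only [Fin.le_def]; omega⟩,
    mkHom ⟨fun i : Fin (n + 1) => (⟨i - p, by omega⟩ : Fin (q + 1)), fun i j hij => by
      have : (i : ℕ) ≤ j := hij
      simp only [Fin.le_def]; omega⟩)

theorem trivialShuffle_fst (p q n : ℕ) (h : p + q = n) (i : Fin (n + 1)) :
    ((trivialShuffle p q n h).1.toOrderHom i : ℕ) = min (i : ℕ) p := rfl

theorem trivialShuffle_snd (p q n : ℕ) (h : p + q = n) (i : Fin (n + 1)) :
    ((trivialShuffle p q n h).2.toOrderHom i : ℕ) = i - p := rfl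

theorem trivialShuffle_mem (p q n : ℕ) (h : p + q = n) : trivialShuffle p q n h ∈ shuffles p q n := by
  rw [mem_shuffles]
  intro i
  rw [trivialShuffle_fst, trivialShuffle_snd]
  omega

/-- As long as the first map still moves, the second has height `0`, so each product has a zero
factor. -/
theorem trivialShuffle_inversions (p q n : ℕ) (h : p + q = n) :
    shuffleInversions (trivialShuffle p q n h).1 (trivialShuffle p q n h).2 = 0 := by
  refine Finset.sum_eq_zero (fun i _ => ?_)
  rw [trivialShuffle_fst, trivialShuffle_fst, trivialShuffle_snd, Fin.val_succ, Fin.val_castSucc, mul_eq_zero]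
  omega

/-- The conditions fix the first map on the front interval and the second on the back interval. The
relation `f i + g i = i` then determines the other map on each of them. -/
theorem eq_trivialShuffle {p q n : ℕ} (h : p + q = n) {x : (⦋n⦌ ⟶ ⦋p⦌) × (⦋n⦌ ⟶ ⦋q⦌)} (hx : x ∈ shuffles p q n)
    (h1 : subinterval (n := n) 0 p (by omega) ≫ x.1 = 𝟙 _)
    (h2 : subinterval (n := n) p q (by omega) ≫ x.2 = 𝟙 _) : x = trivialShuffle p q n h := by
  have hs := (mem_shuffles x).1 hx
  have hp : p + 1 ≤ n + 1 := by omega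
  have hq : q + 1 + p ≤ n + 1 := by omega
  have e1 (i : Fin (p + 1)) : (x.1.toOrderHom (⟨i, i.is_lt.trans_le hp⟩ : Fin (n + 1)) : ℕ) = i :=
    congrArg (fun f => (f.toOrderHom i : ℕ)) h1
  have e2 (i : Fin (q + 1)) :
      (x.2.toOrderHom (⟨i + p, (Nat.add_lt_add_right i.is_lt p).trans_le hq⟩ : Fin (n + 1)) : ℕ) = i :=
    congrArg (fun f => (f.toOrderHom i : ℕ)) h2
  have key (i : Fin (n + 1)) : (x.1.toOrderHom i : ℕ) = min (i : ℕ) p ∧ (x.2.toOrderHom i : ℕ) = i - p := by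
    have h0 := hs i
    have hi' : (i : ℕ) < n + 1 := i.is_lt
    rcases Nat.lt_or_ge p i with hi | hi
    · have h3 := e2 ⟨i - p, by omega⟩
      have e : (⟨i - p + p, by omega⟩ : Fin (n + 1)) = i := Fin.ext (Nat.sub_add_cancel hi.le)
      simp only [e] at h3
      omega
    · have h3 : (x.1.toOrderHom i : ℕ) = i := e1 ⟨i, by omega⟩
      omega
  refine Prod.ext ?_ ?_
  · ext i : 4
    exact (key i).1
  · ext i : 4
    exact (key i).2

/-- If both composites `[p'] → [p]` and `[q'] → [q]` were injective, then `p' ≤ p` and `q' ≤ q`,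
hence `p' = p` because the sums agree. So each term has a degenerate factor. -/
theorem ezTerm_awTerm_proj_of_ne (A B : SimplicialObject (ModuleCat.{u} R)) {p q p' q' n : ℕ} (h : p + q = n)
    (h' : p' + q' = n) (hne : p' ≠ p) :
    ezTerm A B p q n ≫ awTerm A B p' q' n h' ≫ ((proj A).f p' ⊗ₘ (proj B).f q') = 0 := by
  refine (Preadditive.sum_comp (C := ModuleCat.{u} R) _ _ _).trans (Finset.sum_eq_zero (fun x hx => ?_))
  refine (Preadditive.zsmul_comp (C := ModuleCat.{u} R) _ _ _).trans ?_
  refine (congrArg (_ • ·) ?_).trans (smul_zero _)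
  have hz := map_tensor_comp_proj A B (subinterval (n := n) 0 p' (by omega) ≫ x.1)
    (subinterval (n := n) p' q' (by omega) ≫ x.2) (by
      rintro ⟨h1, h2⟩
      have h1 : p' ≤ p := @SimplexCategory.len_le_of_mono _ _ _ h1
      have h2 : q' ≤ q := @SimplexCategory.len_le_of_mono _ _ _ h2
      omega)
  rw [op_comp, op_comp, A.map_comp, B.map_comp, ← tensorHom_comp_tensorHom, Category.assoc] at hz
  exact hz

/-- An injective endomorphism of `[p]` is the identity, so the only shuffle with no degenerate
factor is the trivial one, whose sign is `+1`. -/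
theorem ezTerm_awTerm_proj (A B : SimplicialObject (ModuleCat.{u} R)) {p q n : ℕ} (h : p + q = n) :
    ezTerm A B p q n ≫ awTerm A B p q n h ≫ ((proj A).f p ⊗ₘ (proj B).f q) =
      ((proj A).f p ⊗ₘ (proj B).f q) := by
  refine (Preadditive.sum_comp (C := ModuleCat.{u} R) _ _ _).trans ?_
  rw [Finset.sum_eq_single_of_mem _ (trivialShuffle_mem p q n h)]
  · rw [trivialShuffle_inversions, pow_zero, one_smul]
    have e1 : subinterval (n := n) 0 p (by omega) ≫ (trivialShuffle p q n h).1 = 𝟙 _ := by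
      ext i : 4
      rw [toOrderHom_comp, trivialShuffle_fst, toOrderHom_subinterval]
      exact min_eq_left (by omega)
    have e2 : subinterval (n := n) p q (by omega) ≫ (trivialShuffle p q n h).2 = 𝟙 _ := by
      ext i : 4
      rw [toOrderHom_comp, trivialShuffle_snd, toOrderHom_subinterval]
      exact Nat.add_sub_cancel _ _
    have e : (A.map (trivialShuffle p q n h).1.op ⊗ₘ B.map (trivialShuffle p q n h).2.op) ≫
        (A.map (subinterval (n := n) 0 p (by omega)).op ⊗ₘ B.map (subinterval (n := n) p q (by omega)).op) =
        𝟙 _ := by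
      rw [tensorHom_comp_tensorHom, ← A.map_comp, ← B.map_comp, ← op_comp, ← op_comp, e1, e2, op_id, op_id,
        A.map_id, B.map_id, id_tensorHom_id]
    refine (Category.assoc _ _ _).symm.trans ?_
    exact (congrArg (· ≫ _) e).trans (Category.id_comp _)
  · intro x hx hne
    refine (Preadditive.zsmul_comp (C := ModuleCat.{u} R) _ _ _).trans ?_
    refine (congrArg (_ • ·) ?_).trans (smul_zero _)
    have hz := map_tensor_comp_proj A B (subinterval (n := n) 0 p (by omega) ≫ x.1)
      (subinterval (n := n) p q (by omega) ≫ x.2) (by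
        rintro ⟨h1, h2⟩
        exact hne (eq_trivialShuffle h hx (SimplexCategory.eq_id_of_mono _) (SimplexCategory.eq_id_of_mono _)))
    rw [op_comp, op_comp, A.map_comp, B.map_comp, ← tensorHom_comp_tensorHom, Category.assoc] at hz
    exact hz

theorem ezK_awK_proj (A B : SimplicialObject (ModuleCat.{u} R)) :
    ezK A B ≫ awK A B ≫ (proj A ⊗ₘ proj B) = proj A ⊗ₘ proj B := by
  ext n : 1
  refine HomologicalComplex.mapBifunctor.hom_ext (fun p q h => ?_)
  rw [HomologicalComplex.comp_f, awK_proj_f]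
  refine (HomologicalComplex.ι_mapBifunctorDesc_assoc _ _ _ _ _).trans ?_
  refine Eq.trans ?_ (HomologicalComplex.ι_mapBifunctorMap (proj A) (proj B) (curriedTensor _)
    (ComplexShape.down ℕ) p q n h).symm
  change p + q = n at h
  -- On the summand of bidegree `(p, q)` only the Alexander–Whitney component of the same bidegree
  -- survives.
  rw [Preadditive.comp_sum, Finset.sum_eq_single_of_mem
    (⟨(p, q), Finset.HasAntidiagonal.mem_antidiagonal.2 h⟩ : Finset.HasAntidiagonal.antidiagonal n)
    (Finset.mem_univ _)]
  · rw [← Category.assoc, ezTerm_awTerm_proj, MonoidalCategory.tensorHom_def, Category.assoc]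
    rfl
  · intro x _ hne
    have hx := Finset.HasAntidiagonal.mem_antidiagonal.1 x.2
    rw [← Category.assoc, ezTerm_awTerm_proj_of_ne A B h hx, Limits.zero_comp]
    intro hp
    exact hne (Subtype.ext (Prod.ext hp (by simp only; omega)))

/-- The idempotent `PInfty` between the two maps is absorbed by the Alexander–Whitney side, so
shuffles of degenerate simplices need no separate treatment. -/
theorem ez_aw (A B : SimplicialObject (ModuleCat.{u} R)) : ez A B ≫ aw A B = 𝟙 _ := by
  rw [ez, aw, Category.assoc, Category.assoc, ← Category.assoc (proj _), proj_incl, PInfty_awK_proj,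
    ezK_awK_proj, tensorHom_comp_tensorHom, incl_proj, incl_proj, id_tensorHom_id]

/-! ### The composites of `AW^*` and `EZ^*` -/

theorem awStar_ezStar (A : SimplicialObject (ModuleCat.{u} R)) (D : ChainComplex (ModuleCat.{u} R) ℕ) :
    awStar A D ≫ ezStar A D = 𝟙 _ := by
  refine NatTrans.ext (funext fun n => ModuleCat.hom_ext (LinearMap.ext (fun φ => ?_)))
  let φ' : N.obj A ⊗ N.obj ((stdSimplexModule R).obj n.unop) ⟶ D := φ
  change ez A _ ≫ aw A _ ≫ φ' = φ'
  rw [← Category.assoc, ez_aw, Category.id_comp]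

theorem homTensorMap_comp {X X' X'' : ChainComplex (ModuleCat.{u} R) ℕ} (f : X' ⟶ X) (f' : X'' ⟶ X')
    (D : ChainComplex (ModuleCat.{u} R) ℕ) : homTensorMap f D ≫ homTensorMap f' D = homTensorMap (f' ≫ f) D := by
  refine NatTrans.ext (funext fun n => ModuleCat.hom_ext (LinearMap.ext (fun φ => ?_)))
  let φ' : X ⊗ N.obj ((stdSimplexModule R).obj n.unop) ⟶ D := φ
  change f' ▷ _ ≫ f ▷ _ ≫ φ' = (f' ≫ f) ▷ _ ≫ φ'
  rw [comp_whiskerRight, Category.assoc]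

theorem homTensorMap_id (X D : ChainComplex (ModuleCat.{u} R) ℕ) : homTensorMap (𝟙 X) D = 𝟙 _ := by
  refine NatTrans.ext (funext fun n => ModuleCat.hom_ext (LinearMap.ext (fun φ => ?_)))
  let φ' : X ⊗ N.obj ((stdSimplexModule R).obj n.unop) ⟶ D := φ
  change 𝟙 X ▷ _ ≫ φ' = φ'
  rw [id_whiskerRight, Category.id_comp]

theorem awGamma_ezGamma (C D : ChainComplex (ModuleCat.{u} R) ℕ) : awGamma C D ≫ ezGamma C D = 𝟙 _ := by
  simp only [awGamma, ezGamma, Category.assoc, Iso.inv_hom_id_assoc]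
  rw [← Category.assoc (awStar _ _), awStar_ezStar, Category.id_comp, ← Category.assoc (homTensorMap _ _),
    homTensorMap_comp, Iso.inv_hom_id, homTensorMap_id, Category.id_comp, Iso.hom_inv_id]

/-- Transport of a simplicial homotopy along equalities of its ends. -/
def homotopyOfEq {C : Type*} [Category* C] {X Y : SimplicialObject C} {f f' g g' : X ⟶ Y}
    (h : SimplicialObject.Homotopy f g) (e : f' = f) (e' : g' = g) : SimplicialObject.Homotopy f' g' := by
  subst e e'
  exact h

/-- The counits cancel, which exhibits the composite as a conjugate of restriction along `aw ≫ ez`,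
to which the simplicial homotopy can be transported. -/
theorem ezGamma_awGamma (C D : ChainComplex (ModuleCat.{u} R) ℕ) :
    ezGamma C D ≫ awGamma C D = ((sHomGammaIso (Γ.obj C) D).hom ≫ ezStar (Γ.obj C) D ≫ awStar (Γ.obj C) D) ≫
      (sHomGammaIso (Γ.obj C) D).inv := by
  simp only [awGamma, ezGamma, Category.assoc, Iso.inv_hom_id_assoc]
  rw [← Category.assoc (homTensorMap _ _), homTensorMap_comp, Iso.hom_inv_id, homTensorMap_id, Category.id_comp]

/-- The simplicial homotopy from `ezGamma ≫ awGamma` to the identity. -/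
def ezGammaAwGammaHomotopy (C D : ChainComplex (ModuleCat.{u} R) ℕ) :
    SimplicialObject.Homotopy (ezGamma C D ≫ awGamma C D) (𝟙 (sHom (Γ.obj C) (Γ.obj D))) :=
  homotopyOfEq (((ezStarAwStarHomotopy (Γ.obj C) D).precomp (sHomGammaIso (Γ.obj C) D).hom).postcomp
    (sHomGammaIso (Γ.obj C) D).inv) (ezGamma_awGamma C D)
    (by rw [Category.comp_id, Iso.hom_inv_id])

theorem awN_ezN (A B : SimplicialObject (ModuleCat.{u} R)) : awN A B ≫ ezN A B = 𝟙 _ := by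
  rw [awN, ezN, Category.assoc, ← Category.assoc (N.map _), ← N.map_comp]
  have h : ((gammaHomIso (N.obj A) (N.obj B)).hom ≫ awStar A (N.obj B) ≫ (sHomIso A B).inv) ≫
      ((sHomIso A B).hom ≫ ezStar A (N.obj B) ≫ (gammaHomIso (N.obj A) (N.obj B)).inv) = 𝟙 _ := by
    simp only [Category.assoc, Iso.inv_hom_id_assoc]
    rw [← Category.assoc (awStar _ _), awStar_ezStar, Category.id_comp, Iso.hom_inv_id]
  rw [h, N.map_id, Category.id_comp, Iso.inv_hom_id]

theorem ezN_awN (A B : SimplicialObject (ModuleCat.{u} R)) :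
    ezN A B ≫ awN A B = N.map (((sHomIso A B).hom ≫ ezStar A (N.obj B) ≫ awStar A (N.obj B)) ≫ (sHomIso A B).inv) := by
  rw [awN, ezN, Category.assoc, Iso.hom_inv_id_assoc, ← N.map_comp]
  simp only [Category.assoc, Iso.inv_hom_id_assoc]

/-- Expresses `N.map f` through the unnormalized chains, where a simplicial homotopy yields a chain
homotopy. -/
theorem N_map_eq {A B : SimplicialObject (ModuleCat.{u} R)} (f : A ⟶ B) :
    N.map f = (incl A ≫ chains.map f) ≫ proj B := by
  rw [Category.assoc, proj_naturality, ← Category.assoc, incl_proj, Category.id_comp]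

/-- The chain homotopy of normalized chains induced by a simplicial homotopy. -/
def normalizedHomotopy {A B : SimplicialObject (ModuleCat.{u} R)} {f g : A ⟶ B}
    (h : SimplicialObject.Homotopy f g) : Homotopy (N.map f) (N.map g) :=
  (Homotopy.ofEq (N_map_eq f)).trans
    (((h.toChainHomotopy.compLeft (incl A)).compRight (proj B)).trans (Homotopy.ofEq (N_map_eq g).symm))

/-- The chain homotopy equivalence between `(N B)^(N A)` and `N (B^A)`. -/
def awNEquiv (A B : SimplicialObject (ModuleCat.{u} R)) :
    HomotopyEquiv (homComplex (N.obj A) (N.obj B)) (N.obj (sHom A B)) where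
  hom := awN A B
  inv := ezN A B
  homotopyHomInvId := Homotopy.ofEq (awN_ezN A B)
  -- The simplicial homotopy is first conjugated by `sHomIso` and only then normalized.
  homotopyInvHomId := (Homotopy.ofEq (ezN_awN A B)).trans ((normalizedHomotopy
    (((ezStarAwStarHomotopy A (N.obj B)).precomp (sHomIso A B).hom).postcomp (sHomIso A B).inv)).trans
      (Homotopy.ofEq (by rw [Category.comp_id, Iso.hom_inv_id, N.map_id])))

/-! ### Naturality of `AW^*` -/

/-- Functoriality of `Hom(X ⊗ N (R Δ^n), D)` in `D`. -/
def homTensorPost (X : ChainComplex (ModuleCat.{u} R) ℕ) {D D' : ChainComplex (ModuleCat.{u} R) ℕ} (g : D ⟶ D') :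
    homTensor X D ⟶ homTensor X D' :=
  Functor.whiskerLeft (stdSimplexModule R ⋙ N ⋙ tensorLeft X).op ((linearYoneda R _).map g)

/-- Functoriality of `Hom(N (A ⊗ R Δ^n), D)` in `D`. -/
def homNormalizedPost (A : SimplicialObject (ModuleCat.{u} R)) {D D' : ChainComplex (ModuleCat.{u} R) ℕ}
    (g : D ⟶ D') : homNormalized A D ⟶ homNormalized A D' :=
  Functor.whiskerLeft (stdSimplexModule R ⋙ tensorLeft A ⋙ N).op ((linearYoneda R _).map g)

/-- Functoriality of `Hom(N (A ⊗ R Δ^n), D)` in `A`. -/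
def homNormalizedMap {A A' : SimplicialObject (ModuleCat.{u} R)} (f : A' ⟶ A)
    (D : ChainComplex (ModuleCat.{u} R) ℕ) : homNormalized A D ⟶ homNormalized A' D :=
  Functor.whiskerRight (NatTrans.op (Functor.whiskerRight (Functor.whiskerLeft (stdSimplexModule R)
    ((tensoringLeft _).map f)) N)) ((linearYoneda R _).obj D)

theorem homTensorPost_map {X X' D D' : ChainComplex (ModuleCat.{u} R) ℕ} (f : X' ⟶ X) (g : D ⟶ D') :
    homTensorPost X g ≫ homTensorMap f D' = homTensorMap f D ≫ homTensorPost X' g := by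
  refine NatTrans.ext (funext fun n => ModuleCat.hom_ext (LinearMap.ext (fun φ => ?_)))
  let φ' : X ⊗ N.obj ((stdSimplexModule R).obj n.unop) ⟶ D := φ
  exact (Category.assoc (f ▷ _) φ' g).symm

theorem homTensorPost_awStar (A : SimplicialObject (ModuleCat.{u} R)) {D D' : ChainComplex (ModuleCat.{u} R) ℕ}
    (g : D ⟶ D') : homTensorPost (N.obj A) g ≫ awStar A D' = awStar A D ≫ homNormalizedPost A g := by
  refine NatTrans.ext (funext fun n => ModuleCat.hom_ext (LinearMap.ext (fun φ => ?_)))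
  let φ' : N.obj A ⊗ N.obj ((stdSimplexModule R).obj n.unop) ⟶ D := φ
  exact (Category.assoc (aw A _) φ' g).symm

theorem homTensorMap_awStar {A A' : SimplicialObject (ModuleCat.{u} R)} (f : A' ⟶ A)
    (D : ChainComplex (ModuleCat.{u} R) ℕ) :
    homTensorMap (N.map f) D ≫ awStar A' D = awStar A D ≫ homNormalizedMap f D := by
  refine NatTrans.ext (funext fun n => ModuleCat.hom_ext (LinearMap.ext (fun φ => ?_)))
  have h := aw_naturality f (𝟙 ((stdSimplexModule R).obj n.unop))
  rw [N.map_id, tensorHom_id, tensorHom_id] at h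
  let φ' : N.obj A ⊗ N.obj ((stdSimplexModule R).obj n.unop) ⟶ D := φ
  change aw A' _ ≫ N.map f ▷ _ ≫ φ' = N.map (f ▷ _) ≫ aw A _ ≫ φ'
  rw [← Category.assoc, ← Category.assoc, h]

theorem sHomGammaIso_naturality {A A' : SimplicialObject (ModuleCat.{u} R)}
    {D D' : ChainComplex (ModuleCat.{u} R) ℕ} (f : A' ⟶ A) (g : D ⟶ D') :
    sHomMap f (Γ.map g) ≫ (sHomGammaIso A' D').hom =
      (sHomGammaIso A D).hom ≫ homNormalizedMap f D ≫ homNormalizedPost A' g := by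
  refine NatTrans.ext (funext fun n => ModuleCat.hom_ext (LinearMap.ext (fun φ => ?_)))
  let φ' : A ⊗ (stdSimplexModule R).obj n.unop ⟶ Γ.obj D := φ
  change N.map ((f ▷ _ ≫ φ') ≫ Γ.map g) ≫ (dkCounit D').hom = (N.map (f ▷ _) ≫ N.map φ' ≫ (dkCounit D).hom) ≫ g
  rw [N.map_comp, N.map_comp, Category.assoc, dkCounit_naturality, Category.assoc, Category.assoc, Category.assoc]

theorem sHomIso_naturality {A A' B B' : SimplicialObject (ModuleCat.{u} R)} (f : A' ⟶ A) (g : B ⟶ B') :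
    sHomMap f g ≫ (sHomIso A' B').hom =
      (sHomIso A B).hom ≫ homNormalizedMap f (N.obj B) ≫ homNormalizedPost A' (N.map g) := by
  refine NatTrans.ext (funext fun n => ModuleCat.hom_ext (LinearMap.ext (fun φ => ?_)))
  let φ' : A ⊗ (stdSimplexModule R).obj n.unop ⟶ B := φ
  change N.map ((f ▷ _ ≫ φ') ≫ g) = (N.map (f ▷ _) ≫ N.map φ') ≫ N.map g
  rw [N.map_comp, N.map_comp]

theorem HomFam_comp_homComplexMapFam {C C' D D' : ChainComplex (ModuleCat.{u} R) ℕ} (f : C' ⟶ C) (g : D ⟶ D')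
    {n : ℕ} (φ : HomFam C D n) (p m : ℕ) (h : p + n = m) :
    (homComplexMapFam f g n φ).comp p m h = f.f p ≫ φ.comp p m h ≫ g.f m := by
  subst h
  rw [HomFam.comp_rfl, HomFam.comp_rfl]
  rfl

/-- The sign in the tensor-hom bijection depends only on the bidegree, which `f` and `g` preserve.
-/
theorem tensorHomMap_comp_homComplexMap {C C' D D' X : ChainComplex (ModuleCat.{u} R) ℕ} (f : C' ⟶ C)
    (g : D ⟶ D') (φ : X ⟶ homComplex C D) :
    tensorHomMap (φ ≫ homComplexMap f g) = (f ▷ X ≫ tensorHomMap φ) ≫ g := by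
  ext n : 1
  refine HomologicalComplex.mapBifunctor.hom_ext (fun p q h => ?_)
  refine (ι_tensorHomMap _ p q n h).trans ?_
  rw [Category.assoc]
  change _ = _ ≫ (HomologicalComplex.mapBifunctorMap _ _ _ _).f n ≫ (tensorHomMap φ).f n ≫ g.f n
  rw [HomologicalComplex.ι_mapBifunctorMap_assoc]
  refine Eq.trans ?_ (congrArg (fun a => _ ≫ _ ≫ a)
    ((congrArg (· ≫ g.f n) (ι_tensorHomMap φ p q n h)).symm.trans (Category.assoc _ _ _)))
  refine ModuleCat.MonoidalCategory.tensor_ext (fun c x => ?_)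
  have h1 := congrArg (fun a => a.hom c) (HomFam_comp_homComplexMapFam f g (ev φ q x) p n h)
  change (-1 : ℤ) ^ (p * q) • ((homComplexMapFam f g q (ev φ q x)).comp p n h).hom c =
    (g.f n).hom ((-1 : ℤ) ^ (p * q) • ((ev φ q x).comp p n h).hom ((f.f p).hom c))
  rw [map_zsmul]
  exact congrArg ((-1 : ℤ) ^ (p * q) • ·) h1

theorem gammaHomIso_naturality {C C' D D' : ChainComplex (ModuleCat.{u} R) ℕ} (f : C' ⟶ C) (g : D ⟶ D') :
    Γ.map (homComplexMap f g) ≫ (gammaHomIso C' D').hom =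
      (gammaHomIso C D).hom ≫ homTensorMap f D ≫ homTensorPost C' g := by
  -- The Yoneda isomorphism is evaluation at the universal simplex, so its naturality is
  -- definitional.
  have hy : Functor.whiskerLeft (stdSimplexModule R).op ((linearYoneda R _).map (Γ.map (homComplexMap f g))) ≫
      (yonedaIso (Γ.obj (homComplex C' D'))).hom =
      (yonedaIso (Γ.obj (homComplex C D))).hom ≫ Γ.map (homComplexMap f g) := rfl
  rw [← cancel_epi (yonedaIso (Γ.obj (homComplex C D))).hom, ← Category.assoc, ← hy]
  simp only [gammaHomIso, Iso.trans_hom, Iso.symm_hom, Category.assoc, Iso.hom_inv_id_assoc]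
  -- Once the Yoneda isomorphism is cancelled, an `n`-simplex is a map `R Δ^n → Γ (D^C)`, and the
  -- remaining identifications can be evaluated on it.
  refine NatTrans.ext (funext fun n => ModuleCat.hom_ext (LinearMap.ext (fun φ => ?_)))
  let φ' : (stdSimplexModule R).obj n.unop ⟶ Γ.obj (homComplex C D) := φ
  change tensorHomMap (N.map (φ' ≫ Γ.map (homComplexMap f g)) ≫ (dkCounit _).hom) =
    (f ▷ _ ≫ tensorHomMap (N.map φ' ≫ (dkCounit _).hom)) ≫ g
  rw [N.map_comp, Category.assoc, dkCounit_naturality, ← Category.assoc, tensorHomMap_comp_homComplexMap]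

theorem awGamma_naturality {C C' D D' : ChainComplex (ModuleCat.{u} R) ℕ} (f : C' ⟶ C) (g : D ⟶ D') :
    Γ.map (homComplexMap f g) ≫ awGamma C' D' = awGamma C D ≫ sHomMap (Γ.map f) (Γ.map g) := by
  rw [← cancel_mono (sHomGammaIso (Γ.obj C') D').hom]
  simp only [awGamma, Category.assoc, Iso.inv_hom_id, Category.comp_id, sHomGammaIso_naturality,
    Iso.inv_hom_id_assoc]
  rw [← Category.assoc, gammaHomIso_naturality, Category.assoc, Category.assoc,
    ← Category.assoc (homTensorPost _ _), homTensorPost_map, Category.assoc, homTensorPost_awStar,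
    -- The counit trades `f` for `N Γ f`, to which the naturality of `aw` in simplicial modules
    -- applies.
    ← Category.assoc (homTensorMap f D), homTensorMap_comp, ← dkCounit_naturality, ← homTensorMap_comp,
    Category.assoc, ← Category.assoc (homTensorMap (N.map _) D), homTensorMap_awStar, Category.assoc]

theorem awN_naturality {A A' B B' : SimplicialObject (ModuleCat.{u} R)} (f : A' ⟶ A) (g : B ⟶ B') :
    homComplexMap (N.map f) (N.map g) ≫ awN A' B' = awN A B ≫ N.map (sHomMap f g) := by
  -- The square is checked for simplicial modules and then normalized; `h'` moves the inverse counit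
  -- past the resulting map.
  have h : Γ.map (homComplexMap (N.map f) (N.map g)) ≫ (gammaHomIso (N.obj A') (N.obj B')).hom ≫
      awStar A' (N.obj B') ≫ (sHomIso A' B').inv =
      ((gammaHomIso (N.obj A) (N.obj B)).hom ≫ awStar A (N.obj B) ≫ (sHomIso A B).inv) ≫ sHomMap f g := by
    rw [← cancel_mono (sHomIso A' B').hom]
    simp only [Category.assoc, Iso.inv_hom_id, Category.comp_id, sHomIso_naturality, Iso.inv_hom_id_assoc]
    rw [← Category.assoc, gammaHomIso_naturality, Category.assoc, Category.assoc, homTensorPost_awStar,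
      ← Category.assoc (homTensorMap _ _), homTensorMap_awStar, Category.assoc]
  have h' : homComplexMap (N.map f) (N.map g) ≫ (dkCounit (homComplex (N.obj A') (N.obj B'))).inv =
      (dkCounit (homComplex (N.obj A) (N.obj B))).inv ≫ N.map (Γ.map (homComplexMap (N.map f) (N.map g))) := by
    rw [Iso.comp_inv_eq, Category.assoc, dkCounit_naturality, Iso.inv_hom_id_assoc]
  rw [awN, awN, Category.assoc, ← N.map_comp, ← h, ← Category.assoc, h', Category.assoc,
    ← N.map_comp]

end
end DoldKanHom

open DoldKanHom
theorem theorem8p3 (R : Type u) [CommRing R] :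
    (∀ C D : ChainComplex (ModuleCat.{u} R) ℕ,
      Nonempty (SimplicialObject.Homotopy (awGamma C D ≫ ezGamma C D) (𝟙 (Γ.obj (homComplex C D)))) ∧
      Nonempty (SimplicialObject.Homotopy (ezGamma C D ≫ awGamma C D)
        (𝟙 (sHom (Γ.obj C) (Γ.obj D))))) ∧
    (∀ (C C' D D' : ChainComplex (ModuleCat.{u} R) ℕ) (f : C' ⟶ C) (g : D ⟶ D'),
      Γ.map (homComplexMap f g) ≫ awGamma C' D' = awGamma C D ≫ sHomMap (Γ.map f) (Γ.map g)) ∧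
    (∀ A B : SimplicialObject (ModuleCat.{u} R),
      ∃ e : HomotopyEquiv (homComplex (N.obj A) (N.obj B)) (N.obj (sHom A B)),
        e.hom = awN A B ∧ e.inv = ezN A B) ∧
    (∀ (A A' B B' : SimplicialObject (ModuleCat.{u} R)) (f : A' ⟶ A) (g : B ⟶ B'),
      homComplexMap (N.map f) (N.map g) ≫ awN A' B' = awN A B ≫ N.map (sHomMap f g)) :=
  -- The first composite equals the identity, so the constant homotopy suffices there.
  ⟨fun C D => ⟨⟨homotopyOfEq (.refl (𝟙 _)) (awGamma_ezGamma C D) rfl⟩, ⟨ezGammaAwGammaHomotopy C D⟩⟩,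
    fun _ _ _ _ f g => awGamma_naturality f g, fun A B => ⟨awNEquiv A B, rfl, rfl⟩,
    fun _ _ _ _ f g => awN_naturality f g⟩
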